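/- **Setting.** Let $\Omega\subset\mathbb R^d$ be open and $V=H^1_0(\Omega)$. Let $\kappa:\Omega\times\mathbb R^d\to\mathbb R^d$ be measurable in $x$ with $\kappa(x,0)=0$, and let $\overline\kappa\in L^\infty(\Omega)$, $C_1,C_2>0$ satisfy, for a.e. $x\in\Omega$ and all $z,v\in\mathbb R^d$, $$|\kappa(x,z)-\kappa(x,v)|\le C_1\overline\kappa(x)|z-v|,\qquad (\kappa(x,z)-\kappa(x,v))\cdot(z-v)\ge C_2\,\overline\kappa(x)|z-v|^2 .$$ Let $u\in V$ be the weak solution of the problem with source $f$ and $u=0$ on $\partial\Omega$, i.e. $\int_\Omega\kappa(x,\nabla u)\cdot\nabla w=\int_\Omega fw$ for all $w\in V$. Let $\mathcal T_H$ be a finite coarse mesh of $\Omega$: disjoint open cells $K\subset\Omega$ that fill $\Omega$ up to a null set, each of diameter at most $H$ and containing a ball of radius $\rho H$. For a cell $K$ let $K_0^+=K$, let $K_{m+1}^+$ be obtained from $K_m^+$ by adding all cells whose closure meets the closure of a cell of $K_m^+$, and regard $K_m^+$ as the open set $\Omega\cap\mathrm{int}\bigcup\overline{K'}$ over its cells $K'$.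 Let $0\le\chi_i\le1$ be a Lipschitz partition of unity on $\Omega$ with nodes $x_i$ such that $\chi_i=0$ on all cells whose closure does not contain $x_i$; the closure of each cell contains at most $\nu$ nodes. Put $\tilde\kappa=\overline\kappa\sum_i|\nabla\chi_i|^2$, assumed positive a.e. in $\Omega$, and $$\|v\|_{a(\omega)}^2=\int_\omega\overline\kappa|\nabla v|^2,\qquad s_\omega(v,w)=\int_\omega\tilde\kappa vw,\qquad \|v\|_{s(\omega)}^2=s_\omega(v,v),$$ with $\omega=\Omega$ when omitted. Let finitely many $\mu_{i,j}\in L^\infty(\Omega)$ be given, with $\mu_{i,j}=0$ on the cells other than $K_i$; $V_{aux}$ is their span, $V_{aux}(K_i)$ the span of the $\mu_{i,j}$ with $i$ fixed, $V_{aux}(K_M^+)$ the span of those whose cell lies in $K_M^+$. Let $\Pi$ be the $s$-orthogonal projection onto $V_{aux}$; on a single cell $K$ it is the $s_K$-orthogonal projection onto $V_{aux}(K)$. Assume that $f$ is measurable with $\int_\Omega f^2/\tilde\kappa<\infty$. **Assumptions.** With a constant $C_0$ and a constant $C_\kappa>0$: 1. $\|(I-\Pi)v\|_{s(K)}\le C_0H\|v\|_{a(K)}$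 for every cell $K$ and $v\in V$ (restricted to $K$); 2. for every cell $K$ and $v_{aux}\in V_{aux}(K)$ there is $w\in H^1_0(K)$ with $\|v_{aux}\|_{s(K)}^2\le s_K(v_{aux},w)$ and $\|w\|_{a(K)}\le C_0\|v_{aux}\|_{s(K)}$; 3. $\|v\|_s\le C_\kappa\|v\|_a$ for all $v\in V$. **Method.** Let $M\ge1$. For $U\in V_{aux}$ and a cell $K$, $F_1^{loc,K}(U)\in H^1_0(K_M^+)$ and $F_2^{loc,K}(U)\in V_{aux}(K_M^+)$ solve $$\int_{K_M^+}\kappa(x,\nabla F_1^{loc,K}(U))\cdot\nabla v-s_{K_M^+}(F_2^{loc,K}(U),v)=0\quad\forall v\in H^1_0(K_M^+),$$ $$s_{K_M^+}(F_1^{loc,K}(U),\mu_{i,j})=s(U,\mu_{i,j})\quad\text{for all }\mu_{i,j}\text{ with }K_i\subset K_M^+ .$$ Let $U_{ms}\in V_{aux}$ be a solution of $\sum_K s_K(F_2^{loc,K}(U_{ms}),v)=\int_\Omega fv$ for all $v\in V_{aux}$, and let $F_1^{ms}(U_{ms})=\sum_K\chi_KF_1^{loc,K}(U_{ms})$, where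 $\chi_K\ge0$ are Lipschitz on $\Omega$, $\sum_K\chi_K=1$ on $\Omega$, $\chi_K=0$ outside the union of the closures of the cells of $K_1^+$, and $\sum_K|\nabla\chi_K|^2\le C_\chi\sum_i|\nabla\chi_i|^2$ a.e. **Theorem.** For all $d,\nu,\rho>0,C_0>0,C_\chi>0$ and $H_{\max}>0$ there is a constant $C>1$ depending only on these, and for all $C_1,C_2>0$ there is a constant $c>0$ depending only on these and on $C_1,C_2$, such that in the above setting with $0<H\le H_{\max}$ one has $F_1^{ms}(U_{ms})\in H^1_0(\Omega)$ and $$\|F_1^{ms}(U_{ms})-u\|_a\le C\,C_2^{-1}H\,\|(I-\Pi)(f\tilde\kappa^{-1})\|_s+C_1(M)+C_2(M),$$ where $$C_1(M)=C\,C_1C_2^{-1}(1-C^{-1}C_1^{-1}C_2)^{M/2}M^{d/2}\|U_{ms}\|_s,$$ $$C_2(M)=C\,C_\kappa C_1^2C_2^{-2}(1-C^{-1}C_1^{-1}C_2)^{M/2}M^{d/2}\|U_{ms}\|_s .$$ Moreover, if $H\le\frac12$ and $M\ge c\,\big(\log(H^{-1})+\log\max\{1,C_\kappa\}\big)$, then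 $$\|F_1^{ms}(U_{ms})-u\|_a\le C H\big(C_2^{-1}\|(I-\Pi)(f\tilde\kappa^{-1})\|_s+\|u\|_a\big).$$ -/

import Mathlib

open Filter Topology MeasureTheory

noncomputable section

namespace NLMC

/-- `ℝ^d` with the Euclidean norm. -/
abbrev E (d : ℕ) : Type := EuclideanSpace ℝ (Fin d)

/-- The space `H¹₀(ω)`: the closure of `C_c^∞(ω)` in the `H¹` norm. An element is a function together
with its weak gradient (which the function determines almost everywhere), both extended by zero to
the whole space: the convergence in `L²(ℝ^d)` forces both to vanish a.e. outside `ω`. -/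
structure H10 {d : ℕ} (ω : Set (E d)) where
  val : E d → ℝ
  grad : E d → E d
  memLp_val : MemLp val 2 volume
  memLp_grad : MemLp grad 2 volume
  approx : ∃ φ : ℕ → E d → ℝ,
    (∀ n, ContDiff ℝ (⊤ : ℕ∞) (φ n) ∧ HasCompactSupport (φ n) ∧ tsupport (φ n) ⊆ ω) ∧
    Tendsto (fun n => eLpNorm (fun x => φ n x - val x) 2 volume) atTop (𝓝 0) ∧
    Tendsto (fun n => eLpNorm (fun x => gradient (φ n) x - grad x) 2 volume) atTop (𝓝 0)

/-- A monotone heterogeneous flux `κ(x,v)` on `Ω`, with its weight `κ̄ ∈ L^∞(Ω)`, Lipschitz constant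
`C₁` and monotonicity constant `C₂`. -/
structure Flux {d : ℕ} (Ω : Set (E d)) (C₁ C₂ : ℝ) where
  flux : E d → E d → E d
  bar : E d → ℝ
  bar_memLp : MemLp bar ⊤ (volume.restrict Ω)
  meas : ∀ v, AEStronglyMeasurable (fun x => flux x v) (volume.restrict Ω)
  zero : ∀ᵐ x ∂volume.restrict Ω, flux x 0 = 0
  lipschitz : ∀ᵐ x ∂volume.restrict Ω, ∀ z v,
    ‖flux x z - flux x v‖ ≤ C₁ * bar x * ‖z - v‖
  monotone : ∀ᵐ x ∂volume.restrict Ω, ∀ z v,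
    C₂ * bar x * ‖z - v‖ ^ 2 ≤ inner ℝ (flux x z - flux x v) (z - v)

/-- A coarse mesh of `Ω` of mesh size `H` with cells indexed by `ι`: the cells are disjoint open
subsets that fill `Ω` up to a null set, have diameter at most `H` and contain a ball of radius
`ρ H`. It comes with a Lipschitz partition of unity `χ_j` (as the usual nodal hat functions):
`χ_j` vanishes on all the cells that do not touch the node `x_j`, and every cell touches at most
`ν` nodes. -/
structure CoarseMesh {d : ℕ} (Ω : Set (E d)) (ι J : Type) [Fintype ι] [Fintype J]
    (H ρ : ℝ) (ν : ℕ) where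
  cell : ι → Set (E d)
  isOpen_cell : ∀ i, IsOpen (cell i)
  cell_subset : ∀ i, cell i ⊆ Ω
  disjoint_cell : ∀ i k, i ≠ k → Disjoint (cell i) (cell k)
  cover : volume (Ω \ ⋃ i, cell i) = 0
  diam_le : ∀ i, ∀ x ∈ cell i, ∀ y ∈ cell i, dist x y ≤ H
  ball_subset : ∀ i, ∃ x, Metric.ball x (ρ * H) ⊆ cell i
  node : J → E d
  node_count : ∀ i, {j | node j ∈ closure (cell i)}.ncard ≤ ν
  hat : J → E d → ℝ
  hat_lipschitz : ∀ j, ∃ L, LipschitzOnWith L (hat j) Ω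
  hat_nonneg : ∀ j, ∀ x ∈ Ω, 0 ≤ hat j x
  hat_le_one : ∀ j, ∀ x ∈ Ω, hat j x ≤ 1
  hat_sum : ∀ x ∈ Ω, ∑ j, hat j x = 1
  hat_support : ∀ j i, node j ∉ closure (cell i) → ∀ x ∈ cell i, hat j x = 0

namespace CoarseMesh

variable {d : ℕ} {Ω : Set (E d)} {ι J : Type} [Fintype ι] [Fintype J] {H ρ : ℝ} {ν : ℕ}

/-- The indices of the cells in the enlargement of `K_i` by `m` coarse layers; one layer adds all
the cells whose closures meet the closure of a cell that is already there. -/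
def layer (T : CoarseMesh Ω ι J H ρ ν) (i : ι) : ℕ → Set ι
  | 0 => {i}
  | m + 1 => {k | ∃ l ∈ T.layer i m, (closure (T.cell l) ∩ closure (T.cell k)).Nonempty}

/-- The oversampling region `K_m^+` of the cell `K = K_i`, as an open subset of `Ω`. -/
def region (T : CoarseMesh Ω ι J H ρ ν) (i : ι) (m : ℕ) : Set (E d) :=
  Ω ∩ interior (⋃ k ∈ T.layer i m, closure (T.cell k))

/-- The weight `κ̃ = κ̄ ∑_j |∇χ_j|²`. -/
def weight (T : CoarseMesh Ω ι J H ρ ν) {C₁ C₂ : ℝ} (A : Flux Ω C₁ C₂) (x : E d) : ℝ :=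
  A.bar x * ∑ j, ‖gradient (T.hat j) x‖ ^ 2

end CoarseMesh

variable {d : ℕ} {Ω : Set (E d)} {ι J : Type} [Fintype ι] [Fintype J] {H ρ : ℝ} {ν : ℕ}
  {C₁ C₂ : ℝ}

/-- `A_ω(u,w) = ∫_ω κ(x,∇u)·∇w`, in terms of the gradients. -/
def energyForm (A : Flux Ω C₁ C₂) (ω : Set (E d)) (Du Dw : E d → E d) : ℝ :=
  ∫ x in ω, inner ℝ (A.flux x (Du x)) (Dw x)

/-- `‖u‖_{a(ω)} = (∫_ω κ̄ |∇u|²)^{1/2}`, in terms of the gradient. -/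
def aNorm (A : Flux Ω C₁ C₂) (ω : Set (E d)) (Du : E d → E d) : ℝ :=
  Real.sqrt (∫ x in ω, A.bar x * ‖Du x‖ ^ 2)

/-- `s_ω(u,w) = ∫_ω κ̃ u w`, for a weight `κ̃`. -/
def sForm (kt : E d → ℝ) (ω : Set (E d)) (u w : E d → ℝ) : ℝ :=
  ∫ x in ω, kt x * u x * w x

/-- `‖u‖_{s(ω)}`. -/
def sNorm (kt : E d → ℝ) (ω : Set (E d)) (u : E d → ℝ) : ℝ :=
  Real.sqrt (sForm kt ω u u)

/-- The continua: finitely many functions `μ_{i,j} ∈ L^∞(Ω)` for each cell `K_i`, which vanish on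
the other cells. -/
structure Continua (T : CoarseMesh Ω ι J H ρ ν) where
  num : ι → ℕ
  fn : (i : ι) → Fin (num i) → E d → ℝ
  memLp_fn : ∀ i j, MemLp (fn i j) ⊤ (volume.restrict Ω)
  support_fn : ∀ i j k, k ≠ i → ∀ x ∈ T.cell k, fn i j x = 0

/-- The span of the `μ_{i,j}` with `i ∈ S`: `V_aux` for the set of all cells, `V_aux(K_i)` for
`S = {i}`, `V_aux(K_M^+)` for the cells in `K_M^+`. -/
def Continua.aux {T : CoarseMesh Ω ι J H ρ ν} (B : Continua T) (S : Set ι) :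
    Submodule ℝ (E d → ℝ) :=
  Submodule.span ℝ {g | ∃ i ∈ S, ∃ j, g = B.fn i j}

/-- `p = Π v`, the `s_ω`-orthogonal projection of `v` onto the space `V` (unique up to functions of
`s_ω`-norm zero). -/
def IsProj (kt : E d → ℝ) (ω : Set (E d)) (V : Submodule ℝ (E d → ℝ)) (v p : E d → ℝ) : Prop :=
  p ∈ V ∧ ∀ q ∈ V, sForm kt ω p q = sForm kt ω v q

/-- First assumption: `‖(I - Π)v‖_{s(K)} ≤ C H ‖v‖_{a(K)}` for every cell `K` and `v ∈ V(K)`, where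
`V(K)` consists of the restrictions to `K` of the functions in `V = H¹₀(Ω)`. -/
def CoarseApproximation {T : CoarseMesh Ω ι J H ρ ν} (A : Flux Ω C₁ C₂) (B : Continua T)
    (C : ℝ) : Prop :=
  ∀ (i : ι) (v : H10 Ω) (p : E d → ℝ), IsProj (T.weight A) (T.cell i) (B.aux {i}) v.val p →
    sNorm (T.weight A) (T.cell i) (fun x => v.val x - p x) ≤ C * H * aNorm A (T.cell i) v.grad

/-- Second assumption: the inf-sup-type condition for `V_aux`. -/
def InfSup {T : CoarseMesh Ω ι J H ρ ν} (A : Flux Ω C₁ C₂) (B : Continua T) (C : ℝ) : Prop :=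
  ∀ (i : ι), ∀ v ∈ B.aux {i}, ∃ w : H10 (T.cell i),
    sNorm (T.weight A) (T.cell i) v ^ 2 ≤ sForm (T.weight A) (T.cell i) v w.val ∧
    aNorm A (T.cell i) w.grad ≤ C * sNorm (T.weight A) (T.cell i) v

/-- Third assumption: the weighted Poincaré inequality `‖v‖_s ≤ C_κ ‖v‖_a` on `H¹₀(Ω)`. -/
def WeightedPoincare (T : CoarseMesh Ω ι J H ρ ν) (A : Flux Ω C₁ C₂) (Ck : ℝ) : Prop :=
  ∀ v : H10 Ω, sNorm (T.weight A) Ω v.val ≤ Ck * aNorm A Ω v.grad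

/-- `u ∈ H¹₀(Ω)` is the weak solution: `∫_Ω κ(x,∇u)·∇w = ∫_Ω f w` for all `w ∈ H¹₀(Ω)`. -/
def IsWeakSolution (A : Flux Ω C₁ C₂) (f : E d → ℝ) (u : H10 Ω) : Prop :=
  ∀ w : H10 Ω, energyForm A Ω u.grad w.grad = ∫ x in Ω, f x * w.val x

/-- `(F₁, F₂) = (F₁^{loc,K}(U), F₂^{loc,K}(U))` for `K = K_i`: the solution of the local problem on
the `M`-layer oversampling region, constrained by the continua `U_{k,j} = s(U, μ_{k,j})` of
`U ∈ V_aux`. -/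
structure IsLocalDownscaling {T : CoarseMesh Ω ι J H ρ ν} (A : Flux Ω C₁ C₂) (B : Continua T)
    (M : ℕ) (i : ι) (U : E d → ℝ) (F₁ : H10 (T.region i M)) (F₂ : E d → ℝ) : Prop where
  mem_aux : F₂ ∈ B.aux (T.layer i M)
  equation : ∀ v : H10 (T.region i M),
    energyForm A (T.region i M) F₁.grad v.grad
      - sForm (T.weight A) (T.region i M) F₂ v.val = 0
  constraint : ∀ k ∈ T.layer i M, ∀ j,
    sForm (T.weight A) (T.region i M) F₁.val (B.fn k j) = sForm (T.weight A) Ω U (B.fn k j)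

/-- `U = U_ms ∈ V_aux` solves the coarse system, and `(F₁ i, F₂ i)` are its local downscalings. -/
structure IsNLMCSolution {T : CoarseMesh Ω ι J H ρ ν} (A : Flux Ω C₁ C₂) (B : Continua T)
    (M : ℕ) (f : E d → ℝ) (U : E d → ℝ) (F₁ : (i : ι) → H10 (T.region i M))
    (F₂ : ι → E d → ℝ) : Prop where
  mem_aux : U ∈ B.aux Set.univ
  downscaling : ∀ i, IsLocalDownscaling A B M i U (F₁ i) (F₂ i)
  coarse : ∀ v ∈ B.aux Set.univ,
    ∑ i, sForm (T.weight A) (T.cell i) (F₂ i) v = ∫ x in Ω, f x * v x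

/-- The partition of unity `χ_K` that glues the local solutions: `χ_K` is supported in the
one-layer neighbourhood of `K`, and `∑_K |∇χ_K|² ≤ C ∑_j |∇χ_j|²`. -/
structure IsGluing (T : CoarseMesh Ω ι J H ρ ν) (C : ℝ) (χ : ι → E d → ℝ) : Prop where
  lipschitz : ∀ i, ∃ L, LipschitzOnWith L (χ i) Ω
  nonneg : ∀ i, ∀ x ∈ Ω, 0 ≤ χ i x
  sum_eq : ∀ x ∈ Ω, ∑ i, χ i x = 1
  support : ∀ i, ∀ x ∈ Ω, x ∉ (⋃ k ∈ T.layer i 1, closure (T.cell k)) → χ i x = 0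
  grad_le : ∀ᵐ x ∂volume.restrict Ω,
    ∑ i, ‖gradient (χ i) x‖ ^ 2 ≤ C * ∑ j, ‖gradient (T.hat j) x‖ ^ 2

/-- The first localization error, for `S = ‖U_ms‖_s`. -/
def locError₁ (C C₁ C₂ : ℝ) (d M : ℕ) (S : ℝ) : ℝ :=
  C * C₁ * C₂⁻¹ * (1 - C⁻¹ * C₁⁻¹ * C₂) ^ ((M : ℝ) / 2) * (M : ℝ) ^ ((d : ℝ) / 2) * S

/-- The second localization error, for `S = ‖U_ms‖_s`; here `Ck` is `C_κ`. -/
def locError₂ (C Ck C₁ C₂ : ℝ) (d M : ℕ) (S : ℝ) : ℝ :=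
  C * Ck * C₁ ^ 2 * (C₂⁻¹) ^ 2 * (1 - C⁻¹ * C₁⁻¹ * C₂) ^ ((M : ℝ) / 2)
    * (M : ℝ) ^ ((d : ℝ) / 2) * S

end NLMC

end

/-!
Why the multiscale method is accurate. Everything rests on a comparison of the local solutions of
two neighbouring cells, so that no global downscaling operator (and no existence theory for
monotone problems) is needed.

*Decay.* On the layers of `K` that belong to both oversampling regions, the local solutions of `K`
and of a neighbour `K'` satisfy the same equation with multipliers in `V_aux`, and their difference
is `s`-orthogonal to `V_aux`. Testing with the difference times a cutoff that is `1` on `K_n^+` and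
`0` outside `K_{n+1}^+`, the multipliers drop out where the cutoff is `1`. In the outermost layer
the term with the gradient of the cutoff is bounded by `CoarseApproximation`, and the term with the
multipliers by `InfSup`. Hence the energy of the difference in `K_n^+` is at most a multiple of its
energy in the layer `K_{n+1}^+ \ K_n^+` (`IsLocalDownscaling.sum_layer_le`). Iteration over the
layers gives exponential decay on `K` itself. Summed over all cells, with the overlap
of the oversampling regions counted by volumes, this bounds the total discrepancy `jumpSq`
by the norm of `U_ms` (`jumpSq_le`).

*Gluing and consistency.* On a cell `K` the glued function differs from the local solution of `K`
only through differences of neighbouring local solutions (`aNorm_glued_sub_sq_le`). The local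
equations, tested with `χ_K v`, add up to the statement that the local fluxes and multipliers, each
restricted to its own cell, satisfy the global equation up to the same discrepancy
(`sq_sum_energyForm_sub_le`). By the coarse system, the multipliers act on the projection of `v` as
the source does, which leaves `(I - Π)(f / κ̃)` tested with `(I - Π) v`
(`sum_sForm_sub_integral_le`).
Monotonicity of the flux turns these estimates into the error bound `mul_aNorm_error_le`.

*Constants.* If `U_ms ≠ 0`, then the inf-sup condition forces `C_κ` to be bounded below
(`one_le_mul_poincare`), so the whole discrepancy term is absorbed into the second localization
error. For the last estimate, `‖U_ms‖_s` is bounded by `C_κ` times the energy norms of `u` and of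
the error (`sNorm_coarse_sq_le`), and for many layers the localization factor is so small
(`exists_forall_mul_pow_le`) that the error can be absorbed (`error_le_of_small`).

The analytic prerequisite is that products of functions in `H¹₀(Ω)` with Lipschitz cutoffs vanishing
outside an open subset `ω` lie in `H¹₀(ω)`, where `H¹₀` is the closure of the test functions and `ω`
has no boundary regularity (`IsH10.exists_mul_lipschitz`). It is proved with cutoffs of the distance
to the complement, and mollification.
-/

noncomputable section

namespace NLMC

/-! ### The space `H¹₀` as a set of pairs of functions and gradients -/

section

/-- Dominated convergence in `L²`, with a bound that is constant on a set of finite measure. -/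
theorem tendsto_eLpNorm_two_zero_of_dominated {α F : Type*} [MeasurableSpace α] {μ : Measure α}
    [NormedAddCommGroup F] {f : ℕ → α → F} {S : Set α} (hS : MeasurableSet S) (hμ : μ S ≠ ⊤)
    (B : ℝ) (hmeas : ∀ n, AEStronglyMeasurable (f n) μ)
    (hb : ∀ n, ∀ᵐ x ∂μ, ‖f n x‖ ≤ S.indicator (fun _ => B) x)
    (hlim : ∀ᵐ x ∂μ, Tendsto (fun n => f n x) atTop (𝓝 0)) :
    Tendsto (fun n => eLpNorm (f n) 2 μ) atTop (𝓝 0) := by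
  simp_rw [eLpNorm_eq_lintegral_rpow_enorm_toReal (two_ne_zero) (ENNReal.ofNat_ne_top (n := 2))]
  have h1 : Tendsto (fun n => ∫⁻ x, ‖f n x‖ₑ ^ (2 : ENNReal).toReal ∂μ) atTop (𝓝 (∫⁻ x, 0 ∂μ)) := by
    refine tendsto_lintegral_of_dominated_convergence'
      (S.indicator (fun _ => ENNReal.ofReal B ^ (2 : ENNReal).toReal)) ?_ ?_ ?_ ?_
    · exact fun n => (hmeas n).enorm.pow_const _
    · intro n
      filter_upwards [hb n] with x hx
      by_cases hxS : x ∈ S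
      · simp only [Set.indicator_of_mem hxS] at hx ⊢
        gcongr
        rw [← ofReal_norm]
        exact ENNReal.ofReal_le_ofReal hx
      · simp only [Set.indicator_of_notMem hxS] at hx ⊢
        have : f n x = 0 := norm_le_zero_iff.1 hx
        simp [this]
    · rw [lintegral_indicator hS, lintegral_const]
      simp only [Measure.restrict_apply MeasurableSet.univ, Set.univ_inter]
      exact ENNReal.mul_ne_top (by simp) hμ
    · filter_upwards [hlim] with x hx
      have h2 : Tendsto (fun n => ‖f n x‖ₑ) atTop (𝓝 0) := by
        simpa [Function.comp_def] using (continuous_enorm.tendsto _).comp hx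
      have h3 := (ENNReal.continuous_rpow_const (y := (2 : ENNReal).toReal)).tendsto 0
      simpa [Function.comp_def] using h3.comp h2
  have h3 := (ENNReal.continuous_rpow_const (y := 1 / (2 : ENNReal).toReal)).tendsto 0
  simp only [lintegral_zero] at h1
  simpa [Function.comp_def] using h3.comp h1

variable {d : ℕ}

theorem measurable_gradient (f : E d → ℝ) : Measurable (gradient f) :=
  (InnerProductSpace.toDual ℝ (E d)).symm.continuous.measurable.comp (measurable_fderiv ℝ f)

theorem norm_gradient (f : E d → ℝ) (x : E d) : ‖gradient f x‖ = ‖fderiv ℝ f x‖ :=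
  (InnerProductSpace.toDual ℝ (E d)).symm.norm_map _

theorem norm_gradient_le_of_lipschitz {f : E d → ℝ} {L : NNReal} (hf : LipschitzWith L f)
    (x : E d) : ‖gradient f x‖ ≤ L := by
  rw [norm_gradient]; exact norm_fderiv_le_of_lipschitz ℝ hf

theorem gradient_eq_zero_of_notMem_tsupport {f : E d → ℝ} {x : E d} (hx : x ∉ tsupport f) :
    gradient f x = 0 := by
  have : f =ᶠ[𝓝 x] fun _ => 0 := notMem_tsupport_iff_eventuallyEq.1 hx
  rw [this.gradient_eq]; exact gradient_fun_const x 0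

theorem gradient_add' {f g : E d → ℝ} {x : E d} (hf : DifferentiableAt ℝ f x)
    (hg : DifferentiableAt ℝ g x) :
    gradient (fun y => f y + g y) x = gradient f x + gradient g x := by
  unfold gradient; rw [fderiv_fun_add hf hg, map_add]

theorem gradient_mul' {f g : E d → ℝ} {x : E d} (hf : DifferentiableAt ℝ f x)
    (hg : DifferentiableAt ℝ g x) :
    gradient (fun y => f y * g y) x = f x • gradient g x + g x • gradient f x := by
  unfold gradient
  rw [fderiv_fun_mul hf hg, map_add]; simp

/-- `v ∈ H¹₀(ω)` with weak gradient `D`: the pair underlies an element of the structure `H10 ω`. In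
this form the vector space operations act on functions and gradients separately. -/
def IsH10 (ω : Set (E d)) (v : E d → ℝ) (D : E d → E d) : Prop :=
  ∃ z : H10 ω, z.val = v ∧ z.grad = D

variable {ω ω' : Set (E d)} {v v' : E d → ℝ} {D D' : E d → E d}

theorem H10.isH10 (z : H10 ω) : IsH10 ω z.val z.grad := ⟨z, rfl, rfl⟩

theorem IsH10.memLp_val (h : IsH10 ω v D) : MemLp v 2 volume := by
  obtain ⟨z, rfl, rfl⟩ := h; exact z.memLp_val

theorem IsH10.memLp_grad (h : IsH10 ω v D) : MemLp D 2 volume := by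
  obtain ⟨z, rfl, rfl⟩ := h; exact z.memLp_grad

theorem IsH10.mono (h : IsH10 ω v D) (hω : ω ⊆ ω') : IsH10 ω' v D := by
  obtain ⟨z, rfl, rfl⟩ := h
  obtain ⟨φ, h1, h2, h3⟩ := z.approx
  exact ⟨⟨z.val, z.grad, z.memLp_val, z.memLp_grad, φ,
    fun n => ⟨(h1 n).1, (h1 n).2.1, (h1 n).2.2.trans hω⟩, h2, h3⟩, rfl, rfl⟩

/-- `H¹₀(ω)` is closed under convergence in `L²` of the functions and of their gradients. -/
theorem IsH10.of_tendsto (hv : MemLp v 2 volume) (hD : MemLp D 2 volume) {vn : ℕ → E d → ℝ}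
    {Dn : ℕ → E d → E d} (h : ∀ n, IsH10 ω (vn n) (Dn n))
    (h1 : Tendsto (fun n => eLpNorm (fun x => vn n x - v x) 2 volume) atTop (𝓝 0))
    (h2 : Tendsto (fun n => eLpNorm (fun x => Dn n x - D x) 2 volume) atTop (𝓝 0)) :
    IsH10 ω v D := by
  have key : ∀ n : ℕ, ∃ φ : E d → ℝ,
      (ContDiff ℝ (⊤ : ℕ∞) φ ∧ HasCompactSupport φ ∧ tsupport φ ⊆ ω) ∧
      eLpNorm (fun x => φ x - v x) 2 volume
        ≤ (n + 1 : ENNReal)⁻¹ + eLpNorm (fun x => vn n x - v x) 2 volume ∧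
      eLpNorm (fun x => gradient φ x - D x) 2 volume
        ≤ (n + 1 : ENNReal)⁻¹ + eLpNorm (fun x => Dn n x - D x) 2 volume := by
    intro n
    obtain ⟨z, hz1, hz2⟩ := h n
    obtain ⟨φ, g1, g2, g3⟩ := z.approx
    have hpos : (0 : ENNReal) < (n + 1 : ENNReal)⁻¹ := by
      rw [ENNReal.inv_pos]; finiteness
    obtain ⟨m, hm1, hm2⟩ := ((g2.eventually_le_const hpos).and (g3.eventually_le_const hpos)).exists
    have hc : Continuous (φ m) := (g1 m).1.continuous
    refine ⟨φ m, g1 m, ?_, ?_⟩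
    · refine le_trans (le_of_eq_of_le ?_ (eLpNorm_add_le (f := fun x => φ m x - z.val x)
        (g := fun x => vn n x - v x) ?_ ?_ one_le_two)) (by gcongr)
      · congr 1; ext x; simp [hz1]
      · exact hc.aestronglyMeasurable.sub z.memLp_val.1
      · exact (hz1 ▸ z.memLp_val.1).sub hv.1
    · refine le_trans (le_of_eq_of_le ?_ (eLpNorm_add_le (f := fun x => gradient (φ m) x - z.grad x)
        (g := fun x => Dn n x - D x) ?_ ?_ one_le_two)) (by gcongr)
      · congr 1; ext1 x; simp [hz2]
      · exact (measurable_gradient _).aestronglyMeasurable.sub z.memLp_grad.1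
      · exact (hz2 ▸ z.memLp_grad.1).sub hD.1
  -- diagonal sequence: the `n`-th test function is within `1 / (n + 1)` of the `n`-th element
  choose φ k1 k2 k3 using key
  have hlim : Tendsto (fun n : ℕ => (n + 1 : ENNReal)⁻¹) atTop (𝓝 0) := by
    simpa using (tendsto_add_atTop_iff_nat 1).2 ENNReal.tendsto_inv_nat_nhds_zero
  refine ⟨⟨v, D, hv, hD, φ, k1, ?_, ?_⟩, rfl, rfl⟩
  · exact tendsto_of_tendsto_of_tendsto_of_le_of_le tendsto_const_nhds
      (by simpa using hlim.add h1) (fun _ => zero_le) k2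
  · exact tendsto_of_tendsto_of_tendsto_of_le_of_le tendsto_const_nhds
      (by simpa using hlim.add h2) (fun _ => zero_le) k3

theorem isH10_zero (ω : Set (E d)) : IsH10 ω (fun _ => 0) (fun _ => 0) := by
  refine ⟨⟨fun _ => 0, fun _ => 0, MemLp.zero', MemLp.zero', fun _ _ => 0,
    fun n => ⟨contDiff_const, HasCompactSupport.zero, ?_⟩, ?_, ?_⟩, rfl, rfl⟩
  · have : tsupport (fun _ : E d => (0 : ℝ)) = ∅ := tsupport_eq_empty_iff.2 rfl
    simp [this]
  · simp
  · simp [gradient_fun_const]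

theorem IsH10.add (h : IsH10 ω v D) (h' : IsH10 ω v' D') :
    IsH10 ω (fun x => v x + v' x) (fun x => D x + D' x) := by
  obtain ⟨z, rfl, rfl⟩ := h
  obtain ⟨z', rfl, rfl⟩ := h'
  obtain ⟨φ, h1, h2, h3⟩ := z.approx
  obtain ⟨φ', h1', h2', h3'⟩ := z'.approx
  have hd : ∀ n x, DifferentiableAt ℝ (φ n) x := fun n x =>
    (h1 n).1.differentiable (by simp) x
  have hd' : ∀ n x, DifferentiableAt ℝ (φ' n) x := fun n x =>
    (h1' n).1.differentiable (by simp) x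
  refine ⟨⟨_, _, z.memLp_val.add z'.memLp_val, z.memLp_grad.add z'.memLp_grad,
    fun n x => φ n x + φ' n x, fun n => ⟨(h1 n).1.add (h1' n).1, (h1 n).2.1.add (h1' n).2.1,
      (tsupport_add _ _).trans (Set.union_subset (h1 n).2.2 (h1' n).2.2)⟩, ?_, ?_⟩, rfl, rfl⟩
  · refine tendsto_of_tendsto_of_tendsto_of_le_of_le tendsto_const_nhds
      (by simpa using h2.add h2') (fun _ => zero_le) fun n => ?_
    refine le_of_eq_of_le ?_ (eLpNorm_add_le ?_ ?_ (by norm_num))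
    · congr 1; ext x; simp; ring
    · exact (h1 n).1.continuous.aestronglyMeasurable.sub z.memLp_val.1
    · exact (h1' n).1.continuous.aestronglyMeasurable.sub z'.memLp_val.1
  · refine tendsto_of_tendsto_of_tendsto_of_le_of_le tendsto_const_nhds
      (by simpa using h3.add h3') (fun _ => zero_le) fun n => ?_
    refine le_of_eq_of_le ?_ (eLpNorm_add_le ?_ ?_ (by norm_num))
    · congr 1; ext1 x; simp only [Pi.add_apply]; rw [gradient_add' (hd n x) (hd' n x)]; abel
    · exact (measurable_gradient _).aestronglyMeasurable.sub z.memLp_grad.1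
    · exact (measurable_gradient _).aestronglyMeasurable.sub z'.memLp_grad.1

theorem IsH10.neg (h : IsH10 ω v D) : IsH10 ω (fun x => -v x) (fun x => -D x) := by
  obtain ⟨z, rfl, rfl⟩ := h
  obtain ⟨φ, h1, h2, h3⟩ := z.approx
  refine ⟨⟨_, _, z.memLp_val.neg, z.memLp_grad.neg,
    fun n x => -φ n x, fun n => ⟨(h1 n).1.neg, (h1 n).2.1.neg,
      by simpa [tsupport, Function.support_fun_neg] using (h1 n).2.2⟩, ?_, ?_⟩, rfl, rfl⟩
  · refine h2.congr fun n => ?_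
    rw [← eLpNorm_neg]; congr 1; ext x; simp; ring
  · refine h3.congr fun n => ?_
    rw [← eLpNorm_neg]; congr 1; ext1 x
    simp only [Pi.neg_apply]
    have : gradient (fun x => -φ n x) x = -gradient (φ n) x := by
      unfold gradient; rw [fderiv_fun_neg, map_neg]
    rw [this]; abel

theorem IsH10.sub (h : IsH10 ω v D) (h' : IsH10 ω v' D') :
    IsH10 ω (fun x => v x - v' x) (fun x => D x - D' x) := by
  simpa [sub_eq_add_neg] using h.add h'.neg

theorem IsH10.sum {κ : Type*} (s : Finset κ) {v : κ → E d → ℝ} {D : κ → E d → E d}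
    (h : ∀ i ∈ s, IsH10 ω (v i) (D i)) :
    IsH10 ω (fun x => ∑ i ∈ s, v i x) (fun x => ∑ i ∈ s, D i x) := by
  classical
  induction s using Finset.induction_on with
  | empty => simpa using isH10_zero ω
  | insert a s ha ih =>
    simp only [Finset.sum_insert ha]
    exact (h a (by simp)).add (ih fun i hi => h i (by simp [hi]))

theorem IsH10.ae_eq_zero (h : IsH10 ω v D) (hω : MeasurableSet ω) :
    (∀ᵐ x ∂volume.restrict ωᶜ, v x = 0) ∧ ∀ᵐ x ∂volume.restrict ωᶜ, D x = 0 := by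
  obtain ⟨z, rfl, rfl⟩ := h
  obtain ⟨φ, h1, h2, h3⟩ := z.approx
  have hnot : ∀ n, ∀ x ∈ ωᶜ, x ∉ tsupport (φ n) := fun n x hx hx' => hx ((h1 n).2.2 hx')
  constructor
  · refine (eLpNorm_eq_zero_iff (p := 2) z.memLp_val.1.restrict (by norm_num)).1 ?_
    refine le_antisymm (ge_of_tendsto h2 (Eventually.of_forall fun n => ?_)) zero_le
    rw [← eLpNorm_neg]
    refine le_of_eq_of_le (eLpNorm_congr_ae ?_)
      (eLpNorm_mono_measure _ (Measure.restrict_le_self (s := ωᶜ)))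
    filter_upwards [ae_restrict_mem hω.compl] with x hx
    simp [image_eq_zero_of_notMem_tsupport (hnot n x hx)]
  · refine (eLpNorm_eq_zero_iff (p := 2) z.memLp_grad.1.restrict (by norm_num)).1 ?_
    refine le_antisymm (ge_of_tendsto h3 (Eventually.of_forall fun n => ?_)) zero_le
    rw [← eLpNorm_neg]
    refine le_of_eq_of_le (eLpNorm_congr_ae ?_)
      (eLpNorm_mono_measure _ (Measure.restrict_le_self (s := ωᶜ)))
    filter_upwards [ae_restrict_mem hω.compl] with x hx
    simp [gradient_eq_zero_of_notMem_tsupport (hnot n x hx)]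

end

/-! ### Lipschitz functions vanishing outside an open set -/

section

variable {d : ℕ}
open scoped Convolution

/-- The derivative of a Lipschitz function exists almost everywhere by the theorem of Rademacher,
and mollification may be differentiated under the integral sign with this derivative. -/
theorem hasFDerivAt_convolution_of_lipschitz {φ : E d → ℝ} (hφ : Continuous φ)
    (hφc : HasCompactSupport φ) {g : E d → ℝ} {L : NNReal} (hg : LipschitzWith L g)
    (x : E d) :
    HasFDerivAt (φ ⋆[ContinuousLinearMap.lsmul ℝ ℝ, volume] g)
      ((φ ⋆[ContinuousLinearMap.lsmul ℝ ℝ, volume] fderiv ℝ g) x) x := by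
  have hint : Integrable φ volume := hφ.integrable_of_hasCompactSupport hφc
  have hdiff : ∀ᵐ t : E d, DifferentiableAt ℝ g (x - t) :=
    (quasiMeasurePreserving_sub_left volume x).ae hg.ae_differentiableAt
  have := hasFDerivAt_integral_of_dominated_loc_of_lip (𝕜 := ℝ) (μ := (volume : Measure (E d)))
    (F := fun y t => φ t • g (y - t)) (F' := fun t => φ t • fderiv ℝ g (x - t)) (x₀ := x)
    (s := Set.univ) (bound := fun t => ‖φ t‖ * L) univ_mem
    (Eventually.of_forall fun y => (hφ.smul
      (hg.continuous.comp (continuous_const.sub continuous_id))).aestronglyMeasurable)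
    ?_ ?_ ?_ ?_ ?_
  · exact this.2
  · refine Continuous.integrable_of_hasCompactSupport ?_ hφc.smul_right
    exact hφ.smul (hg.continuous.comp (continuous_const.sub continuous_id))
  · exact (hφ.measurable.smul ((measurable_fderiv ℝ g).comp
      (measurable_const.sub measurable_id))).aestronglyMeasurable
  · refine Eventually.of_forall fun t => LipschitzOnWith.of_dist_le_mul fun y _ z _ => ?_
    rw [dist_eq_norm, ← smul_sub, norm_smul]
    have : ‖g (y - t) - g (z - t)‖ ≤ L * dist y z := by
      rw [← dist_eq_norm]; simpa using hg.dist_le_mul (y - t) (z - t)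
    calc ‖φ t‖ * ‖g (y - t) - g (z - t)‖ ≤ ‖φ t‖ * (L * dist y z) := by gcongr
      _ = _ := by
        rw [Real.coe_nnabs, abs_of_nonneg (by positivity)]; ring
  · exact hint.norm.mul_const _
  · filter_upwards [hdiff] with t ht
    have h1 : HasFDerivAt (fun y => y - t) (ContinuousLinearMap.id ℝ (E d)) x :=
      (hasFDerivAt_id x).sub_const t
    have h2 := (ht.hasFDerivAt.comp x h1).const_smul (φ t)
    exact h2

/-- A Lipschitz function whose support is a compact subset of an open set `ω` belongs to `H¹₀(ω)`:
its mollifications converge to it together with their gradients. -/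
theorem isH10_of_lipschitz_of_tsupport_subset {ω : Set (E d)} (hω : IsOpen ω) {g : E d → ℝ}
    {L : NNReal} (hg : LipschitzWith L g) (hc : HasCompactSupport g) (hs : tsupport g ⊆ ω) :
    IsH10 ω g (gradient g) := by
  obtain ⟨δ, hδ, hδω⟩ := hc.isCompact.exists_cthickening_subset_open hω hs
  let φ : ℕ → ContDiffBump (0 : E d) := fun n =>
    ⟨δ / (2 * (n + 1)), δ / (n + 1), by positivity, by
      rw [div_lt_div_iff₀ (by positivity) (by positivity)]
      have : 0 < δ * (n + 1) := by positivity
      linarith⟩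
  have hr : ∀ n, (φ n).rOut = δ / (n + 1) := fun n => rfl
  have hrδ : ∀ n, (φ n).rOut ≤ δ := fun n => by
    rw [hr]; exact div_le_self hδ.le (by linarith [n.cast_nonneg (α := ℝ)])
  have hr0 : Tendsto (fun n => (φ n).rOut) atTop (𝓝 0) := by
    simp_rw [hr, div_eq_mul_inv]
    simpa using (tendsto_one_div_add_atTop_nhds_zero_nat (𝕜 := ℝ)).const_mul δ
  have hK : ∀ᶠ n in atTop, (φ n).rOut ≤ 2 * (φ n).rIn := Eventually.of_forall fun n => by
    change δ / (n + 1) ≤ 2 * (δ / (2 * (n + 1)))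
    apply le_of_eq; field_simp
  -- all the mollifications are supported in this compact subset of `ω`
  let S := Metric.cthickening δ (tsupport g)
  have hSc : IsCompact S := hc.isCompact.cthickening
  let G : ℕ → E d → ℝ := fun n => (φ n).normed volume ⋆[ContinuousLinearMap.lsmul ℝ ℝ, volume] g
  have hsupp : ∀ n, Function.support (G n) ⊆ S := by
    intro n x hx
    obtain ⟨a, ha, b, hb, rfl⟩ := support_convolution_subset _ hx
    rw [(φ n).support_normed_eq, mem_ball_zero_iff] at ha
    refine Metric.mem_cthickening_of_dist_le (a + b) b δ _ (subset_tsupport _ hb) ?_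
    simpa [dist_eq_norm] using ha.le.trans (hrδ n)
  have htsupp : ∀ n, tsupport (G n) ⊆ S := fun n =>
    closure_minimal (hsupp n) Metric.isClosed_cthickening
  have hgS : tsupport g ⊆ S := Metric.self_subset_cthickening _
  have hfd : ∀ n x, HasFDerivAt (G n)
      (((φ n).normed volume ⋆[ContinuousLinearMap.lsmul ℝ ℝ, volume] fderiv ℝ g) x) x :=
    fun n x => hasFDerivAt_convolution_of_lipschitz (φ n).continuous_normed
      (φ n).hasCompactSupport_normed hg x
  have hGnear : ∀ n x, ‖G n x - g x‖ ≤ L * δ / (n + 1) := by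
    intro n x
    rw [← dist_eq_norm]
    refine (φ n).dist_normed_convolution_le hg.continuous.aestronglyMeasurable fun y hy => ?_
    refine (hg.dist_le_mul y x).trans ?_
    rw [mul_div_assoc]
    gcongr
    exact (Metric.mem_ball.1 hy).le
  have hfdb : ∀ n x, ‖fderiv ℝ (G n) x‖ ≤ L := by
    intro n x
    rw [(hfd n x).fderiv]
    have := dist_convolution_le (μ := (volume : Measure (E d))) (f := (φ n).normed volume)
      (g := fderiv ℝ g) (x₀ := x) (R := (φ n).rOut) (ε := L) (z₀ := 0) L.2
      (φ n).support_normed_eq.subset (φ n).nonneg_normed (φ n).integral_normed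
      (measurable_fderiv ℝ g).aestronglyMeasurable (fun y _ => by
        rw [dist_zero_right]; exact norm_fderiv_le_of_lipschitz ℝ hg)
    rwa [dist_zero_right] at this
  have hloc : LocallyIntegrable (fderiv ℝ g) volume := by
    refine (locallyIntegrable_const (L : ℝ)).mono (measurable_fderiv ℝ g).aestronglyMeasurable
      (Eventually.of_forall fun x => ?_)
    simpa using norm_fderiv_le_of_lipschitz ℝ hg
  -- the gradients converge at the Lebesgue points of `∇g`
  have hae := ContDiffBump.ae_convolution_tendsto_right_of_locallyIntegrable (μ := volume)
    hr0 hK hloc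
  have hgb : MemLp g 2 volume := hg.continuous.memLp_of_hasCompactSupport hc
  have hDb : MemLp (gradient g) 2 volume := by
    have : MemLp (S.indicator fun _ => (L : ℝ)) 2 (volume : Measure (E d)) :=
      memLp_indicator_const 2 hSc.measurableSet _ (Or.inr hSc.measure_lt_top.ne)
    refine this.mono (measurable_gradient g).aestronglyMeasurable (Eventually.of_forall fun x => ?_)
    by_cases hx : x ∈ S
    · simpa [Set.indicator_of_mem hx] using norm_gradient_le_of_lipschitz hg x
    · rw [gradient_eq_zero_of_notMem_tsupport fun h => hx (hgS h)]; simp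
  refine ⟨⟨g, gradient g, hgb, hDb, G, fun n => ⟨?_, ?_, (htsupp n).trans hδω⟩, ?_, ?_⟩, rfl, rfl⟩
  · exact (φ n).hasCompactSupport_normed.contDiff_convolution_left _ (φ n).contDiff_normed
      hg.continuous.locallyIntegrable
  · exact hSc.of_isClosed_subset (isClosed_tsupport _) (htsupp n)
  · refine tendsto_eLpNorm_two_zero_of_dominated hSc.measurableSet hSc.measure_lt_top.ne (L * δ)
      (fun n => ?_) (fun n => Eventually.of_forall fun x => ?_) (Eventually.of_forall fun x => ?_)
    · exact (continuous_iff_continuousAt.2 fun x =>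
        (hfd n x).continuousAt).aestronglyMeasurable.sub hgb.1
    · by_cases hx : x ∈ S
      · rw [Set.indicator_of_mem hx]
        exact (hGnear n x).trans (div_le_self (by positivity)
          (by linarith [n.cast_nonneg (α := ℝ)]))
      · rw [Set.indicator_of_notMem hx, image_eq_zero_of_notMem_tsupport fun h => hx (hgS h),
          image_eq_zero_of_notMem_tsupport fun h => hx (htsupp n h)]; simp
    · refine squeeze_zero_norm (hGnear · x) ?_
      simp_rw [div_eq_mul_inv]
      simpa using (tendsto_one_div_add_atTop_nhds_zero_nat (𝕜 := ℝ)).const_mul (L * δ)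
  · refine tendsto_eLpNorm_two_zero_of_dominated hSc.measurableSet hSc.measure_lt_top.ne (L + L)
      (fun n => ?_) (fun n => Eventually.of_forall fun x => ?_) ?_
    · exact ((measurable_gradient _).sub (measurable_gradient _)).aestronglyMeasurable
    · by_cases hx : x ∈ S
      · rw [Set.indicator_of_mem hx]
        refine (norm_sub_le _ _).trans (add_le_add ?_ (norm_gradient_le_of_lipschitz hg x))
        rw [norm_gradient]; exact hfdb n x
      · rw [Set.indicator_of_notMem hx, gradient_eq_zero_of_notMem_tsupport fun h => hx (hgS h),
          gradient_eq_zero_of_notMem_tsupport fun h => hx (htsupp n h)]; simp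
    · filter_upwards [hae] with x hx
      have h1 : Tendsto (fun n => gradient (G n) x) atTop (𝓝 (gradient g x)) := by
        refine (((InnerProductSpace.toDual ℝ (E d)).symm.continuous.tendsto _).comp hx).congr ?_
        intro n
        simp only [Function.comp_apply, gradient, (hfd n x).fderiv]
      simpa using h1.sub_const (gradient g x)

/-- The cutoff `x ↦ min 1 (max 0 (n dist(x, s) - 1))`. -/
def distCutoff (s : Set (E d)) (n : ℕ) (x : E d) : ℝ :=
  min 1 (max 0 (n * Metric.infDist x s - 1))

/-- A Lipschitz function of compact support which vanishes outside an open set `ω` belongs to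
`H¹₀(ω)`, even if its support touches the boundary. The approximants are its products with cutoffs
of the distance to the complement: these have bounded gradients because the function is
at most of the order of the distance. -/
theorem isH10_of_lipschitz_of_eq_zero {ω : Set (E d)} (hω : IsOpen ω) (hne : ωᶜ.Nonempty)
    {g : E d → ℝ} {L : NNReal} (hg : LipschitzWith L g) (hc : HasCompactSupport g)
    (h0 : ∀ x ∉ ω, g x = 0) : IsH10 ω g (ω.indicator (gradient g)) := by
  let ζ : ℕ → E d → ℝ := distCutoff ωᶜ
  have hζ0 : ∀ n x, 0 ≤ ζ n x := fun n x => le_min zero_le_one (le_max_left _ _)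
  have hζ1 : ∀ n x, ζ n x ≤ 1 := fun n x => min_le_left _ _
  have hζ2 : ∀ (n : ℕ) x, 2 ≤ n * Metric.infDist x ωᶜ → ζ n x = 1 := by
    intro n x hx
    simp only [ζ, distCutoff]
    rw [max_eq_right (by linarith), min_eq_left (by linarith)]
  have hζ3 : ∀ (n : ℕ) x, n * Metric.infDist x ωᶜ ≤ 1 → ζ n x = 0 := by
    intro n x hx
    simp only [ζ, distCutoff]
    rw [max_eq_left (by linarith), min_eq_right (by linarith)]
  have hζL : ∀ n x y, |ζ n x - ζ n y| ≤ n * dist x y := by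
    intro n x y
    have h1 : |ζ n x - ζ n y| ≤ |n * Metric.infDist x ωᶜ - 1 - (n * Metric.infDist y ωᶜ - 1)| := by
      refine (abs_min_sub_min_le_max _ _ _ _).trans ?_
      simp only [sub_self, abs_zero, abs_nonneg, max_eq_right]
      refine (abs_max_sub_max_le_max _ _ _ _).trans ?_
      simp
    refine h1.trans ?_
    have h2 : |Metric.infDist x ωᶜ - Metric.infDist y ωᶜ| ≤ dist x y := by
      simpa [Real.dist_eq] using (Metric.lipschitz_infDist_pt ωᶜ).dist_le_mul x y
    rw [show (n : ℝ) * Metric.infDist x ωᶜ - 1 - (n * Metric.infDist y ωᶜ - 1)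
      = n * (Metric.infDist x ωᶜ - Metric.infDist y ωᶜ) by ring, abs_mul, Nat.abs_cast]
    gcongr
  have hgd : ∀ x, |g x| ≤ L * Metric.infDist x ωᶜ := by
    intro x
    obtain ⟨y, hy, hxy⟩ := hω.isClosed_compl.exists_infDist_eq_dist hne x
    have := hg.dist_le_mul x y
    rw [h0 y hy, Real.dist_eq, sub_zero] at this
    rwa [hxy]
  have hlip1 : ∀ n x y, Metric.infDist x ωᶜ ≤ Metric.infDist y ωᶜ →
      |g x * ζ n x - g y * ζ n y| ≤ 3 * L * dist x y := by
    intro n x y hxy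
    have h1 : |(g x - g y) * ζ n y| ≤ L * dist x y := by
      rw [abs_mul, abs_of_nonneg (hζ0 n y)]
      refine (mul_le_of_le_one_right (abs_nonneg _) (hζ1 n y)).trans ?_
      simpa [Real.dist_eq] using hg.dist_le_mul x y
    -- the cutoff has slope `n`, but it varies only where `n dist(x, ωᶜ) ≤ 2`, hence `|g| ≤ 2 L / n`
    have h2 : |g x * (ζ n x - ζ n y)| ≤ 2 * L * dist x y := by
      rcases le_total 2 (n * Metric.infDist x ωᶜ) with h | h
      · rw [hζ2 n x h, hζ2 n y (h.trans (by gcongr))]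
        simp only [sub_self, mul_zero, abs_zero]; positivity
      · rw [abs_mul]
        calc |g x| * |ζ n x - ζ n y| ≤ (L * Metric.infDist x ωᶜ) * (n * dist x y) := by
              exact mul_le_mul (hgd x) (hζL n x y) (abs_nonneg _) ((abs_nonneg _).trans (hgd x))
          _ = (n * Metric.infDist x ωᶜ) * L * dist x y := by ring
          _ ≤ _ := by gcongr
    calc |g x * ζ n x - g y * ζ n y| = |(g x - g y) * ζ n y + g x * (ζ n x - ζ n y)| := by
          congr 1; ring
      _ ≤ _ := abs_add_le _ _
      _ ≤ L * dist x y + 2 * L * dist x y := add_le_add h1 h2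
      _ = _ := by ring
  have hlip : ∀ n, LipschitzWith (3 * L) (fun x => g x * ζ n x) := by
    intro n
    refine LipschitzWith.of_dist_le_mul fun x y => ?_
    rw [Real.dist_eq]
    rcases le_total (Metric.infDist x ωᶜ) (Metric.infDist y ωᶜ) with h | h
    · exact hlip1 n x y h
    · rw [abs_sub_comm, dist_comm]; exact hlip1 n y x h
  have hts : ∀ n, tsupport (fun x => g x * ζ n x) ⊆ tsupport g := fun n =>
    tsupport_mul_subset_left
  have hcn : ∀ n, HasCompactSupport (fun x => g x * ζ n x) := fun n => hc.mul_right
  have htω : ∀ n, tsupport (fun x => g x * ζ n x) ⊆ ω := by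
    intro n
    have hcl : IsClosed {x : E d | 1 ≤ n * Metric.infDist x ωᶜ} :=
      isClosed_le continuous_const (continuous_const.mul (Metric.continuous_infDist_pt _))
    refine (closure_minimal (fun x hx => ?_) hcl).trans fun x hx => ?_
    · by_contra h
      exact hx (by simp only [hζ3 n x (not_le.1 h).le]; exact mul_zero _)
    · by_contra h
      have h1 : Metric.infDist x ωᶜ = 0 := Metric.infDist_zero_of_mem h
      have h2 : (1 : ℝ) ≤ n * Metric.infDist x ωᶜ := hx
      rw [h1] at h2; norm_num at h2
  -- near every point of `ω`, the product is eventually `g` itself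
  have hev : ∀ x ∈ ω, ∀ᶠ n : ℕ in atTop, ∀ᶠ y in 𝓝 x, g y * ζ n y = g y := by
    intro x hx
    have hpos : 0 < Metric.infDist x ωᶜ :=
      (hω.isClosed_compl.notMem_iff_infDist_pos hne).1 (by simpa using hx)
    filter_upwards [(tendsto_natCast_atTop_atTop (R := ℝ)).eventually_gt_atTop
      (2 / Metric.infDist x ωᶜ)] with n hn
    have h1 : 2 < n * Metric.infDist x ωᶜ := by rwa [div_lt_iff₀ hpos] at hn
    have h2 : ∀ᶠ y in 𝓝 x, 2 < n * Metric.infDist y ωᶜ :=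
      (continuous_const.mul (Metric.continuous_infDist_pt _)).continuousAt.eventually_const_lt h1
    filter_upwards [h2] with y hy
    rw [hζ2 n y hy.le, mul_one]
  have hout : ∀ x ∉ ω, ∀ n, gradient (fun x => g x * ζ n x) x = 0 := fun x hx n =>
    gradient_eq_zero_of_notMem_tsupport fun h => hx (htω n h)
  have hS := hc.isCompact
  have hmi : Measurable (ω.indicator (gradient g)) :=
    (measurable_gradient g).indicator hω.measurableSet
  have hib : ∀ x, ‖ω.indicator (gradient g) x‖ ≤ (tsupport g).indicator (fun _ => (L : ℝ)) x := by
    intro x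
    by_cases hx : x ∈ tsupport g
    · rw [Set.indicator_of_mem hx]
      exact (norm_indicator_le_norm_self _ _).trans (norm_gradient_le_of_lipschitz hg x)
    · rw [Set.indicator_of_notMem hx]
      refine (norm_indicator_le_norm_self _ _).trans ?_
      rw [gradient_eq_zero_of_notMem_tsupport hx, norm_zero]
  refine IsH10.of_tendsto (vn := fun n x => g x * ζ n x)
    (Dn := fun n => gradient (fun x => g x * ζ n x))
    (hg.continuous.memLp_of_hasCompactSupport hc) ?_
    (fun n => isH10_of_lipschitz_of_tsupport_subset hω (hlip n) (hcn n) (htω n)) ?_ ?_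
  · have : MemLp ((tsupport g).indicator fun _ => (L : ℝ)) 2 (volume : Measure (E d)) :=
      memLp_indicator_const 2 hS.measurableSet _ (Or.inr hS.measure_lt_top.ne)
    refine this.mono hmi.aestronglyMeasurable (Eventually.of_forall fun x => ?_)
    exact (hib x).trans (le_abs_self _)
  · obtain ⟨B, hB⟩ := hg.continuous.bounded_above_of_compact_support hc
    refine tendsto_eLpNorm_two_zero_of_dominated hS.measurableSet hS.measure_lt_top.ne B
      (fun n => ?_) (fun n => Eventually.of_forall fun x => ?_) (Eventually.of_forall fun x => ?_)
    · exact ((hlip n).continuous.sub hg.continuous).aestronglyMeasurable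
    · by_cases hx : x ∈ tsupport g
      · rw [Set.indicator_of_mem hx]
        rw [show g x * ζ n x - g x = -(g x * (1 - ζ n x)) by ring, norm_neg, norm_mul]
        refine (mul_le_of_le_one_right (norm_nonneg _) ?_).trans (hB x)
        rw [Real.norm_eq_abs, abs_le]; constructor <;> linarith [hζ0 n x, hζ1 n x]
      · rw [Set.indicator_of_notMem hx, image_eq_zero_of_notMem_tsupport hx]; simp
    · by_cases hx : x ∈ ω
      · refine tendsto_const_nhds.congr' ?_
        filter_upwards [hev x hx] with n hn
        rw [hn.self_of_nhds, sub_self]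
      · simp [h0 x hx]
  · refine tendsto_eLpNorm_two_zero_of_dominated hS.measurableSet hS.measure_lt_top.ne
      (3 * L + L)
      (fun n => ?_) (fun n => Eventually.of_forall fun x => ?_) (Eventually.of_forall fun x => ?_)
    · exact ((measurable_gradient _).sub hmi).aestronglyMeasurable
    · refine (norm_sub_le _ _).trans ((add_le_add_right (hib x) _).trans ?_)
      by_cases hx : x ∈ tsupport g
      · simp only [Set.indicator_of_mem hx]
        gcongr
        exact norm_gradient_le_of_lipschitz (hlip n) x
      · simp only [Set.indicator_of_notMem hx]
        rw [gradient_eq_zero_of_notMem_tsupport fun h => hx (hts n h)]; simp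
    · by_cases hx : x ∈ ω
      · refine tendsto_const_nhds.congr' ?_
        filter_upwards [hev x hx] with n hn
        have : (fun y => g y * ζ n y) =ᶠ[𝓝 x] g := hn
        rw [this.gradient_eq, Set.indicator_of_mem hx, sub_self]
      · simp [hout x hx, Set.indicator_of_notMem hx]

end

/-! ### Products with Lipschitz cutoffs -/

section

variable {d : ℕ}

theorem exists_lipschitz_extension_unitInterval {Ω : Set (E d)} {η : E d → ℝ} {L : NNReal}
    (hL : LipschitzOnWith L η Ω) (h0 : ∀ x ∈ Ω, 0 ≤ η x) (h1 : ∀ x ∈ Ω, η x ≤ 1) :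
    ∃ η' : E d → ℝ, LipschitzWith L η' ∧ (∀ x, 0 ≤ η' x) ∧ (∀ x, η' x ≤ 1) ∧ Set.EqOn η η' Ω := by
  obtain ⟨g, hg, hgη⟩ := hL.extend_real
  refine ⟨fun x => max 0 (min 1 (g x)), (hg.const_min 1).const_max 0,
    fun x => le_max_left _ _, fun x => max_le zero_le_one (min_le_left _ _), fun x hx => ?_⟩
  simp only
  rw [← hgη hx, min_eq_right (h1 x hx), max_eq_right (h0 x hx)]

theorem gradient_eq_of_eqOn {Ω : Set (E d)} (hΩ : IsOpen Ω) {f g : E d → ℝ} (h : Set.EqOn f g Ω)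
    {x : E d} (hx : x ∈ Ω) : gradient f x = gradient g x :=
  (h.eventuallyEq_of_mem (hΩ.mem_nhds hx)).gradient_eq

/-- Multiplication by a Lipschitz cutoff which vanishes on `Ω \ ω` maps `H¹₀(Ω)` to `H¹₀(ω)`, with
the product rule for the gradient. -/
theorem IsH10.exists_mul_lipschitz {Ω ω : Set (E d)} (hΩ : IsOpen Ω) (hω : IsOpen ω)
    (hne : ωᶜ.Nonempty) (hωΩ : ω ⊆ Ω) {v : E d → ℝ} {D : E d → E d} (h : IsH10 Ω v D)
    {η : E d → ℝ} {L : NNReal} (hL : LipschitzOnWith L η Ω) (h0 : ∀ x ∈ Ω, 0 ≤ η x)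
    (h1 : ∀ x ∈ Ω, η x ≤ 1) (hz : ∀ x ∈ Ω, x ∉ ω → η x = 0) :
    ∃ z : H10 ω, (∀ x ∈ Ω, z.val x = η x * v x) ∧
      ∀ x ∈ ω, z.grad x = η x • D x + v x • gradient η x := by
  obtain ⟨θ, hθL, hθ0, hθ1, hηθ⟩ := exists_lipschitz_extension_unitInterval hL h0 h1
  have hgrad : ∀ x ∈ ω, gradient η x = gradient θ x := fun x hx =>
    gradient_eq_of_eqOn hΩ hηθ (hωΩ hx)
  suffices H : IsH10 ω (fun x => θ x * v x)
      (ω.indicator fun x => θ x • D x + v x • gradient θ x) by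
    obtain ⟨z, hz1, hz2⟩ := H
    refine ⟨z, fun x hx => ?_, fun x hx => ?_⟩
    · rw [hz1, hηθ hx]
    · rw [hz2, Set.indicator_of_mem hx, hηθ (hωΩ hx), hgrad x hx]
  obtain ⟨z, rfl, rfl⟩ := h
  obtain ⟨φ, g1, g2, g3⟩ := z.approx
  have hθn : ∀ x, ‖θ x‖ ≤ 1 := fun x => by
    rw [Real.norm_eq_abs, abs_of_nonneg (hθ0 x)]; exact hθ1 x
  have hgθ : ∀ x, ‖gradient θ x‖ ≤ L := norm_gradient_le_of_lipschitz hθL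
  have hmg : Measurable (gradient θ) := measurable_gradient θ
  have hv : MemLp (fun x => θ x * z.val x) 2 volume := by
    refine z.memLp_val.mono (hθL.continuous.aestronglyMeasurable.mul z.memLp_val.1)
      (Eventually.of_forall fun x => ?_)
    rw [norm_mul]; exact mul_le_of_le_one_left (norm_nonneg _) (hθn x)
  have hD1 : MemLp (fun x => θ x • z.grad x) 2 volume := by
    refine z.memLp_grad.mono (hθL.continuous.aestronglyMeasurable.smul z.memLp_grad.1)
      (Eventually.of_forall fun x => ?_)
    rw [norm_smul]; exact mul_le_of_le_one_left (norm_nonneg _) (hθn x)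
  have hD2 : MemLp (fun x => z.val x • gradient θ x) 2 volume := by
    refine (z.memLp_val.const_mul (L : ℝ)).mono
      (z.memLp_val.1.smul hmg.aestronglyMeasurable) (Eventually.of_forall fun x => ?_)
    rw [norm_smul, norm_mul, mul_comm, NNReal.norm_eq]
    gcongr; exact hgθ x
  have hD : MemLp (ω.indicator fun x => θ x • z.grad x + z.val x • gradient θ x) 2 volume :=
    (hD1.add hD2).indicator hω.measurableSet
  -- the products with the test functions vanish outside `ω` and are Lipschitz
  have happ : ∀ n, IsH10 ω (fun x => θ x * φ n x)
      (ω.indicator (gradient fun x => θ x * φ n x)) := by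
    intro n
    obtain ⟨Ln, hLn⟩ := (g1 n).1.lipschitzWith_of_hasCompactSupport (g1 n).2.1 (by simp)
    obtain ⟨b, hb⟩ := (g1 n).1.continuous.bounded_above_of_compact_support (g1 n).2.1
    have hb0 : 0 ≤ b := (norm_nonneg _).trans (hb 0)
    lift b to NNReal using hb0
    refine isH10_of_lipschitz_of_eq_zero (L := Ln + L * b) hω hne
      (LipschitzWith.of_dist_le_mul fun x y => ?_) (g1 n).2.1.mul_left fun x hx => ?_
    · rw [Real.dist_eq, show θ x * φ n x - θ y * φ n y
        = θ x * (φ n x - φ n y) + (θ x - θ y) * φ n y by ring]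
      refine (abs_add_le _ _).trans ?_
      rw [abs_mul, abs_mul, abs_of_nonneg (hθ0 x)]
      have e1 := hLn.dist_le_mul x y
      have e2 := hθL.dist_le_mul x y
      rw [Real.dist_eq] at e1 e2
      have e3 : |φ n y| ≤ b := hb y
      calc θ x * |φ n x - φ n y| + |θ x - θ y| * |φ n y|
          ≤ 1 * (Ln * dist x y) + (L * dist x y) * b := by
            gcongr; exact hθ1 x
        _ = _ := by push_cast; ring
    · by_cases hxΩ : x ∈ Ω
      · rw [← hηθ hxΩ, hz x hxΩ hx, zero_mul]
      · rw [image_eq_zero_of_notMem_tsupport fun h => hxΩ ((g1 n).2.2 h), mul_zero]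
  refine IsH10.of_tendsto hv hD happ ?_ ?_
  · refine tendsto_of_tendsto_of_tendsto_of_le_of_le tendsto_const_nhds g2 (fun _ => zero_le)
      fun n => eLpNorm_mono fun x => ?_
    rw [← mul_sub, norm_mul]
    exact mul_le_of_le_one_left (norm_nonneg _) (hθn x)
  · have hlim : Tendsto (fun n => eLpNorm (fun x => gradient (φ n) x - z.grad x) 2 volume
        + ‖(L : ℝ)‖ₑ * eLpNorm (fun x => φ n x - z.val x) 2 volume) atTop (𝓝 0) := by
      simpa using g3.add (ENNReal.Tendsto.const_mul g2 (Or.inr (by simp)))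
    refine tendsto_of_tendsto_of_tendsto_of_le_of_le tendsto_const_nhds hlim (fun _ => zero_le)
      fun n => ?_
    have hmn : AEStronglyMeasurable (fun x => gradient (φ n) x - z.grad x) volume :=
      (measurable_gradient _).aestronglyMeasurable.sub z.memLp_grad.1
    have hmn' : AEStronglyMeasurable (fun x => φ n x - z.val x) volume :=
      (g1 n).1.continuous.aestronglyMeasurable.sub z.memLp_val.1
    have key : eLpNorm (fun x => ω.indicator (gradient fun x => θ x * φ n x) x
        - ω.indicator (fun x => θ x • z.grad x + z.val x • gradient θ x) x) 2 volume
        ≤ eLpNorm ((fun x => ‖gradient (φ n) x - z.grad x‖)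
          + (L : ℝ) • fun x => ‖φ n x - z.val x‖) 2 volume := by
      refine eLpNorm_mono_ae_real ?_
      filter_upwards [hθL.ae_differentiableAt] with x hx
      by_cases hxω : x ∈ ω
      · simp only [Set.indicator_of_mem hxω, Pi.add_apply, Pi.smul_apply, smul_eq_mul]
        rw [gradient_mul' hx ((g1 n).1.differentiable (by simp) x),
          show θ x • gradient (φ n) x + φ n x • gradient θ x
            - (θ x • z.grad x + z.val x • gradient θ x)
            = θ x • (gradient (φ n) x - z.grad x) + (φ n x - z.val x) • gradient θ x by
            module]
        refine (norm_add_le _ _).trans ?_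
        rw [norm_smul, norm_smul, mul_comm (L : ℝ)]
        gcongr
        · exact mul_le_of_le_one_left (norm_nonneg _) (hθn x)
        · exact hgθ x
      · simp only [Set.indicator_of_notMem hxω, sub_self, norm_zero, Pi.add_apply,
          Pi.smul_apply, smul_eq_mul]
        positivity
    refine key.trans ((eLpNorm_add_le hmn.norm (hmn'.norm.const_smul _) one_le_two).trans ?_)
    rw [eLpNorm_norm, eLpNorm_const_smul, eLpNorm_norm]

end

/-! ### Cells, layers and cutoffs of a coarse mesh -/

section

variable {d : ℕ}

theorem ae_differentiableAt_of_lipschitzOn {Ω : Set (E d)} (hΩ : IsOpen Ω) {f : E d → ℝ}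
    {L : NNReal} (hf : LipschitzOnWith L f Ω) :
    ∀ᵐ x ∂volume.restrict Ω, DifferentiableAt ℝ f x := by
  filter_upwards [hf.ae_differentiableWithinAt hΩ.measurableSet, ae_restrict_mem hΩ.measurableSet]
    with x hx hxΩ using hx.differentiableAt (hΩ.mem_nhds hxΩ)

theorem gradient_sum {κ : Type*} (s : Finset κ) {f : κ → E d → ℝ} {x : E d}
    (h : ∀ j ∈ s, DifferentiableAt ℝ (f j) x) :
    gradient (fun y => ∑ j ∈ s, f j y) x = ∑ j ∈ s, gradient (f j) x := by
  unfold gradient; rw [fderiv_fun_sum h, map_sum]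

theorem exists_lipschitzOnWith_sum {κ : Type*} (s : Finset κ) {Ω : Set (E d)} {f : κ → E d → ℝ}
    (h : ∀ j, ∃ L, LipschitzOnWith L (f j) Ω) :
    ∃ L, LipschitzOnWith L (fun x => ∑ j ∈ s, f j x) Ω := by
  classical
  induction s using Finset.induction_on with
  | empty => exact ⟨0, by simp⟩
  | insert a s ha ih =>
    obtain ⟨L, hL⟩ := h a
    obtain ⟨L', hL'⟩ := ih
    simp only [Finset.sum_insert ha]
    exact ⟨_, hL.add hL'⟩

theorem gradient_eq_zero_of_eqOn_const {s : Set (E d)} (hs : IsOpen s) {f : E d → ℝ} {c : ℝ}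
    (h : ∀ x ∈ s, f x = c) {x : E d} (hx : x ∈ s) : gradient f x = 0 := by
  rw [gradient_eq_of_eqOn hs (g := fun _ => c) h hx, gradient_fun_const]

namespace CoarseMesh

variable {Ω : Set (E d)} {ι J : Type} [Fintype ι] [Fintype J] {H ρ : ℝ} {ν : ℕ}
  (T : CoarseMesh Ω ι J H ρ ν)

theorem measurableSet_cell (i : ι) : MeasurableSet (T.cell i) := (T.isOpen_cell i).measurableSet

theorem cell_nonempty (hρ : 0 < ρ) (hH : 0 < H) (i : ι) : (T.cell i).Nonempty := by
  obtain ⟨x, hx⟩ := T.ball_subset i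
  exact ⟨x, hx (Metric.mem_ball_self (mul_pos hρ hH))⟩

theorem eq_of_mem_cell_of_mem_closure {i k : ι} {x : E d} (hx : x ∈ T.cell i)
    (hx' : x ∈ closure (T.cell k)) : k = i := by
  by_contra h
  obtain ⟨y, hy, hy'⟩ := mem_closure_iff.1 hx' _ (T.isOpen_cell i) hx
  exact (T.disjoint_cell k i h).le_bot ⟨hy', hy⟩

theorem subset_iUnion_closure (hΩ : IsOpen Ω) : Ω ⊆ ⋃ i, closure (T.cell i) := by
  intro x hx
  by_contra hn
  have hcl : IsClosed (⋃ i, closure (T.cell i)) :=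
    isClosed_iUnion_of_finite fun _ => isClosed_closure
  have hop : IsOpen (Ω ∩ (⋃ i, closure (T.cell i))ᶜ) := hΩ.inter hcl.isOpen_compl
  refine (hop.measure_pos volume ⟨x, hx, hn⟩).ne' (measure_mono_null ?_ T.cover)
  refine fun y hy => ⟨hy.1, fun h => hy.2 ?_⟩
  obtain ⟨i, hi⟩ := Set.mem_iUnion.1 h
  exact Set.mem_iUnion.2 ⟨i, subset_closure hi⟩

include T in
theorem isBounded (hΩ : IsOpen Ω) : Bornology.IsBounded Ω := by
  refine Bornology.IsBounded.subset ?_ (T.subset_iUnion_closure hΩ)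
  refine Bornology.isBounded_iUnion.2 fun i => Bornology.IsBounded.closure ?_
  exact Metric.isBounded_iff.2 ⟨H, fun x hx y hy => T.diam_le i x hx y hy⟩

include T in
theorem volume_lt_top (hΩ : IsOpen Ω) : volume Ω < ⊤ := (T.isBounded hΩ).measure_lt_top

theorem ae_exists_mem_cell (hΩ : IsOpen Ω) : ∀ᵐ x ∂volume.restrict Ω, ∃ i, x ∈ T.cell i := by
  have h : ∀ᵐ x ∂(volume : Measure (E d)), x ∉ Ω \ ⋃ i, T.cell i :=
    measure_eq_zero_iff_ae_notMem.1 T.cover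
  filter_upwards [ae_restrict_of_ae h, ae_restrict_mem hΩ.measurableSet] with x hx hxΩ
  by_contra hn
  exact hx ⟨hxΩ, fun h' => hn (Set.mem_iUnion.1 h')⟩

theorem integral_eq_sum_cell (hΩ : IsOpen Ω) {f : E d → ℝ} (hf : IntegrableOn f Ω) :
    ∫ x in Ω, f x = ∑ i, ∫ x in T.cell i, f x := by
  have hae : (Ω : Set (E d)) =ᵐ[volume] ⋃ i ∈ Finset.univ, T.cell i := by
    refine eventuallyEq_set.2 ?_
    filter_upwards [ae_imp_of_ae_restrict (T.ae_exists_mem_cell hΩ)] with x hx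
    refine ⟨fun hxΩ => ?_, fun h => ?_⟩
    · obtain ⟨i, hi⟩ := hx hxΩ
      exact Set.mem_biUnion (Finset.mem_univ i) hi
    · obtain ⟨i, -, hi⟩ := Set.mem_iUnion₂.1 h
      exact T.cell_subset i hi
  rw [setIntegral_congr_set hae]
  exact integral_biUnion_finset _ (fun i _ => T.measurableSet_cell i)
    (fun i _ k _ h => T.disjoint_cell i k h) fun i _ => hf.mono_set (T.cell_subset i)

/-- The indices of the cells of `K_m^+` as a finite set. -/
def layerFinset (i : ι) (m : ℕ) : Finset ι := by
  classical exact Finset.univ.filter (· ∈ T.layer i m)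

@[simp] theorem mem_layerFinset {i k : ι} {m : ℕ} : k ∈ T.layerFinset i m ↔ k ∈ T.layer i m := by
  simp [layerFinset]

theorem region_subset (i : ι) (m : ℕ) : T.region i m ⊆ Ω := Set.inter_subset_left

theorem isOpen_region (hΩ : IsOpen Ω) (i : ι) (m : ℕ) : IsOpen (T.region i m) :=
  hΩ.inter isOpen_interior

theorem cell_subset_region {i k : ι} {m : ℕ} (hk : k ∈ T.layer i m) :
    T.cell k ⊆ T.region i m := by
  refine Set.subset_inter (T.cell_subset k) (interior_maximal ?_ (T.isOpen_cell k))
  exact subset_closure.trans (Set.subset_biUnion_of_mem (u := fun k => closure (T.cell k)) hk)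

theorem mem_layer_of_mem_region {i k : ι} {m : ℕ} {x : E d} (hx : x ∈ T.region i m)
    (hk : x ∈ T.cell k) : k ∈ T.layer i m := by
  obtain ⟨l, hl, hxl⟩ := Set.mem_iUnion₂.1 (interior_subset hx.2)
  rwa [← T.eq_of_mem_cell_of_mem_closure hk hxl]

theorem integral_region_eq_sum_cell (hΩ : IsOpen Ω) (i : ι) (m : ℕ) {f : E d → ℝ}
    (hf : IntegrableOn f Ω) :
    ∫ x in T.region i m, f x = ∑ k ∈ T.layerFinset i m, ∫ x in T.cell k, f x := by
  have hae : (T.region i m : Set (E d)) =ᵐ[volume] ⋃ k ∈ T.layerFinset i m, T.cell k := by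
    refine eventuallyEq_set.2 ?_
    filter_upwards [ae_imp_of_ae_restrict (T.ae_exists_mem_cell hΩ)] with x hx
    refine ⟨fun hxr => ?_, fun h => ?_⟩
    · obtain ⟨k, hk⟩ := hx (T.region_subset i m hxr)
      exact Set.mem_biUnion (T.mem_layerFinset.2 (T.mem_layer_of_mem_region hxr hk)) hk
    · obtain ⟨k, hk, hxk⟩ := Set.mem_iUnion₂.1 h
      exact T.cell_subset_region (T.mem_layerFinset.1 hk) hxk
  rw [setIntegral_congr_set hae]
  exact integral_biUnion_finset _ (fun i _ => T.measurableSet_cell i)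
    (fun i _ k _ h => T.disjoint_cell i k h) fun i _ => hf.mono_set (T.cell_subset i)

/-- A function which is continuous on `Ω` and vanishes on the cells outside `K_m^+` vanishes
outside the open set `K_m^+`. -/
theorem eq_zero_of_notMem_region (hΩ : IsOpen Ω) {i : ι} {m : ℕ} {η : E d → ℝ}
    (hη : ContinuousOn η Ω) (h0 : ∀ k ∉ T.layer i m, ∀ x ∈ T.cell k, η x = 0) {x : E d}
    (hx : x ∈ Ω) (hxr : x ∉ T.region i m) : η x = 0 := by
  have key : ∀ {s : Set (E d)} {y : E d}, (∀ z ∈ s, z ∈ Ω → η z = 0) → y ∈ Ω →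
      y ∈ closure s → η y = 0 := by
    intro s y hs hy hys
    by_contra hne
    have h1 : ∀ᶠ z in 𝓝 y, η z ≠ 0 := (hη.continuousAt (hΩ.mem_nhds hy)).eventually_ne hne
    obtain ⟨z, hz3, hz1, hz2⟩ := ((mem_closure_iff_frequently.1 hys).and_eventually
      (h1.and (hΩ.eventually_mem hy))).exists
    exact hz1 (hs z hz3 hz2)
  have hxc : x ∈ closure (⋃ k ∈ T.layer i m, closure (T.cell k))ᶜ := by
    rw [closure_compl]; exact fun h => hxr ⟨hx, h⟩
  refine key (fun z hz hzΩ => ?_) hx hxc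
  obtain ⟨k, hk⟩ := Set.mem_iUnion.1 (T.subset_iUnion_closure hΩ hzΩ)
  have hkl : k ∉ T.layer i m := fun h => hz (Set.mem_biUnion h hk)
  exact key (fun y hy _ => h0 k hkl y hy) hzΩ hk

section Layers

variable (hρ : 0 < ρ) (hH : 0 < H)
include hρ hH

theorem layer_subset_succ (i : ι) (m : ℕ) : T.layer i m ⊆ T.layer i (m + 1) := fun k hk =>
  ⟨k, hk, by rw [Set.inter_self]; exact (T.cell_nonempty hρ hH k).closure⟩

theorem layer_mono (i : ι) : Monotone (T.layer i) :=
  monotone_nat_of_le_succ (T.layer_subset_succ hρ hH i)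

theorem self_mem_layer (i : ι) (m : ℕ) : i ∈ T.layer i m :=
  T.layer_mono hρ hH i (zero_le (a := m)) rfl

omit hρ hH in
theorem mem_layer_one_comm {i k : ι} : k ∈ T.layer i 1 ↔ i ∈ T.layer k 1 := by
  simp only [layer, Set.mem_singleton_iff, exists_eq_left, Set.mem_ofPred_eq]
  rw [Set.inter_comm]

omit hρ hH in
theorem layer_subset_of_mem_layer_one {i k : ι} (hk : k ∈ T.layer i 1) (n : ℕ) :
    T.layer i n ⊆ T.layer k (n + 1) := by
  induction n with
  | zero => rintro l rfl; exact T.mem_layer_one_comm.1 hk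
  | succ n ih => rintro l ⟨m, hm, h⟩; exact ⟨m, ih hm, h⟩

omit hρ hH in
theorem dist_le_of_mem_closure_cell {i : ι} {x y : E d} (hx : x ∈ closure (T.cell i))
    (hy : y ∈ closure (T.cell i)) : dist x y ≤ H := by
  have h1 : ∀ a ∈ T.cell i, ∀ y ∈ closure (T.cell i), dist a y ≤ H := fun a ha y hy =>
    closure_minimal (fun b hb => T.diam_le i a ha b hb)
      (isClosed_le (continuous_const.dist continuous_id) continuous_const) hy
  exact closure_minimal (fun a ha => h1 a ha y hy)
    (isClosed_le (continuous_id.dist continuous_const) continuous_const) hx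

omit hρ hH in
theorem dist_le_of_mem_layer {i k : ι} {m : ℕ} (hk : k ∈ T.layer i m) {x y : E d}
    (hx : x ∈ closure (T.cell i)) (hy : y ∈ closure (T.cell k)) : dist x y ≤ (m + 1) * H := by
  induction m generalizing k y with
  | zero =>
    obtain rfl : k = i := hk
    simpa using T.dist_le_of_mem_closure_cell hx hy
  | succ m ih =>
    obtain ⟨l, hl, z, hz1, hz2⟩ := hk
    have h1 := ih hl hz1
    have h2 := T.dist_le_of_mem_closure_cell hz2 hy
    have h3 := dist_triangle x z y
    push_cast; linarith

/-- Volume count: a ball of radius `R` contains at most `(R / (ρ H))^d` cells. -/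
theorem card_mul_le_of_subset_closedBall (s : Finset ι) (y : E d) {R : ℝ} (hR : 0 ≤ R)
    (hs : ∀ k ∈ s, T.cell k ⊆ Metric.closedBall y R) : s.card * (ρ * H) ^ d ≤ R ^ d := by
  choose c hc using T.ball_subset
  have hpos : 0 < ρ * H := mul_pos hρ hH
  set V := (volume (Metric.ball (0 : E d) 1)).toReal with hV
  have hVpos : 0 < V := ENNReal.toReal_pos
    (Metric.measure_ball_pos volume _ one_pos).ne' measure_ball_lt_top.ne
  have hball : ∀ k, (ρ * H) ^ d * V ≤ volume.real (T.cell k) := by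
    intro k
    have hfin : volume (T.cell k) ≠ ⊤ := by
      refine (Bornology.IsBounded.measure_lt_top ?_).ne
      exact Metric.isBounded_iff.2 ⟨H, fun x hx y hy => T.diam_le k x hx y hy⟩
    refine le_of_eq_of_le ?_ (measureReal_mono (hc k) hfin)
    rw [measureReal_def, Measure.addHaar_ball_of_pos _ _ hpos, ENNReal.toReal_mul,
      ENNReal.toReal_ofReal (by positivity), finrank_euclideanSpace_fin]
  have hun : ∑ k ∈ s, volume.real (T.cell k) ≤ R ^ d * V := by
    rw [← measureReal_biUnion_finset (fun i _ k _ h => T.disjoint_cell i k h)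
      (fun k _ => T.measurableSet_cell k) fun k hk =>
        ((measure_mono (hs k hk)).trans_lt measure_closedBall_lt_top).ne]
    refine (measureReal_mono (Set.iUnion₂_subset hs) measure_closedBall_lt_top.ne).trans_eq ?_
    rw [measureReal_def, Measure.addHaar_closedBall _ _ hR, ENNReal.toReal_mul,
      ENNReal.toReal_ofReal (by positivity), finrank_euclideanSpace_fin]
  have h1 : s.card * ((ρ * H) ^ d * V) ≤ R ^ d * V := by
    refine le_trans ?_ hun
    rw [← nsmul_eq_mul]
    exact Finset.card_nsmul_le_sum _ _ _ fun k _ => hball k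
  rw [← mul_assoc] at h1
  exact le_of_mul_le_mul_right h1 hVpos

theorem card_le_of_dist_le (s : Finset ι) (y : E d) (m : ℕ)
    (hs : ∀ k ∈ s, ∀ x ∈ T.cell k, dist x y ≤ (m + 1) * H) :
    (s.card : ℝ) ≤ ((m + 1) / ρ) ^ d := by
  have h := T.card_mul_le_of_subset_closedBall hρ hH s y (R := (m + 1) * H) (by positivity)
    fun k hk x hx => hs k hk x hx
  rw [← le_div_iff₀ (by positivity), ← div_pow, mul_div_mul_right _ _ hH.ne'] at h
  exact h

open scoped Classical in
theorem card_filter_mem_layer_le (k : ι) (m : ℕ) :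
    ((Finset.univ.filter fun i => k ∈ T.layerFinset i m).card : ℝ) ≤ ((m + 1) / ρ) ^ d := by
  obtain ⟨y, hy⟩ := T.cell_nonempty hρ hH k
  refine T.card_le_of_dist_le hρ hH _ y m fun i hi x hx => ?_
  simp only [Finset.mem_filter, Finset.mem_univ, true_and, mem_layerFinset] at hi
  exact T.dist_le_of_mem_layer hi (subset_closure hx) (subset_closure hy)

end Layers

/-- The cutoff which sums the hat functions of the nodes on the cells of `K_n^+`; it is `1` on
`K_n^+` and `0` outside `K_{n+1}^+`. -/
def cutoff (i : ι) (n : ℕ) (x : E d) : ℝ := by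
  classical
  exact ∑ j ∈ Finset.univ.filter fun j => ∃ k ∈ T.layer i n, T.node j ∈ closure (T.cell k),
    T.hat j x

theorem exists_lipschitzOnWith_cutoff (i : ι) (n : ℕ) :
    ∃ L, LipschitzOnWith L (T.cutoff i n) Ω :=
  exists_lipschitzOnWith_sum _ T.hat_lipschitz

theorem cutoff_nonneg (i : ι) (n : ℕ) {x : E d} (hx : x ∈ Ω) : 0 ≤ T.cutoff i n x :=
  Finset.sum_nonneg fun j _ => T.hat_nonneg j x hx

theorem cutoff_le_one (i : ι) (n : ℕ) {x : E d} (hx : x ∈ Ω) : T.cutoff i n x ≤ 1 := by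
  rw [← T.hat_sum x hx]
  exact Finset.sum_le_univ_sum_of_nonneg fun j => T.hat_nonneg j x hx

theorem cutoff_eq_one {i k : ι} {n : ℕ} (hk : k ∈ T.layer i n) {x : E d} (hx : x ∈ T.cell k) :
    T.cutoff i n x = 1 := by
  classical
  rw [← T.hat_sum x (T.cell_subset k hx)]
  refine Finset.sum_subset (Finset.subset_univ _) fun j _ hj => ?_
  refine T.hat_support j k (fun h => hj ?_) x hx
  simpa using ⟨k, hk, h⟩

theorem cutoff_eq_zero {i k : ι} {n : ℕ} (hk : k ∉ T.layer i (n + 1)) {x : E d}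
    (hx : x ∈ T.cell k) : T.cutoff i n x = 0 := by
  classical
  refine Finset.sum_eq_zero fun j hj => ?_
  obtain ⟨l, hl, hjl⟩ := (Finset.mem_filter.1 hj).2
  exact T.hat_support j k (fun h => hk ⟨l, hl, T.node j, hjl, h⟩) x hx

theorem ae_forall_differentiableAt_hat (hΩ : IsOpen Ω) :
    ∀ᵐ x ∂volume.restrict Ω, ∀ j, DifferentiableAt ℝ (T.hat j) x := by
  refine ae_all_iff.2 fun j => ?_
  obtain ⟨L, hL⟩ := T.hat_lipschitz j
  exact ae_differentiableAt_of_lipschitzOn hΩ hL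

/-- On a cell only the at most `ν` hat functions of its own nodes have a nonzero gradient. -/
theorem norm_gradient_cutoff_sq_le (hΩ : IsOpen Ω) (i : ι) (n : ℕ) :
    ∀ᵐ x ∂volume.restrict Ω,
      ‖gradient (T.cutoff i n) x‖ ^ 2 ≤ ν * ∑ j, ‖gradient (T.hat j) x‖ ^ 2 := by
  classical
  filter_upwards [T.ae_forall_differentiableAt_hat hΩ, T.ae_exists_mem_cell hΩ] with x hd ⟨k, hk⟩
  let N : Finset J := Finset.univ.filter fun j => T.node j ∈ closure (T.cell k)
  have hN : (N.card : ℝ) ≤ ν := by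
    have := T.node_count k
    rw [Set.ncard_eq_toFinset_card'] at this
    exact_mod_cast (by simpa [N] using this)
  have h0 : ∀ j ∉ N, gradient (T.hat j) x = 0 := fun j hj =>
    gradient_eq_zero_of_eqOn_const (T.isOpen_cell k)
      (T.hat_support j k fun h => hj (by simpa [N] using h)) hk
  have h1 : gradient (T.cutoff i n) x = ∑ j ∈ Finset.univ.filter
      (fun j => ∃ k ∈ T.layer i n, T.node j ∈ closure (T.cell k)), gradient (T.hat j) x :=
    gradient_sum _ fun j _ => hd j
  have h2 : ‖gradient (T.cutoff i n) x‖ ≤ ∑ j ∈ N, ‖gradient (T.hat j) x‖ := by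
    rw [h1]
    refine (norm_sum_le _ _).trans ((Finset.sum_le_univ_sum_of_nonneg
      fun j => norm_nonneg _).trans_eq ?_)
    exact (Finset.sum_subset (Finset.subset_univ N) fun j _ hj => by rw [h0 j hj, norm_zero]).symm
  calc ‖gradient (T.cutoff i n) x‖ ^ 2 ≤ (∑ j ∈ N, ‖gradient (T.hat j) x‖) ^ 2 := by gcongr
    _ ≤ N.card * ∑ j ∈ N, ‖gradient (T.hat j) x‖ ^ 2 := sq_sum_le_card_mul_sum_sq
    _ ≤ ν * ∑ j, ‖gradient (T.hat j) x‖ ^ 2 := by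
      gcongr
      exact Finset.subset_univ _

end CoarseMesh

end

/-! ### The mass form and the energy form -/

section

variable {d : ℕ}

theorem integrable_mul_mul_of_memLp {α : Type*} [MeasurableSpace α] {μ : Measure α}
    {w a b : α → ℝ} (hw : MemLp w ⊤ μ) (ha : MemLp a 2 μ) (hb : MemLp b 2 μ) :
    Integrable (fun x => w x * a x * b x) μ := by
  have h : MemLp (fun x => w x * a x) 2 μ := ha.mul (p := ⊤) (q := 2) (r := 2) hw
  exact h.integrable_mul hb

/-- The Cauchy-Schwarz inequality for a weighted integral. -/
theorem abs_integral_mul_mul_le {α : Type*} [MeasurableSpace α] {μ : Measure α} {w a b : α → ℝ}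
    (hw : MemLp w ⊤ μ) (hw0 : ∀ᵐ x ∂μ, 0 ≤ w x) (ha : MemLp a 2 μ) (hb : MemLp b 2 μ) :
    |∫ x, w x * a x * b x ∂μ|
      ≤ √(∫ x, w x * a x * a x ∂μ) * √(∫ x, w x * b x * b x ∂μ) := by
  have iaa := integrable_mul_mul_of_memLp hw ha ha
  have iab := integrable_mul_mul_of_memLp hw ha hb
  have ibb := integrable_mul_mul_of_memLp hw hb hb
  have haa : 0 ≤ ∫ x, w x * a x * a x ∂μ := integral_nonneg_of_ae <| by
    filter_upwards [hw0] with x hx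
    rw [mul_assoc]; exact mul_nonneg hx (mul_self_nonneg _)
  rw [← Real.sqrt_mul haa]
  refine Real.abs_le_sqrt ?_
  have h : ∀ t : ℝ, 0 ≤ (∫ x, w x * a x * a x ∂μ) * (t * t)
      + (2 * ∫ x, w x * a x * b x ∂μ) * t + ∫ x, w x * b x * b x ∂μ := by
    intro t
    have h1 : 0 ≤ ∫ x, w x * (t * a x + b x) ^ 2 ∂μ := integral_nonneg_of_ae <| by
      filter_upwards [hw0] with x hx using mul_nonneg hx (sq_nonneg _)
    have h2 : ∫ x, w x * (t * a x + b x) ^ 2 ∂μ = ∫ x, ((t * t) * (w x * a x * a x)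
        + (2 * t) * (w x * a x * b x) + w x * b x * b x) ∂μ := by
      congr 1; ext x; ring
    have h3 : ∫ x, ((t * t) * (w x * a x * a x) + (2 * t) * (w x * a x * b x)
        + w x * b x * b x) ∂μ = (t * t) * ∫ x, w x * a x * a x ∂μ
        + (2 * t) * ∫ x, w x * a x * b x ∂μ + ∫ x, w x * b x * b x ∂μ := by
      rw [← integral_const_mul, ← integral_const_mul,
        ← integral_add (iaa.const_mul _) (iab.const_mul _)]
      exact integral_add ((iaa.const_mul _).add (iab.const_mul _)) ibb
    rw [h2, h3] at h1
    linarith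
  have := discrim_le_zero h
  unfold discrim at this
  nlinarith

section Mass

variable {Ω ω : Set (E d)} {kt : E d → ℝ} {u v w : E d → ℝ}

theorem sForm_comm (kt : E d → ℝ) (ω : Set (E d)) (u v : E d → ℝ) :
    sForm kt ω u v = sForm kt ω v u := by
  unfold sForm; congr 1; ext x; ring

theorem sForm_congr (hω : MeasurableSet ω) {u' v' : E d → ℝ} (hu : ∀ x ∈ ω, u x = u' x)
    (hv : ∀ x ∈ ω, v x = v' x) : sForm kt ω u v = sForm kt ω u' v' :=
  setIntegral_congr_fun hω fun x hx => by simp only [hu x hx, hv x hx]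

theorem sNorm_congr (hω : MeasurableSet ω) {u' : E d → ℝ} (hu : ∀ x ∈ ω, u x = u' x) :
    sNorm kt ω u = sNorm kt ω u' := by
  unfold sNorm; rw [sForm_congr hω hu hu]

theorem sNorm_nonneg (kt : E d → ℝ) (ω : Set (E d)) (u : E d → ℝ) : 0 ≤ sNorm kt ω u :=
  Real.sqrt_nonneg _

variable (hkt : MemLp kt ⊤ (volume.restrict Ω)) (hkt0 : ∀ᵐ x ∂volume.restrict Ω, 0 ≤ kt x)
  (hω : ω ⊆ Ω) (hu : MemLp u 2 (volume.restrict Ω)) (hv : MemLp v 2 (volume.restrict Ω))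
  (hw : MemLp w 2 (volume.restrict Ω))

include hkt hu hv in
theorem integrableOn_sForm : IntegrableOn (fun x => kt x * u x * v x) Ω :=
  integrable_mul_mul_of_memLp hkt hu hv

include hkt0 hω in
theorem sNorm_sq (u : E d → ℝ) : sNorm kt ω u ^ 2 = sForm kt ω u u := by
  refine Real.sq_sqrt (integral_nonneg_of_ae ?_)
  filter_upwards [ae_restrict_of_ae_restrict_of_subset hω hkt0] with x hx
  simpa [mul_assoc] using mul_nonneg hx (mul_self_nonneg _)

include hkt hω hu hv hw in
theorem sForm_sub_left : sForm kt ω (fun x => u x - v x) w = sForm kt ω u w - sForm kt ω v w := by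
  unfold sForm
  rw [← integral_sub ((integrableOn_sForm hkt hu hw).mono_set hω)
    ((integrableOn_sForm hkt hv hw).mono_set hω)]
  congr 1; ext x; ring

include hkt hω hu hv hw in
theorem sForm_sub_right :
    sForm kt ω w (fun x => u x - v x) = sForm kt ω w u - sForm kt ω w v := by
  simp only [sForm_comm kt ω w, sForm_sub_left hkt hω hu hv hw]

include hkt hkt0 hω hu hv in
theorem abs_sForm_le : |sForm kt ω u v| ≤ sNorm kt ω u * sNorm kt ω v :=
  abs_integral_mul_mul_le (hkt.mono_measure (Measure.restrict_mono_set _ hω))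
    (ae_restrict_of_ae_restrict_of_subset hω hkt0)
    (hu.mono_measure (Measure.restrict_mono_set _ hω))
    (hv.mono_measure (Measure.restrict_mono_set _ hω))

include hkt hkt0 hω hu hv in
theorem sNorm_add_sq_le : sNorm kt ω (fun x => u x + v x) ^ 2
    ≤ 2 * sNorm kt ω u ^ 2 + 2 * sNorm kt ω v ^ 2 := by
  simp only [sNorm_sq hkt0 hω]
  unfold sForm
  have hi : ∀ {f g : E d → ℝ}, MemLp f 2 (volume.restrict Ω) → MemLp g 2 (volume.restrict Ω) →
      IntegrableOn (fun x => kt x * f x * g x) ω := fun hf hg =>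
    (integrableOn_sForm hkt hf hg).mono_set hω
  rw [← integral_const_mul, ← integral_const_mul,
    ← integral_add ((hi hu hu).const_mul _) ((hi hv hv).const_mul _)]
  refine integral_mono_ae (hi (hu.add hv) (hu.add hv))
    (((hi hu hu).const_mul _).add ((hi hv hv).const_mul _)) ?_
  filter_upwards [ae_restrict_of_ae_restrict_of_subset hω hkt0] with x hx
  nlinarith [mul_nonneg hx (sq_nonneg (u x - v x))]

end Mass

section Energy

variable {Ω ω : Set (E d)} {C₁ C₂ : ℝ} (A : Flux Ω C₁ C₂) {D D' D₁ D₂ D₃ : E d → E d}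

/-- The flux is a Carathéodory function: for simple `D` the measurability is that of finitely many
functions `κ(·, z)`, and the Lipschitz bound passes it to the limit. -/
theorem Flux.aestronglyMeasurable_comp (hD : AEStronglyMeasurable D (volume.restrict Ω)) :
    AEStronglyMeasurable (fun x => A.flux x (D x)) (volume.restrict Ω) := by
  classical
  let s := hD.stronglyMeasurable_mk.approx
  have hs : ∀ n, AEStronglyMeasurable (fun x => A.flux x (s n x)) (volume.restrict Ω) := by
    intro n
    have h : (fun x => A.flux x (s n x)) = fun x => ∑ c ∈ (s n).range,
        ((s n) ⁻¹' {c}).indicator (fun x => A.flux x c) x := by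
      ext1 x
      rw [Finset.sum_eq_single (s n x)]
      · simp
      · intro c _ hc
        exact Set.indicator_of_notMem (fun h => hc (by simpa using h.symm)) _
      · intro h; exact absurd ((s n).mem_range_self x) h
    rw [h]
    exact Finset.aestronglyMeasurable_fun_sum _ fun c _ =>
      (A.meas c).indicator ((s n).measurableSet_fiber c)
  refine aestronglyMeasurable_of_tendsto_ae atTop hs ?_
  filter_upwards [hD.ae_eq_mk, A.lipschitz] with x hx hL
  rw [hx]
  have hlim : Tendsto (fun n => s n x) atTop (𝓝 (hD.mk D x)) :=
    hD.stronglyMeasurable_mk.tendsto_approx x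
  rw [tendsto_iff_norm_sub_tendsto_zero] at hlim ⊢
  exact squeeze_zero (fun _ => norm_nonneg _) (fun n => hL _ _)
    (by simpa using hlim.const_mul (C₁ * A.bar x))

theorem Flux.ae_norm_le : ∀ᵐ x ∂volume.restrict Ω, ∀ z, ‖A.flux x z‖ ≤ C₁ * A.bar x * ‖z‖ := by
  filter_upwards [A.lipschitz, A.zero] with x hL h0 z
  simpa [h0] using hL z 0

theorem Flux.memLp_comp (hD : MemLp D 2 (volume.restrict Ω)) :
    MemLp (fun x => A.flux x (D x)) 2 (volume.restrict Ω) := by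
  have h : MemLp (fun x => C₁ * (A.bar x * ‖D x‖)) 2 (volume.restrict Ω) :=
    (hD.norm.mul (p := ⊤) (q := 2) (r := 2) A.bar_memLp).const_mul C₁
  refine h.mono (A.aestronglyMeasurable_comp hD.1) ?_
  filter_upwards [A.ae_norm_le] with x hx
  rw [← mul_assoc]
  exact (hx _).trans (le_abs_self _)

theorem Flux.integrableOn_inner (hD : MemLp D 2 (volume.restrict Ω))
    (hD' : MemLp D' 2 (volume.restrict Ω)) :
    IntegrableOn (fun x => inner ℝ (A.flux x (D x)) (D' x)) Ω := by
  have h := (A.memLp_comp hD).norm.integrable_mul hD'.norm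
  refine h.mono ((A.memLp_comp hD).1.inner hD'.1) (Eventually.of_forall fun x => ?_)
  simpa using abs_real_inner_le_norm (A.flux x (D x)) (D' x)

theorem energyForm_congr (hω : MeasurableSet ω) (h : ∀ x ∈ ω, D₁ x = D₂ x) :
    energyForm A ω D D₁ = energyForm A ω D D₂ :=
  setIntegral_congr_fun hω fun x hx => by simp only [h x hx]

theorem aNorm_nonneg (ω : Set (E d)) (D : E d → E d) : 0 ≤ aNorm A ω D := Real.sqrt_nonneg _

theorem integrableOn_bar_mul_sq (hD : MemLp D 2 (volume.restrict Ω)) :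
    IntegrableOn (fun x => A.bar x * ‖D x‖ ^ 2) Ω := by
  refine (integrable_mul_mul_of_memLp A.bar_memLp hD.norm hD.norm).congr ?_
  filter_upwards with x; ring

theorem energyForm_add_right (hω : ω ⊆ Ω) (hD : MemLp D 2 (volume.restrict Ω))
    (h₁ : MemLp D₁ 2 (volume.restrict Ω)) (h₂ : MemLp D₂ 2 (volume.restrict Ω)) :
    energyForm A ω D (fun x => D₁ x + D₂ x) = energyForm A ω D D₁ + energyForm A ω D D₂ := by
  unfold energyForm
  rw [← integral_add ((A.integrableOn_inner hD h₁).mono_set hω)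
    ((A.integrableOn_inner hD h₂).mono_set hω)]
  simp only [inner_add_right]

theorem energyForm_zero_left (hω : ω ⊆ Ω) (D : E d → E d) :
    energyForm A ω (fun _ => 0) D = 0 := by
  refine integral_eq_zero_of_ae ?_
  filter_upwards [ae_restrict_of_ae_restrict_of_subset hω A.zero] with x hx
  simp [hx]

variable (hb : ∀ᵐ x ∂volume.restrict Ω, 0 ≤ A.bar x) (hω : ω ⊆ Ω)
include hb hω

theorem aNorm_sq (D : E d → E d) : aNorm A ω D ^ 2 = ∫ x in ω, A.bar x * ‖D x‖ ^ 2 := by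
  refine Real.sq_sqrt (integral_nonneg_of_ae ?_)
  filter_upwards [ae_restrict_of_ae_restrict_of_subset hω hb] with x hx
  exact mul_nonneg hx (sq_nonneg _)

/-- Comparison of energies from a pointwise comparison. -/
theorem aNorm_sq_le_of_ae (hD : MemLp D 2 (volume.restrict Ω)) {g : E d → ℝ}
    (hg : IntegrableOn g ω)
    (h : ∀ᵐ x ∂volume.restrict ω, A.bar x * ‖D x‖ ^ 2 ≤ g x) :
    aNorm A ω D ^ 2 ≤ ∫ x in ω, g x := by
  rw [aNorm_sq A hb hω]
  exact integral_mono_ae ((integrableOn_bar_mul_sq A hD).mono_set hω) hg h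

theorem aNorm_add_sq_le (h₁ : MemLp D₁ 2 (volume.restrict Ω))
    (h₂ : MemLp D₂ 2 (volume.restrict Ω)) :
    aNorm A ω (fun x => D₁ x + D₂ x) ^ 2 ≤ 2 * aNorm A ω D₁ ^ 2 + 2 * aNorm A ω D₂ ^ 2 := by
  have i₁ := ((integrableOn_bar_mul_sq A h₁).mono_set hω).const_mul 2
  have i₂ := ((integrableOn_bar_mul_sq A h₂).mono_set hω).const_mul 2
  refine (aNorm_sq_le_of_ae A hb hω (h₁.add h₂) (i₁.add i₂) ?_).trans_eq ?_
  · filter_upwards [ae_restrict_of_ae_restrict_of_subset hω hb] with x hx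
    have h3 : ‖D₁ x + D₂ x‖ ^ 2 ≤ 2 * ‖D₁ x‖ ^ 2 + 2 * ‖D₂ x‖ ^ 2 := by
      have := norm_add_le (D₁ x) (D₂ x)
      nlinarith [norm_nonneg (D₁ x + D₂ x), sq_nonneg (‖D₁ x‖ - ‖D₂ x‖)]
    have := mul_le_mul_of_nonneg_left h3 hx
    simp only [Pi.add_apply]
    linarith
  · simp only [Pi.add_apply]
    rw [integral_add i₁ i₂, integral_const_mul, integral_const_mul, aNorm_sq A hb hω,
      aNorm_sq A hb hω]

theorem aNorm_sub_sq_le (h₁ : MemLp D₁ 2 (volume.restrict Ω))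
    (h₂ : MemLp D₂ 2 (volume.restrict Ω)) :
    aNorm A ω (fun x => D₁ x - D₂ x) ^ 2 ≤ 2 * aNorm A ω D₁ ^ 2 + 2 * aNorm A ω D₂ ^ 2 := by
  have := aNorm_add_sq_le A hb hω h₁ h₂.neg
  simpa [← sub_eq_add_neg, aNorm] using this

theorem aNorm_smul_sq_le (hD : MemLp D 2 (volume.restrict Ω)) {η : E d → ℝ}
    (hη : ∀ x ∈ ω, |η x| ≤ 1) (hωm : MeasurableSet ω)
    (hηD : MemLp (fun x => η x • D x) 2 (volume.restrict Ω)) :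
    aNorm A ω (fun x => η x • D x) ^ 2 ≤ aNorm A ω D ^ 2 := by
  rw [aNorm_sq A hb hω D]
  refine aNorm_sq_le_of_ae A hb hω hηD ((integrableOn_bar_mul_sq A hD).mono_set hω) ?_
  filter_upwards [ae_restrict_of_ae_restrict_of_subset hω hb, ae_restrict_mem hωm] with x hx hxω
  rw [norm_smul]
  gcongr
  exact mul_le_of_le_one_left (norm_nonneg _) (hη x hxω)

/-- The Lipschitz bound on the flux, tested with a gradient field. -/
theorem abs_energyForm_sub_le (hC₁ : 0 ≤ C₁) (h₁ : MemLp D₁ 2 (volume.restrict Ω))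
    (h₂ : MemLp D₂ 2 (volume.restrict Ω)) (h₃ : MemLp D₃ 2 (volume.restrict Ω)) :
    |energyForm A ω D₁ D₃ - energyForm A ω D₂ D₃|
      ≤ C₁ * aNorm A ω (fun x => D₁ x - D₂ x) * aNorm A ω D₃ := by
  unfold energyForm
  rw [← integral_sub ((A.integrableOn_inner h₁ h₃).mono_set hω)
    ((A.integrableOn_inner h₂ h₃).mono_set hω)]
  have hmono := Measure.restrict_mono_set (volume : Measure (E d)) hω
  have hn : MemLp (fun x => ‖D₁ x - D₂ x‖) 2 (volume.restrict ω) :=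
    (h₁.sub h₂).norm.mono_measure hmono
  have hn3 : MemLp (fun x => ‖D₃ x‖) 2 (volume.restrict ω) := h₃.norm.mono_measure hmono
  have hbar : MemLp A.bar ⊤ (volume.restrict ω) := A.bar_memLp.mono_measure hmono
  have hb' := ae_restrict_of_ae_restrict_of_subset hω hb
  have hcs := abs_integral_mul_mul_le hbar hb' hn hn3
  have hint := (integrable_mul_mul_of_memLp hbar hn hn3).const_mul C₁
  calc |∫ x in ω, (inner ℝ (A.flux x (D₁ x)) (D₃ x) - inner ℝ (A.flux x (D₂ x)) (D₃ x))|
      ≤ ∫ x in ω, C₁ * (A.bar x * ‖D₁ x - D₂ x‖ * ‖D₃ x‖) := by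
        refine abs_integral_le_integral_abs.trans (integral_mono_of_nonneg
          (Eventually.of_forall fun x => abs_nonneg _) hint ?_)
        filter_upwards [ae_restrict_of_ae_restrict_of_subset hω A.lipschitz] with x hx
        rw [← inner_sub_left]
        refine (abs_real_inner_le_norm _ _).trans ?_
        have := mul_le_mul_of_nonneg_right (hx (D₁ x) (D₂ x)) (norm_nonneg (D₃ x))
        linarith
    _ = C₁ * ∫ x in ω, A.bar x * ‖D₁ x - D₂ x‖ * ‖D₃ x‖ := integral_const_mul _ _
    _ ≤ C₁ * (aNorm A ω (fun x => D₁ x - D₂ x) * aNorm A ω D₃) := by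
        gcongr
        refine (le_abs_self _).trans (hcs.trans_eq ?_)
        simp only [aNorm, mul_assoc, ← sq]
    _ = _ := by ring

omit hb in
/-- Monotonicity of the flux, localized by a nonnegative bounded factor. -/
theorem energyForm_sub_smul_nonneg (hC₂ : 0 ≤ C₂) (hb : ∀ᵐ x ∂volume.restrict Ω, 0 ≤ A.bar x)
    (hωm : MeasurableSet ω) {η : E d → ℝ}
    (hη : ∀ x ∈ ω, 0 ≤ η x) (h₁ : MemLp D₁ 2 (volume.restrict Ω))
    (h₂ : MemLp D₂ 2 (volume.restrict Ω))
    (h₃ : MemLp (fun x => η x • (D₁ x - D₂ x)) 2 (volume.restrict Ω)) :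
    0 ≤ energyForm A ω D₁ (fun x => η x • (D₁ x - D₂ x))
      - energyForm A ω D₂ (fun x => η x • (D₁ x - D₂ x)) := by
  unfold energyForm
  rw [← integral_sub ((A.integrableOn_inner h₁ h₃).mono_set hω)
    ((A.integrableOn_inner h₂ h₃).mono_set hω)]
  refine integral_nonneg_of_ae ?_
  filter_upwards [ae_restrict_of_ae_restrict_of_subset hω A.monotone,
    ae_restrict_of_ae_restrict_of_subset hω hb, ae_restrict_mem hωm] with x hx hbx hxω
  rw [← inner_sub_left, inner_smul_right]
  exact mul_nonneg (hη x hxω) (le_trans (by positivity) (hx _ _))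

/-- Strong monotonicity of the energy form. -/
theorem mul_aNorm_sq_le_energyForm_sub (h₁ : MemLp D₁ 2 (volume.restrict Ω))
    (h₂ : MemLp D₂ 2 (volume.restrict Ω)) :
    C₂ * aNorm A ω (fun x => D₁ x - D₂ x) ^ 2
      ≤ energyForm A ω D₁ (fun x => D₁ x - D₂ x) - energyForm A ω D₂ fun x => D₁ x - D₂ x := by
  have h₃ : MemLp (fun x => D₁ x - D₂ x) 2 (volume.restrict Ω) := h₁.sub h₂
  have i₁ := (A.integrableOn_inner h₁ h₃).mono_set hω
  have i₂ := (A.integrableOn_inner h₂ h₃).mono_set hω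
  rw [aNorm_sq A hb hω, ← integral_const_mul]
  refine le_of_le_of_eq (integral_mono_ae
    (((integrableOn_bar_mul_sq A h₃).mono_set hω).const_mul _) (i₁.sub i₂) ?_)
    (integral_sub i₁ i₂)
  filter_upwards [ae_restrict_of_ae_restrict_of_subset hω A.monotone] with x hx
  simp only [Pi.sub_apply]
  rw [← inner_sub_left, ← mul_assoc]
  exact hx _ _

end Energy

end

/-! ### The weight, the continua and weighted projections -/

section

variable {d : ℕ}

variable {Ω : Set (E d)} {ι J : Type} [Fintype ι] [Fintype J] {H ρ : ℝ} {ν : ℕ}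
  {C₁ C₂ : ℝ}

theorem norm_gradient_le_of_lipschitzOn (hΩ : IsOpen Ω) {η : E d → ℝ} {L : NNReal}
    (hL : LipschitzOnWith L η Ω) {x : E d} (hx : x ∈ Ω) : ‖gradient η x‖ ≤ L := by
  rw [norm_gradient]; exact norm_fderiv_le_of_lipschitzOn ℝ (hΩ.mem_nhds hx) hL

theorem memLp_top_gradient (hΩ : IsOpen Ω) {η : E d → ℝ} {L : NNReal}
    (hL : LipschitzOnWith L η Ω) : MemLp (gradient η) ⊤ (volume.restrict Ω) :=
  memLp_top_of_bound (measurable_gradient η).aestronglyMeasurable L <| by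
    filter_upwards [ae_restrict_mem hΩ.measurableSet] with x hx
    exact norm_gradient_le_of_lipschitzOn hΩ hL hx

theorem memLp_smul_gradient (hΩ : IsOpen Ω) {η : E d → ℝ} {L : NNReal}
    (hL : LipschitzOnWith L η Ω) {v : E d → ℝ} (hv : MemLp v 2 (volume.restrict Ω)) :
    MemLp (fun x => v x • gradient η x) 2 (volume.restrict Ω) :=
  (memLp_top_gradient hΩ hL).smul (p := 2) (q := ⊤) (r := 2) hv

theorem memLp_top_of_lipschitzOn (hΩ : IsOpen Ω) {η : E d → ℝ} {L : NNReal}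
    (hL : LipschitzOnWith L η Ω) {c : ℝ} (hc : ∀ x ∈ Ω, |η x| ≤ c) :
    MemLp η ⊤ (volume.restrict Ω) :=
  memLp_top_of_bound (hL.continuousOn.aestronglyMeasurable hΩ.measurableSet) c <| by
    filter_upwards [ae_restrict_mem hΩ.measurableSet] with x hx using hc x hx

theorem memLp_lipschitz_smul (hΩ : IsOpen Ω) {η : E d → ℝ} {L : NNReal}
    (hL : LipschitzOnWith L η Ω) {c : ℝ} (hc : ∀ x ∈ Ω, |η x| ≤ c) {D : E d → E d}
    (hD : MemLp D 2 (volume.restrict Ω)) :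
    MemLp (fun x => η x • D x) 2 (volume.restrict Ω) :=
  hD.smul (p := ⊤) (q := 2) (r := 2) (memLp_top_of_lipschitzOn hΩ hL hc)

theorem memLp_lipschitz_mul (hΩ : IsOpen Ω) {η : E d → ℝ} {L : NNReal}
    (hL : LipschitzOnWith L η Ω) {c : ℝ} (hc : ∀ x ∈ Ω, |η x| ≤ c) {v : E d → ℝ}
    (hv : MemLp v 2 (volume.restrict Ω)) :
    MemLp (fun x => η x * v x) 2 (volume.restrict Ω) :=
  hv.mul (p := ⊤) (q := 2) (r := 2) (memLp_top_of_lipschitzOn hΩ hL hc)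

theorem H10.memLp_val_restrict {ω : Set (E d)} (z : H10 ω) (Ω : Set (E d)) :
    MemLp z.val 2 (volume.restrict Ω) := z.memLp_val.restrict _

theorem H10.memLp_grad_restrict {ω : Set (E d)} (z : H10 ω) (Ω : Set (E d)) :
    MemLp z.grad 2 (volume.restrict Ω) := z.memLp_grad.restrict _

/-- An element of `H¹₀(ω)`, regarded as an element of `H¹₀(ω')` for a larger set `ω'`. -/
def H10.ofSubset {ω ω' : Set (E d)} (z : H10 ω) (h : ω ⊆ ω') : H10 ω' where
  val := z.val
  grad := z.grad
  memLp_val := z.memLp_val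
  memLp_grad := z.memLp_grad
  approx := by
    obtain ⟨φ, h1, h2, h3⟩ := z.approx
    exact ⟨φ, fun n => ⟨(h1 n).1, (h1 n).2.1, (h1 n).2.2.trans h⟩, h2, h3⟩

theorem H10.ae_eq_zero {ω : Set (E d)} (z : H10 ω) (hω : MeasurableSet ω) :
    ∀ᵐ x ∂(volume : Measure (E d)), x ∉ ω → z.val x = 0 ∧ z.grad x = 0 := by
  have h := z.isH10.ae_eq_zero hω
  filter_upwards [ae_imp_of_ae_restrict h.1, ae_imp_of_ae_restrict h.2] with x h1 h2 hx
  exact ⟨h1 hx, h2 hx⟩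

section Extension

variable {ω ω' : Set (E d)} (z : H10 ω) (hω : MeasurableSet ω) (hω' : MeasurableSet ω')
  (hsub : ω ⊆ ω')
include hω hω' hsub

theorem energyForm_eq_of_subset (A : Flux Ω C₁ C₂) (D : E d → E d) :
    energyForm A ω' D z.grad = energyForm A ω D z.grad := by
  refine setIntegral_eq_of_subset_of_ae_sdiff_eq_zero hω'.nullMeasurableSet hsub ?_
  filter_upwards [z.ae_eq_zero hω] with x hx hx'
  simp [(hx hx'.2).2]

theorem sForm_eq_of_subset (kt h : E d → ℝ) :
    sForm kt ω' h z.val = sForm kt ω h z.val := by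
  refine setIntegral_eq_of_subset_of_ae_sdiff_eq_zero hω'.nullMeasurableSet hsub ?_
  filter_upwards [z.ae_eq_zero hω] with x hx hx'
  simp [(hx hx'.2).1]

theorem sNorm_eq_of_subset (kt : E d → ℝ) : sNorm kt ω' z.val = sNorm kt ω z.val := by
  unfold sNorm; rw [sForm_eq_of_subset z hω hω' hsub]

theorem aNorm_eq_of_subset (A : Flux Ω C₁ C₂) : aNorm A ω' z.grad = aNorm A ω z.grad := by
  unfold aNorm; congr 1
  refine setIntegral_eq_of_subset_of_ae_sdiff_eq_zero hω'.nullMeasurableSet hsub ?_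
  filter_upwards [z.ae_eq_zero hω] with x hx hx'
  simp [(hx hx'.2).2]

end Extension

section Weight

variable {T : CoarseMesh Ω ι J H ρ ν} {A : Flux Ω C₁ C₂}

theorem bar_nonneg_of_weight_pos (hw : ∀ᵐ x ∂volume.restrict Ω, 0 < T.weight A x) :
    ∀ᵐ x ∂volume.restrict Ω, 0 ≤ A.bar x := by
  filter_upwards [hw] with x hx
  exact (pos_of_mul_pos_left hx (Finset.sum_nonneg fun j _ => sq_nonneg _)).le

theorem weight_nonneg (hw : ∀ᵐ x ∂volume.restrict Ω, 0 < T.weight A x) :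
    ∀ᵐ x ∂volume.restrict Ω, 0 ≤ T.weight A x := hw.mono fun _ h => h.le

theorem memLp_weight (hΩ : IsOpen Ω) (T : CoarseMesh Ω ι J H ρ ν) (A : Flux Ω C₁ C₂) :
    MemLp (T.weight A) ⊤ (volume.restrict Ω) := by
  have h : MemLp (fun x => ∑ j, ‖gradient (T.hat j) x‖ ^ 2) ⊤ (volume.restrict Ω) := by
    refine memLp_finsetSum _ fun j _ => ?_
    obtain ⟨L, hL⟩ := T.hat_lipschitz j
    refine memLp_top_of_bound
      ((measurable_gradient (T.hat j)).norm.pow_const 2).aestronglyMeasurable ((L : ℝ) ^ 2) ?_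
    filter_upwards [ae_restrict_mem hΩ.measurableSet] with x hx
    rw [Real.norm_of_nonneg (by positivity)]
    gcongr
    exact norm_gradient_le_of_lipschitzOn hΩ hL hx
  exact h.mul (p := ⊤) (q := ⊤) (r := ⊤) A.bar_memLp

variable (hΩ : IsOpen Ω) (hw : ∀ᵐ x ∂volume.restrict Ω, 0 < T.weight A x)

include hΩ hw in
/-- The term `v ∇η` of the product rule is controlled by the `s`-norm, since `κ̄ |∇η|²` is
controlled by `κ̃`. -/
theorem aNorm_smul_gradient_sq_le {ω : Set (E d)} (hω : ω ⊆ Ω) {η : E d → ℝ} {L : NNReal}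
    (hL : LipschitzOnWith L η Ω) {c : ℝ} (hη : ∀ᵐ x ∂volume.restrict Ω,
      ‖gradient η x‖ ^ 2 ≤ c * ∑ j, ‖gradient (T.hat j) x‖ ^ 2) {v : E d → ℝ}
    (hv : MemLp v 2 (volume.restrict Ω)) :
    aNorm A ω (fun x => v x • gradient η x) ^ 2 ≤ c * sNorm (T.weight A) ω v ^ 2 := by
  rw [sNorm_sq (weight_nonneg hw) hω, sForm, ← integral_const_mul]
  refine aNorm_sq_le_of_ae A (bar_nonneg_of_weight_pos hw) hω (memLp_smul_gradient hΩ hL hv)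
    (((integrableOn_sForm (memLp_weight hΩ T A) hv hv).mono_set hω).const_mul c) ?_
  filter_upwards [ae_restrict_of_ae_restrict_of_subset hω (bar_nonneg_of_weight_pos hw),
    ae_restrict_of_ae_restrict_of_subset hω hη] with x hx hηx
  rw [norm_smul, mul_pow, Real.norm_eq_abs, sq_abs, CoarseMesh.weight]
  have := mul_le_mul_of_nonneg_left hηx (mul_nonneg hx (sq_nonneg (v x)))
  linarith

include hΩ in
theorem sForm_eq_sum_cell {u v : E d → ℝ} (hu : MemLp u 2 (volume.restrict Ω))
    (hv : MemLp v 2 (volume.restrict Ω)) :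
    sForm (T.weight A) Ω u v = ∑ k, sForm (T.weight A) (T.cell k) u v :=
  T.integral_eq_sum_cell hΩ (integrableOn_sForm (memLp_weight hΩ T A) hu hv)

include hΩ in
theorem sForm_region_eq_sum_cell (i : ι) (m : ℕ) {u v : E d → ℝ}
    (hu : MemLp u 2 (volume.restrict Ω)) (hv : MemLp v 2 (volume.restrict Ω)) :
    sForm (T.weight A) (T.region i m) u v
      = ∑ k ∈ T.layerFinset i m, sForm (T.weight A) (T.cell k) u v :=
  T.integral_region_eq_sum_cell hΩ i m (integrableOn_sForm (memLp_weight hΩ T A) hu hv)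

include hΩ in
theorem energyForm_eq_sum_cell (T : CoarseMesh Ω ι J H ρ ν) {D D' : E d → E d}
    (hD : MemLp D 2 (volume.restrict Ω)) (hD' : MemLp D' 2 (volume.restrict Ω)) :
    energyForm A Ω D D' = ∑ k, energyForm A (T.cell k) D D' :=
  T.integral_eq_sum_cell hΩ (A.integrableOn_inner hD hD')

include hΩ in
theorem energyForm_region_eq_sum_cell (T : CoarseMesh Ω ι J H ρ ν) (i : ι) (m : ℕ)
    {D D' : E d → E d} (hD : MemLp D 2 (volume.restrict Ω))
    (hD' : MemLp D' 2 (volume.restrict Ω)) :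
    energyForm A (T.region i m) D D'
      = ∑ k ∈ T.layerFinset i m, energyForm A (T.cell k) D D' :=
  T.integral_region_eq_sum_cell hΩ i m (A.integrableOn_inner hD hD')

include hΩ hw in
theorem sNorm_sq_eq_sum_cell {u : E d → ℝ} (hu : MemLp u 2 (volume.restrict Ω)) :
    sNorm (T.weight A) Ω u ^ 2 = ∑ k, sNorm (T.weight A) (T.cell k) u ^ 2 := by
  rw [sNorm_sq (weight_nonneg hw) subset_rfl, sForm_eq_sum_cell hΩ hu hu]
  exact Finset.sum_congr rfl fun k _ => (sNorm_sq (weight_nonneg hw) (T.cell_subset k) u).symm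

include hΩ hw in
theorem aNorm_sq_eq_sum_cell {D : E d → E d} (hD : MemLp D 2 (volume.restrict Ω)) :
    aNorm A Ω D ^ 2 = ∑ k, aNorm A (T.cell k) D ^ 2 := by
  have hb := bar_nonneg_of_weight_pos hw
  rw [aNorm_sq A hb subset_rfl, T.integral_eq_sum_cell hΩ (integrableOn_bar_mul_sq A hD)]
  exact Finset.sum_congr rfl fun k _ => (aNorm_sq A hb (T.cell_subset k) D).symm

end Weight

namespace Continua

variable {T : CoarseMesh Ω ι J H ρ ν} (B : Continua T)

theorem aux_mono {S S' : Set ι} (h : S ⊆ S') : B.aux S ≤ B.aux S' :=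
  Submodule.span_mono fun _ ⟨i, hi, j, hg⟩ => ⟨i, h hi, j, hg⟩

theorem memLp_of_mem_aux (hΩ : IsOpen Ω) {S : Set ι} {v : E d → ℝ} (hv : v ∈ B.aux S) :
    MemLp v 2 (volume.restrict Ω) := by
  have : IsFiniteMeasure (volume.restrict Ω) := ⟨by simpa using T.volume_lt_top hΩ⟩
  induction hv using Submodule.span_induction with
  | mem x h =>
    obtain ⟨i, -, j, rfl⟩ := h
    exact (B.memLp_fn i j).mono_exponent le_top
  | zero => exact MemLp.zero'
  | add x y _ _ hx hy => exact hx.add hy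
  | smul a x _ hx => exact hx.const_smul a

theorem exists_mem_aux_singleton {S : Set ι} {v : E d → ℝ} (hv : v ∈ B.aux S) (k : ι) :
    ∃ v' ∈ B.aux {k}, ∀ x ∈ T.cell k, v x = v' x := by
  induction hv using Submodule.span_induction with
  | mem x h =>
    obtain ⟨i, -, j, rfl⟩ := h
    by_cases hik : i = k
    · subst hik
      exact ⟨_, Submodule.subset_span ⟨i, rfl, j, rfl⟩, fun _ _ => rfl⟩
    · exact ⟨0, Submodule.zero_mem _, fun x hx => B.support_fn i j k (Ne.symm hik) x hx⟩
  | zero => exact ⟨0, Submodule.zero_mem _, fun _ _ => rfl⟩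
  | add x y _ _ hx hy =>
    obtain ⟨x', hx', h1⟩ := hx
    obtain ⟨y', hy', h2⟩ := hy
    exact ⟨x' + y', Submodule.add_mem _ hx' hy', fun z hz => by simp [h1 z hz, h2 z hz]⟩
  | smul a x _ hx =>
    obtain ⟨x', hx', h1⟩ := hx
    exact ⟨a • x', Submodule.smul_mem _ a hx', fun z hz => by simp [h1 z hz]⟩

theorem eq_zero_of_mem_aux_singleton {k l : ι} (hkl : l ≠ k) {v : E d → ℝ} (hv : v ∈ B.aux {k})
    {x : E d} (hx : x ∈ T.cell l) : v x = 0 := by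
  induction hv using Submodule.span_induction with
  | mem x h =>
    obtain ⟨i, rfl, j, rfl⟩ := h
    exact B.support_fn i j l hkl _ hx
  | zero => rfl
  | add x y _ _ hx hy => simp [hx, hy]
  | smul a x _ hx => simp [hx]

theorem finite_generators (S : Set ι) : {g | ∃ i ∈ S, ∃ j, g = B.fn i j}.Finite := by
  refine (Set.finite_range fun p : (i : ι) × Fin (B.num i) => B.fn p.1 p.2).subset ?_
  rintro g ⟨i, -, j, rfl⟩
  exact ⟨⟨i, j⟩, rfl⟩

end Continua

theorem memLp_sqrt_mul {μ : Measure (E d)} {kt q : E d → ℝ} (hkt : MemLp kt ⊤ μ)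
    (hkt0 : ∀ᵐ x ∂μ, 0 ≤ kt x) (hq : MemLp q 2 μ) : MemLp (fun x => √(kt x) * q x) 2 μ := by
  have hsq : MemLp (fun x => √(kt x)) ⊤ μ := by
    refine ((memLp_top_const (1 : ℝ)).add hkt.norm).mono
      (Real.continuous_sqrt.comp_aestronglyMeasurable hkt.1) ?_
    filter_upwards [hkt0] with x hx
    simp only [Pi.add_apply, Real.norm_eq_abs, abs_of_nonneg hx]
    rw [abs_of_nonneg (Real.sqrt_nonneg _), abs_of_nonneg (by positivity)]
    nlinarith [Real.sq_sqrt hx, sq_nonneg (√(kt x) - 1)]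
  exact hq.mul (p := ⊤) (q := 2) (r := 2) hsq

/-- Existence of the weighted `L²` projection onto a finite-dimensional space of functions: it is
the orthogonal projection in `L²` after multiplication by the square root of the weight. -/
theorem exists_isProj {ω : Set (E d)} {kt : E d → ℝ} (hkt : MemLp kt ⊤ (volume.restrict ω))
    (hkt0 : ∀ᵐ x ∂volume.restrict ω, 0 ≤ kt x) (V : Submodule ℝ (E d → ℝ))
    [FiniteDimensional ℝ V] (hV : ∀ q ∈ V, MemLp q 2 (volume.restrict ω)) {v : E d → ℝ}
    (hv : MemLp v 2 (volume.restrict ω)) : ∃ p, IsProj kt ω V v p := by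
  have hm : ∀ {q : E d → ℝ}, MemLp q 2 (volume.restrict ω) →
      MemLp (fun x => √(kt x) * q x) 2 (volume.restrict ω) := fun hq =>
    memLp_sqrt_mul hkt hkt0 hq
  let Φ : V →ₗ[ℝ] Lp ℝ 2 (volume.restrict ω) :=
    { toFun := fun q => (hm (hV q q.2)).toLp
      map_add' := fun q q' => by
        rw [← MemLp.toLp_add]
        congr 1; ext x; simp [mul_add]
      map_smul' := fun c q => by
        simp only [RingHom.id_apply]
        rw [← MemLp.toLp_const_smul]
        congr 1; ext x; simp; ring }
  have hinner : ∀ {a b : E d → ℝ} (ha : MemLp a 2 (volume.restrict ω))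
      (hb : MemLp b 2 (volume.restrict ω)),
      inner ℝ (hm ha).toLp (hm hb).toLp = sForm kt ω a b := by
    intro a b ha hb
    rw [L2.inner_def]
    refine integral_congr_ae ?_
    filter_upwards [(hm ha).coeFn_toLp, (hm hb).coeFn_toLp, hkt0] with x h1 h2 h3
    rw [h1, h2]
    calc inner ℝ (√(kt x) * a x) (√(kt x) * b x) = √(kt x) * b x * (√(kt x) * a x) := rfl
      _ = (√(kt x) * √(kt x)) * a x * b x := by ring
      _ = _ := by rw [Real.mul_self_sqrt h3]
  obtain ⟨⟨p, hp⟩, hpv⟩ : ((LinearMap.range Φ).starProjection (hm hv).toLp : Lp ℝ 2 _)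
      ∈ LinearMap.range Φ := Submodule.starProjection_apply_mem _ _
  refine ⟨p, hp, fun q hq => ?_⟩
  have h1 : inner ℝ ((hm hv).toLp - (LinearMap.range Φ).starProjection (hm hv).toLp)
      (Φ ⟨q, hq⟩) = 0 :=
    Submodule.starProjection_inner_eq_zero _ _ ⟨_, rfl⟩
  rw [← hpv, inner_sub_left, sub_eq_zero] at h1
  rw [← hinner hv (hV q hq), ← hinner (hV p hp) (hV q hq)]
  exact h1.symm

end

/-! ### Local solutions and their multipliers -/

section

variable {d : ℕ}

variable {Ω : Set (E d)} {ι J : Type} [Fintype ι] [Fintype J] {H ρ : ℝ} {ν : ℕ}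
  {C₁ C₂ : ℝ}

theorem sNorm_mul_sq_le {kt : E d → ℝ} {ω : Set (E d)} (hkt : MemLp kt ⊤ (volume.restrict Ω))
    (hkt0 : ∀ᵐ x ∂volume.restrict Ω, 0 ≤ kt x) (hω : ω ⊆ Ω) (hωm : MeasurableSet ω)
    {η v : E d → ℝ} (hη : ∀ x ∈ ω, |η x| ≤ 1) (hv : MemLp v 2 (volume.restrict Ω))
    (hηv : MemLp (fun x => η x * v x) 2 (volume.restrict Ω)) :
    sNorm kt ω (fun x => η x * v x) ^ 2 ≤ sNorm kt ω v ^ 2 := by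
  rw [sNorm_sq hkt0 hω, sNorm_sq hkt0 hω]
  refine integral_mono_ae ((integrableOn_sForm hkt hηv hηv).mono_set hω)
    ((integrableOn_sForm hkt hv hv).mono_set hω) ?_
  filter_upwards [ae_restrict_of_ae_restrict_of_subset hω hkt0, ae_restrict_mem hωm] with x hx hxω
  have h1 : η x ^ 2 ≤ 1 := (sq_le_one_iff_abs_le_one _).2 (hη x hxω)
  have h2 := mul_nonneg hx (sq_nonneg (v x))
  nlinarith

namespace CoarseMesh

variable (T : CoarseMesh Ω ι J H ρ ν)

theorem region_subset_region {i i' : ι} {m m' : ℕ} (h : T.layer i m ⊆ T.layer i' m') :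
    T.region i m ⊆ T.region i' m' :=
  Set.inter_subset_inter_right _ (interior_mono (Set.biUnion_subset_biUnion_left h))

/-- A domain carrying a coarse mesh and a weight `κ̃` which is positive almost everywhere is not the
whole space: in positive dimension it is bounded, and in dimension zero all gradients vanish. The
complement is needed for cutoffs in terms of the distance to it. -/
theorem compl_nonempty (hΩ : IsOpen Ω) {A : Flux Ω C₁ C₂}
    (hw : ∀ᵐ x ∂volume.restrict Ω, 0 < T.weight A x) : (Ωᶜ).Nonempty := by
  by_contra hne
  rw [Set.not_nonempty_iff_eq_empty, Set.compl_empty_iff] at hne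
  rcases Nat.eq_zero_or_pos d with rfl | hd
  · have h0 : ∀ x, T.weight A x = 0 := fun x => by
      simp only [weight]
      rw [Finset.sum_eq_zero fun j _ => ?_, mul_zero]
      rw [Subsingleton.elim (gradient (T.hat j) x) 0, norm_zero]; ring
    have h1 : ∀ᵐ x ∂volume.restrict Ω, False := hw.mono fun x hx => by simp [h0 x] at hx
    rw [hne, Measure.restrict_univ] at h1
    exact (ae_neBot.2 (NeZero.ne (volume : Measure (E 0)))).ne (eventually_false_iff_eq_bot.1 h1)
  · have : Nonempty (Fin d) := ⟨⟨0, hd⟩⟩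
    have : Nontrivial (E d) := inferInstance
    have hb := T.isBounded hΩ
    rw [hne] at hb
    exact NormedSpace.unbounded_univ ℝ (E d) hb

end CoarseMesh

variable {T : CoarseMesh Ω ι J H ρ ν} {A : Flux Ω C₁ C₂} {B : Continua T}

/-- The inf-sup condition bounds an auxiliary function by the difference of fluxes that it
balances on a cell. -/
theorem InfSup.sNorm_le {Cas : ℝ} (hI : InfSup A B Cas) (hC₁ : 0 ≤ C₁) (hCas : 0 ≤ Cas)
    (hw : ∀ᵐ x ∂volume.restrict Ω, 0 < T.weight A x) {S : Set ι} {h : E d → ℝ}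
    (hh : h ∈ B.aux S) {k : ι} {D₁ D₂ : E d → E d} (h₁ : MemLp D₁ 2 (volume.restrict Ω))
    (h₂ : MemLp D₂ 2 (volume.restrict Ω))
    (heq : ∀ w : H10 (T.cell k), energyForm A (T.cell k) D₁ w.grad
      - energyForm A (T.cell k) D₂ w.grad = sForm (T.weight A) (T.cell k) h w.val) :
    sNorm (T.weight A) (T.cell k) h
      ≤ C₁ * Cas * aNorm A (T.cell k) fun x => D₁ x - D₂ x := by
  obtain ⟨h', hh', hcell⟩ := B.exists_mem_aux_singleton hh k
  have hm := T.measurableSet_cell k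
  rw [sNorm_congr hm hcell]
  obtain ⟨w, hw1, hw2⟩ := hI k h' hh'
  have h3 := abs_energyForm_sub_le A (bar_nonneg_of_weight_pos hw) (T.cell_subset k) hC₁ h₁ h₂
    (w.memLp_grad_restrict Ω)
  rw [heq w, sForm_congr hm hcell (fun _ _ => rfl)] at h3
  have h4 := (le_abs_self _).trans h3
  set s := sNorm (T.weight A) (T.cell k) h'
  have hs : 0 ≤ s := sNorm_nonneg _ _ _
  set a := aNorm A (T.cell k) fun x => D₁ x - D₂ x
  have ha : 0 ≤ a := aNorm_nonneg _ _ _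
  have h5 : s * s ≤ C₁ * Cas * a * s := by
    calc s * s = s ^ 2 := (sq s).symm
      _ ≤ C₁ * a * aNorm A (T.cell k) w.grad := hw1.trans h4
      _ ≤ C₁ * a * (Cas * s) := by gcongr
      _ = _ := by ring
  rcases hs.eq_or_lt with h0 | h0
  · rw [← h0]; positivity
  · exact le_of_mul_le_mul_right h5 h0

/-- A function with vanishing projection on a cell is controlled there by its energy. -/
theorem CoarseApproximation.sNorm_le {Cas : ℝ} (hP : CoarseApproximation A B Cas) {k : ι}
    {v : E d → ℝ} {D : E d → E d} (hv : IsH10 Ω v D)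
    (h0 : ∀ q ∈ B.aux {k}, sForm (T.weight A) (T.cell k) v q = 0) :
    sNorm (T.weight A) (T.cell k) v ≤ Cas * H * aNorm A (T.cell k) D := by
  obtain ⟨z, rfl, rfl⟩ := hv
  have := hP k z 0 ⟨Submodule.zero_mem _, fun q hq => by rw [h0 q hq]; simp [sForm]⟩
  simpa using this

namespace IsLocalDownscaling

variable {M : ℕ} {i i' : ι} {U : E d → ℝ} {F₁ : H10 (T.region i M)} {F₁' : H10 (T.region i' M)}
  {F₂ F₂' : E d → ℝ}

/-- The local equation may be tested with functions supported in a smaller set. -/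
theorem equation_of_subset (hL : IsLocalDownscaling A B M i U F₁ F₂) (hΩ : IsOpen Ω)
    {ω : Set (E d)} (hω : MeasurableSet ω) (hsub : ω ⊆ T.region i M) (z : H10 ω) :
    energyForm A ω F₁.grad z.grad = sForm (T.weight A) ω F₂ z.val := by
  have hr := (T.isOpen_region hΩ i M).measurableSet
  have h := hL.equation (z.ofSubset hsub)
  rw [sub_eq_zero] at h
  rw [← energyForm_eq_of_subset z hω hr hsub, ← sForm_eq_of_subset z hω hr hsub]
  exact h

/-- A continuum lives on its own cell, so the constraint holds cell by cell. -/
theorem constraint_cell (hL : IsLocalDownscaling A B M i U F₁ F₂) (hΩ : IsOpen Ω)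
    (hU : U ∈ B.aux Set.univ) {k : ι} (hk : k ∈ T.layer i M) {q : E d → ℝ} (hq : q ∈ B.aux {k}) :
    sForm (T.weight A) (T.cell k) F₁.val q = sForm (T.weight A) (T.cell k) U q := by
  have hkt := memLp_weight hΩ T A
  have hUm := B.memLp_of_mem_aux hΩ hU
  have hFm := F₁.memLp_val_restrict Ω
  have key : ∀ j, sForm (T.weight A) (T.cell k) F₁.val (B.fn k j)
      = sForm (T.weight A) (T.cell k) U (B.fn k j) := by
    intro j
    have hfn : B.fn k j ∈ B.aux {k} := Submodule.subset_span ⟨k, rfl, j, rfl⟩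
    have hfm := B.memLp_of_mem_aux hΩ hfn
    have h0 : ∀ (v : E d → ℝ), ∀ l, l ≠ k → sForm (T.weight A) (T.cell l) v (B.fn k j) = 0 := by
      intro v l hl
      rw [sForm_congr (v' := fun _ => 0) (T.measurableSet_cell l) (fun _ _ => rfl)
        (fun x hx => B.eq_zero_of_mem_aux_singleton hl hfn hx)]
      simp [sForm]
    have h := hL.constraint k hk j
    rw [sForm_region_eq_sum_cell hΩ i M hFm hfm, sForm_eq_sum_cell hΩ hUm hfm,
      Finset.sum_eq_single k (fun l _ hl => h0 _ l hl)
        (fun h => absurd (T.mem_layerFinset.2 hk) h),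
      Finset.sum_eq_single k (fun l _ hl => h0 _ l hl)
        (fun h => absurd (Finset.mem_univ k) h)] at h
    exact h
  have hsub := T.cell_subset k
  induction hq using Submodule.span_induction with
  | mem x h =>
    obtain ⟨l, hl, j, rfl⟩ := h
    obtain rfl : l = k := hl
    exact key j
  | zero => simp [sForm]
  | add x y hx hy ihx ihy =>
    have hxm := B.memLp_of_mem_aux hΩ hx
    have hym := (B.memLp_of_mem_aux hΩ hy).neg
    have e : x + y = fun z => x z - (-y) z := by ext z; simp
    have e2 : ∀ v, sForm (T.weight A) (T.cell k) v (-y) = - sForm (T.weight A) (T.cell k) v y := by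
      intro v; unfold sForm; rw [← integral_neg]; congr 1; ext z; simp
    rw [e, sForm_sub_right hkt hsub hxm hym hFm, sForm_sub_right hkt hsub hxm hym hUm, ihx, e2, e2,
      ihy]
  | smul a x _ ihx =>
    have e2 : ∀ v, sForm (T.weight A) (T.cell k) v (a • x)
        = a * sForm (T.weight A) (T.cell k) v x := by
      intro v; unfold sForm; rw [← integral_const_mul]; congr 1; ext z
      simp only [Pi.smul_apply, smul_eq_mul]; ring
    rw [e2, e2, ihx]

/-- The energy of a local solution is bounded by its data: test the equation with the solution
itself and bound the multiplier by the inf-sup condition. -/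
theorem sum_aNorm_sq_le (hL : IsLocalDownscaling A B M i U F₁ F₂) (hΩ : IsOpen Ω)
    (hw : ∀ᵐ x ∂volume.restrict Ω, 0 < T.weight A x) (hU : U ∈ B.aux Set.univ) {Cas : ℝ}
    (hI : InfSup A B Cas) (hC₁ : 0 ≤ C₁) (hC₂ : 0 < C₂) (hCas : 0 ≤ Cas) :
    ∑ k ∈ T.layerFinset i M, aNorm A (T.cell k) F₁.grad ^ 2
      ≤ (Cas * (C₁ / C₂)) ^ 2
        * ∑ k ∈ T.layerFinset i M, sNorm (T.weight A) (T.cell k) U ^ 2 := by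
  have hkt := memLp_weight hΩ T A
  have hkt0 := weight_nonneg hw
  have hb := bar_nonneg_of_weight_pos hw
  have hUm := B.memLp_of_mem_aux hΩ hU
  have hF₂m := B.memLp_of_mem_aux hΩ hL.mem_aux
  have hG := F₁.memLp_grad_restrict Ω
  have hZ : MemLp (fun _ : E d => (0 : E d)) 2 (volume.restrict Ω) := MemLp.zero'
  set X := ∑ k ∈ T.layerFinset i M, aNorm A (T.cell k) F₁.grad ^ 2 with hX
  set Y := ∑ k ∈ T.layerFinset i M, sNorm (T.weight A) (T.cell k) U ^ 2 with hY
  have hX0 : 0 ≤ X := Finset.sum_nonneg fun _ _ => sq_nonneg _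
  have hY0 : 0 ≤ Y := Finset.sum_nonneg fun _ _ => sq_nonneg _
  have h1 : C₂ * X ≤ ∑ k ∈ T.layerFinset i M, energyForm A (T.cell k) F₁.grad F₁.grad := by
    rw [hX, Finset.mul_sum]
    refine Finset.sum_le_sum fun k _ => ?_
    have := mul_aNorm_sq_le_energyForm_sub A hb (T.cell_subset k) hG hZ
    simpa [energyForm_zero_left A (T.cell_subset k)] using this
  have h2 : ∑ k ∈ T.layerFinset i M, energyForm A (T.cell k) F₁.grad F₁.grad
      = ∑ k ∈ T.layerFinset i M, sForm (T.weight A) (T.cell k) F₂ F₁.val := by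
    rw [← energyForm_region_eq_sum_cell hΩ T i M hG hG,
      ← sForm_region_eq_sum_cell hΩ i M hF₂m (F₁.memLp_val_restrict Ω)]
    exact sub_eq_zero.1 (hL.equation F₁)
  have h3 : ∀ k ∈ T.layerFinset i M, sForm (T.weight A) (T.cell k) F₂ F₁.val
      ≤ C₁ * Cas * (aNorm A (T.cell k) F₁.grad * sNorm (T.weight A) (T.cell k) U) := by
    intro k hk
    have hk' := T.mem_layerFinset.1 hk
    have hm := T.measurableSet_cell k
    have h4 : sNorm (T.weight A) (T.cell k) F₂ ≤ C₁ * Cas * aNorm A (T.cell k) F₁.grad := by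
      have := hI.sNorm_le hC₁ hCas hw hL.mem_aux (k := k) hG hZ fun w => by
        rw [energyForm_zero_left A (T.cell_subset k), sub_zero]
        exact hL.equation_of_subset hΩ hm (T.cell_subset_region hk') w
      simpa using this
    obtain ⟨h', hh', hcell⟩ := B.exists_mem_aux_singleton hL.mem_aux k
    -- the multiplier only sees the projection of the solution, which is prescribed by `U`
    have h5 : sForm (T.weight A) (T.cell k) F₂ F₁.val = sForm (T.weight A) (T.cell k) F₂ U := by
      rw [sForm_congr hm hcell (fun _ _ => rfl), sForm_comm,
        hL.constraint_cell hΩ hU hk' hh', sForm_comm,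
        sForm_congr hm (fun x hx => (hcell x hx).symm) (fun _ _ => rfl)]
    rw [h5]
    refine (le_abs_self _).trans ((abs_sForm_le hkt hkt0 (T.cell_subset k) hF₂m hUm).trans ?_)
    rw [← mul_assoc]
    exact mul_le_mul_of_nonneg_right h4 (sNorm_nonneg _ _ _)
  have h6 : C₂ * X ≤ C₁ * Cas * ∑ k ∈ T.layerFinset i M,
      aNorm A (T.cell k) F₁.grad * sNorm (T.weight A) (T.cell k) U := by
    exact (h1.trans (h2.trans_le (Finset.sum_le_sum h3))).trans_eq (Finset.mul_sum _ _ _).symm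
  have h7 : (∑ k ∈ T.layerFinset i M, aNorm A (T.cell k) F₁.grad
      * sNorm (T.weight A) (T.cell k) U) ^ 2 ≤ X * Y := Finset.sum_mul_sq_le_sq_mul_sq _ _ _
  have h8 : (C₂ * X) ^ 2 ≤ (C₁ * Cas) ^ 2 * (X * Y) := by
    calc (C₂ * X) ^ 2 ≤ (C₁ * Cas * ∑ k ∈ T.layerFinset i M,
          aNorm A (T.cell k) F₁.grad * sNorm (T.weight A) (T.cell k) U) ^ 2 := by gcongr
      _ = (C₁ * Cas) ^ 2 * _ := mul_pow _ _ _
      _ ≤ _ := by gcongr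
  rcases hX0.eq_or_lt with h0 | h0
  · rw [← h0]; positivity
  · have h9 : X ≤ (C₁ * Cas) ^ 2 * Y / C₂ ^ 2 := by
      rw [le_div_iff₀ (by positivity)]
      refine le_of_mul_le_mul_right ?_ h0
      linarith
    refine h9.trans_eq ?_
    field_simp

section Difference

variable (hL : IsLocalDownscaling A B M i U F₁ F₂) (hL' : IsLocalDownscaling A B M i' U F₁' F₂')
  (hΩ : IsOpen Ω) (hU : U ∈ B.aux Set.univ) {k : ι} (hk : k ∈ T.layer i M)
  (hk' : k ∈ T.layer i' M)

theorem isH10_sub : IsH10 Ω (fun x => F₁.val x - F₁'.val x) fun x => F₁.grad x - F₁'.grad x :=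
  (F₁.isH10.mono (T.region_subset i M)).sub (F₁'.isH10.mono (T.region_subset i' M))

include hL hL' hΩ hU hk hk'

theorem sForm_sub_eq_zero {q : E d → ℝ} (hq : q ∈ B.aux {k}) :
    sForm (T.weight A) (T.cell k) (fun x => F₁.val x - F₁'.val x) q = 0 := by
  rw [sForm_sub_left (memLp_weight hΩ T A) (T.cell_subset k) (F₁.memLp_val_restrict Ω)
    (F₁'.memLp_val_restrict Ω) (B.memLp_of_mem_aux hΩ hq), hL.constraint_cell hΩ hU hk hq,
    hL'.constraint_cell hΩ hU hk' hq, sub_self]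

theorem sNorm_sub_le {Cas : ℝ} (hP : CoarseApproximation A B Cas) :
    sNorm (T.weight A) (T.cell k) (fun x => F₁.val x - F₁'.val x)
      ≤ Cas * H * aNorm A (T.cell k) fun x => F₁.grad x - F₁'.grad x :=
  hP.sNorm_le isH10_sub fun _ hq => hL.sForm_sub_eq_zero hL' hΩ hU hk hk' hq

omit hU in
/-- The multipliers of two local problems differ no more than the fluxes of the two solutions. -/
theorem sNorm_multiplier_sub_le (hw : ∀ᵐ x ∂volume.restrict Ω, 0 < T.weight A x) {Cas : ℝ}
    (hI : InfSup A B Cas) (hC₁ : 0 ≤ C₁) (hCas : 0 ≤ Cas) :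
    sNorm (T.weight A) (T.cell k) (fun x => F₂ x - F₂' x)
      ≤ C₁ * Cas * aNorm A (T.cell k) fun x => F₁.grad x - F₁'.grad x := by
  have hm := T.measurableSet_cell k
  refine hI.sNorm_le (S := Set.univ) hC₁ hCas hw (Submodule.sub_mem _
    (B.aux_mono (Set.subset_univ _) hL.mem_aux) (B.aux_mono (Set.subset_univ _) hL'.mem_aux))
    (F₁.memLp_grad_restrict Ω) (F₁'.memLp_grad_restrict Ω) fun w => ?_
  rw [hL.equation_of_subset hΩ hm (T.cell_subset_region hk) w,
    hL'.equation_of_subset hΩ hm (T.cell_subset_region hk') w]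
  exact (sForm_sub_left (memLp_weight hΩ T A) (T.cell_subset k) (B.memLp_of_mem_aux hΩ hL.mem_aux)
    (B.memLp_of_mem_aux hΩ hL'.mem_aux) (w.memLp_val_restrict Ω)).symm

end Difference

end IsLocalDownscaling

end

/-! ### Exponential decay of the difference of local solutions -/

section

variable {d : ℕ}

variable {Ω : Set (E d)} {ι J : Type} [Fintype ι] [Fintype J] {H ρ : ℝ} {ν : ℕ}
  {C₁ C₂ : ℝ}
variable {T : CoarseMesh Ω ι J H ρ ν} {A : Flux Ω C₁ C₂} {B : Continua T}

namespace IsLocalDownscaling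

variable {M : ℕ} {i i' : ι} {U : E d → ℝ} {F₁ : H10 (T.region i M)} {F₁' : H10 (T.region i' M)}
  {F₂ F₂' : E d → ℝ}

/-- The energy of the difference of two local solutions in `K_n^+` is controlled by its energy in
the next layer. The difference of the two equations is tested with the difference of the solutions
times a cutoff; the multipliers drop out where the cutoff is `1`, because the two solutions have
the same projections. -/
theorem sum_layer_le (hL : IsLocalDownscaling A B M i U F₁ F₂)
    (hL' : IsLocalDownscaling A B M i' U F₁' F₂') (hΩ : IsOpen Ω) (hρ : 0 < ρ) (hH : 0 < H)
    (hw : ∀ᵐ x ∂volume.restrict Ω, 0 < T.weight A x) (hU : U ∈ B.aux Set.univ) {Cas : ℝ}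
    (hP : CoarseApproximation A B Cas) (hI : InfSup A B Cas) (hC₁ : 0 ≤ C₁) (hC₂ : 0 ≤ C₂)
    (hCas : 0 ≤ Cas) {n : ℕ} (hn : T.layer i (n + 1) ⊆ T.layer i M)
    (hn' : T.layer i (n + 1) ⊆ T.layer i' M) :
    C₂ * ∑ k ∈ T.layerFinset i n, aNorm A (T.cell k) (fun x => F₁.grad x - F₁'.grad x) ^ 2
      ≤ C₁ * (√ν * Cas * H + Cas ^ 2 * H)
        * (∑ k ∈ T.layerFinset i (n + 1), aNorm A (T.cell k) (fun x => F₁.grad x - F₁'.grad x) ^ 2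
          - ∑ k ∈ T.layerFinset i n,
            aNorm A (T.cell k) (fun x => F₁.grad x - F₁'.grad x) ^ 2) := by
  classical
  have hkt := memLp_weight hΩ T A
  have hkt0 := weight_nonneg hw
  have hb := bar_nonneg_of_weight_pos hw
  have hG := F₁.memLp_grad_restrict Ω
  have hG' := F₁'.memLp_grad_restrict Ω
  have hF₂ := B.memLp_of_mem_aux hΩ hL.mem_aux
  have hF₂' := B.memLp_of_mem_aux hΩ hL'.mem_aux
  set w : E d → ℝ := fun x => F₁.val x - F₁'.val x
  set D : E d → E d := fun x => F₁.grad x - F₁'.grad x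
  have hwm : MemLp w 2 (volume.restrict Ω) :=
    (F₁.memLp_val_restrict Ω).sub (F₁'.memLp_val_restrict Ω)
  have hDm : MemLp D 2 (volume.restrict Ω) := hG.sub hG'
  set η := T.cutoff i n
  obtain ⟨L, hLip⟩ := T.exists_lipschitzOnWith_cutoff i n
  have hη1 : ∀ x ∈ Ω, |η x| ≤ 1 := fun x hx => by
    rw [abs_of_nonneg (T.cutoff_nonneg i n hx)]; exact T.cutoff_le_one i n hx
  have hrsub := T.region_subset i (n + 1)
  have hr := T.isOpen_region hΩ i (n + 1)
  obtain ⟨z, hz1, hz2⟩ := IsH10.exists_mul_lipschitz hΩ hr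
    ((T.compl_nonempty hΩ hw).mono (Set.compl_subset_compl.2 hrsub)) hrsub
    (isH10_sub (F₁ := F₁) (F₁' := F₁')) hLip (fun x hx => T.cutoff_nonneg i n hx)
    (fun x hx => T.cutoff_le_one i n hx)
    (fun x hx hxr => T.eq_zero_of_notMem_region hΩ hLip.continuousOn
      (fun k hk y hy => T.cutoff_eq_zero hk hy) hx hxr)
  have hzm := z.memLp_val_restrict Ω
  have hzG := z.memLp_grad_restrict Ω
  have h1 := hL.equation_of_subset hΩ hr.measurableSet (T.region_subset_region hn) z
  have h2 := hL'.equation_of_subset hΩ hr.measurableSet (T.region_subset_region hn') z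
  rw [energyForm_region_eq_sum_cell hΩ T _ _ hG hzG,
    sForm_region_eq_sum_cell hΩ _ _ hF₂ hzm] at h1
  rw [energyForm_region_eq_sum_cell hΩ T _ _ hG' hzG,
    sForm_region_eq_sum_cell hΩ _ _ hF₂' hzm] at h2
  have h3 : ∑ k ∈ T.layerFinset i (n + 1), (energyForm A (T.cell k) F₁.grad z.grad
      - energyForm A (T.cell k) F₁'.grad z.grad
      - sForm (T.weight A) (T.cell k) (fun x => F₂ x - F₂' x) z.val) = 0 := by
    rw [Finset.sum_sub_distrib, Finset.sum_sub_distrib, h1, h2, ← Finset.sum_sub_distrib,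
      ← Finset.sum_sub_distrib]
    refine Finset.sum_eq_zero fun k _ => ?_
    rw [sForm_sub_left hkt (T.cell_subset k) hF₂ hF₂' hzm, sub_self]
  have hsub : T.layerFinset i n ⊆ T.layerFinset i (n + 1) := fun k hk =>
    T.mem_layerFinset.2 (T.layer_subset_succ hρ hH i n (T.mem_layerFinset.1 hk))
  rw [← Finset.sum_sdiff hsub] at h3 ⊢
  set a : ι → ℝ := fun k => aNorm A (T.cell k) D
  have ha0 : ∀ k, 0 ≤ a k := fun k => aNorm_nonneg _ _ _
  -- where the cutoff is `1`, the multipliers drop out and monotonicity applies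
  have hinner : ∀ k ∈ T.layerFinset i n, C₂ * a k ^ 2 ≤ energyForm A (T.cell k) F₁.grad z.grad
      - energyForm A (T.cell k) F₁'.grad z.grad
      - sForm (T.weight A) (T.cell k) (fun x => F₂ x - F₂' x) z.val := by
    intro k hk
    have hk0 := T.mem_layerFinset.1 hk
    have hk1 := T.layer_subset_succ hρ hH i n hk0
    have hm := T.measurableSet_cell k
    have e1 : ∀ x ∈ T.cell k, z.val x = w x := fun x hx => by
      rw [hz1 x (T.cell_subset k hx), T.cutoff_eq_one hk0 hx, one_mul]
    have e2 : ∀ x ∈ T.cell k, z.grad x = D x := fun x hx => by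
      rw [hz2 x (T.cell_subset_region hk1 hx), T.cutoff_eq_one hk0 hx,
        gradient_eq_zero_of_eqOn_const (T.isOpen_cell k) (fun y hy => T.cutoff_eq_one hk0 hy) hx,
        one_smul, smul_zero, add_zero]
    obtain ⟨h', hh', hcell⟩ : ∃ h' ∈ B.aux {k}, ∀ x ∈ T.cell k, F₂ x - F₂' x = h' x :=
      B.exists_mem_aux_singleton (S := Set.univ) (Submodule.sub_mem _
        (B.aux_mono (Set.subset_univ _) hL.mem_aux)
        (B.aux_mono (Set.subset_univ _) hL'.mem_aux)) k
    have e3 : sForm (T.weight A) (T.cell k) (fun x => F₂ x - F₂' x) z.val = 0 := by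
      rw [sForm_congr hm hcell e1, sForm_comm]
      exact hL.sForm_sub_eq_zero hL' hΩ hU (hn hk1) (hn' hk1) hh'
    rw [energyForm_congr A hm e2, energyForm_congr A hm e2, e3, sub_zero]
    exact mul_aNorm_sq_le_energyForm_sub A hb (T.cell_subset k) hG hG'
  -- in the outermost layer, the terms with `∇η` and with the multipliers are bounded by the energy
  have houter : ∀ k ∈ T.layerFinset i (n + 1) \ T.layerFinset i n,
      -(C₁ * (√ν * Cas * H + Cas ^ 2 * H) * a k ^ 2) ≤ energyForm A (T.cell k) F₁.grad z.grad
      - energyForm A (T.cell k) F₁'.grad z.grad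
      - sForm (T.weight A) (T.cell k) (fun x => F₂ x - F₂' x) z.val := by
    intro k hk
    have hk1 := T.mem_layerFinset.1 (Finset.mem_sdiff.1 hk).1
    have hm := T.measurableSet_cell k
    have hsubk := T.cell_subset k
    have e1 : ∀ x ∈ T.cell k, z.val x = η x * w x := fun x hx => hz1 x (hsubk hx)
    have e2 : ∀ x ∈ T.cell k, z.grad x = η x • D x + w x • gradient η x := fun x hx =>
      hz2 x (T.cell_subset_region hk1 hx)
    have m1 : MemLp (fun x => η x • D x) 2 (volume.restrict Ω) :=
      memLp_lipschitz_smul hΩ hLip hη1 hDm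
    have m2 : MemLp (fun x => w x • gradient η x) 2 (volume.restrict Ω) :=
      memLp_smul_gradient hΩ hLip hwm
    have m3 : MemLp (fun x => η x * w x) 2 (volume.restrict Ω) :=
      memLp_lipschitz_mul hΩ hLip hη1 hwm
    have e3 := energyForm_sub_smul_nonneg A hsubk hC₂ hb hm (η := η)
      (fun x hx => T.cutoff_nonneg i n (hsubk hx)) hG hG' m1
    have e4 := abs_energyForm_sub_le A hb hsubk hC₁ hG hG' m2
    have hws : sNorm (T.weight A) (T.cell k) w ≤ Cas * H * a k :=
      hL.sNorm_sub_le hL' hΩ hU (hn hk1) (hn' hk1) hP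
    have hF : sNorm (T.weight A) (T.cell k) (fun x => F₂ x - F₂' x) ≤ C₁ * Cas * a k :=
      hL.sNorm_multiplier_sub_le hL' hΩ (hn hk1) (hn' hk1) hw hI hC₁ hCas
    have e5 : aNorm A (T.cell k) (fun x => w x • gradient η x) ≤ √ν * (Cas * H * a k) := by
      have := aNorm_smul_gradient_sq_le hΩ hw hsubk hLip
        (T.norm_gradient_cutoff_sq_le hΩ i n) hwm
      refine le_trans (abs_le_of_sq_le_sq' (b := √ν * sNorm (T.weight A) (T.cell k) w) ?_ ?_).2 ?_
      · rw [mul_pow, Real.sq_sqrt (Nat.cast_nonneg _)]; exact this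
      · exact mul_nonneg (Real.sqrt_nonneg _) (sNorm_nonneg _ _ _)
      · gcongr
    have e6 : |sForm (T.weight A) (T.cell k) (fun x => F₂ x - F₂' x) (fun x => η x * w x)|
        ≤ C₁ * Cas * a k * (Cas * H * a k) := by
      refine (abs_sForm_le hkt hkt0 hsubk (hF₂.sub hF₂') m3).trans ?_
      have : sNorm (T.weight A) (T.cell k) (fun x => η x * w x) ≤ Cas * H * a k :=
        (abs_le_of_sq_le_sq' (sNorm_mul_sq_le hkt hkt0 hsubk hm
          (fun x hx => hη1 x (hsubk hx)) hwm m3) (sNorm_nonneg _ _ _)).2.trans hws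
      exact mul_le_mul hF this (sNorm_nonneg _ _ _)
        (mul_nonneg (mul_nonneg hC₁ hCas) (ha0 k))
    rw [energyForm_congr A hm e2, energyForm_congr A hm e2,
      energyForm_add_right A hsubk hG m1 m2, energyForm_add_right A hsubk hG' m1 m2,
      sForm_congr hm (fun _ _ => rfl) e1]
    have e7 := (abs_le.1 e4).1
    have e8 := (abs_le.1 e6).2
    have e9 : C₁ * a k * aNorm A (T.cell k) (fun x => w x • gradient η x)
        ≤ C₁ * a k * (√ν * (Cas * H * a k)) :=
      mul_le_mul_of_nonneg_left e5 (mul_nonneg hC₁ (ha0 k))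
    linarith
  have h4 := add_le_add (Finset.sum_le_sum houter) (Finset.sum_le_sum hinner)
  rw [h3, ← Finset.mul_sum, Finset.sum_neg_distrib, ← Finset.mul_sum] at h4
  linarith

/-- Exponential decay of the difference of the local solutions of two neighbouring cells: the layers
of `K` up to the `(M - 1)`-st one lie in both oversampling regions. -/
theorem aNorm_sub_sq_le_pow (hL : IsLocalDownscaling A B M i U F₁ F₂)
    (hL' : IsLocalDownscaling A B M i' U F₁' F₂') (hΩ : IsOpen Ω) (hρ : 0 < ρ) (hH : 0 < H)
    (hw : ∀ᵐ x ∂volume.restrict Ω, 0 < T.weight A x) (hU : U ∈ B.aux Set.univ) {Cas : ℝ}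
    (hP : CoarseApproximation A B Cas) (hI : InfSup A B Cas) (hC₁ : 0 ≤ C₁) (hC₂ : 0 < C₂)
    (hCas : 0 ≤ Cas) (hM : 1 ≤ M) (hi : i' ∈ T.layer i 1) {q : ℝ} (hq : 0 ≤ q)
    (hqC : C₁ * (√ν * Cas * H + Cas ^ 2 * H)
      ≤ q * (C₂ + C₁ * (√ν * Cas * H + Cas ^ 2 * H))) :
    aNorm A (T.cell i) (fun x => F₁.grad x - F₁'.grad x) ^ 2
      ≤ q ^ (M - 1) * (2 * ∑ k ∈ T.layerFinset i M, aNorm A (T.cell k) F₁.grad ^ 2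
        + 2 * ∑ k ∈ T.layerFinset i' M, aNorm A (T.cell k) F₁'.grad ^ 2) := by
  have hb := bar_nonneg_of_weight_pos hw
  set e : ℕ → ℝ := fun n => ∑ k ∈ T.layerFinset i n,
    aNorm A (T.cell k) (fun x => F₁.grad x - F₁'.grad x) ^ 2 with he
  have hlay : T.layer i (M - 1) ⊆ T.layer i' M := by
    have := T.layer_subset_of_mem_layer_one hi (M - 1)
    rwa [Nat.sub_add_cancel hM] at this
  have hstep : ∀ n, n + 1 ≤ M - 1 → e n ≤ q * e (n + 1) := by
    intro n hn
    have h := hL.sum_layer_le hL' hΩ hρ hH hw hU hP hI hC₁ hC₂.le hCas (n := n)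
      (T.layer_mono hρ hH i (by omega)) ((T.layer_mono hρ hH i hn).trans hlay)
    set Λ := C₁ * (√ν * Cas * H + Cas ^ 2 * H)
    have hΛ0 : 0 ≤ Λ := by positivity
    have he0 : 0 ≤ e (n + 1) := Finset.sum_nonneg fun _ _ => sq_nonneg _
    have h2 : (C₂ + Λ) * e n ≤ Λ * e (n + 1) := by simp only [he]; linarith
    have h3 : Λ * e (n + 1) ≤ (C₂ + Λ) * (q * e (n + 1)) := by
      have := mul_le_mul_of_nonneg_right hqC he0
      linarith
    exact le_of_mul_le_mul_left (h2.trans h3) (by positivity)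
  -- `(C₂ + Λ) e n ≤ Λ e (n + 1)` is iterated from the cell itself outwards
  have hiter : ∀ n, n ≤ M - 1 → e 0 ≤ q ^ n * e n := by
    intro n
    induction n with
    | zero => intro _; simp
    | succ n ih =>
      intro hn
      refine (ih (by omega)).trans ?_
      rw [pow_succ, mul_assoc]
      gcongr
      exact hstep n hn
  have h0 : e 0 = aNorm A (T.cell i) (fun x => F₁.grad x - F₁'.grad x) ^ 2 := by
    have : T.layerFinset i 0 = {i} := by
      ext k; simp [CoarseMesh.layer]
    simp only [he, this, Finset.sum_singleton]
  rw [← h0]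
  refine (hiter (M - 1) le_rfl).trans ?_
  gcongr
  have hs1 : T.layerFinset i (M - 1) ⊆ T.layerFinset i M := fun k hk =>
    T.mem_layerFinset.2 (T.layer_mono hρ hH i (Nat.sub_le _ _) (T.mem_layerFinset.1 hk))
  have hs2 : T.layerFinset i (M - 1) ⊆ T.layerFinset i' M := fun k hk =>
    T.mem_layerFinset.2 (hlay (T.mem_layerFinset.1 hk))
  calc e (M - 1) ≤ ∑ k ∈ T.layerFinset i (M - 1), (2 * aNorm A (T.cell k) F₁.grad ^ 2
        + 2 * aNorm A (T.cell k) F₁'.grad ^ 2) := Finset.sum_le_sum fun k _ =>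
        aNorm_sub_sq_le A hb (T.cell_subset k) (F₁.memLp_grad_restrict Ω)
          (F₁'.memLp_grad_restrict Ω)
    _ = 2 * ∑ k ∈ T.layerFinset i (M - 1), aNorm A (T.cell k) F₁.grad ^ 2
        + 2 * ∑ k ∈ T.layerFinset i (M - 1), aNorm A (T.cell k) F₁'.grad ^ 2 := by
        rw [Finset.sum_add_distrib, Finset.mul_sum, Finset.mul_sum]
    _ ≤ _ := by
        gcongr

end IsLocalDownscaling

end

/-! ### Gluing of local solutions -/

section

variable {d : ℕ}

variable {Ω : Set (E d)} {ι J : Type} [Fintype ι] [Fintype J] {H ρ : ℝ} {ν : ℕ}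
  {C₁ C₂ : ℝ}
variable {T : CoarseMesh Ω ι J H ρ ν} {A : Flux Ω C₁ C₂} {B : Continua T}

theorem norm_sum_smul_sq_le {κ F : Type*} [NormedAddCommGroup F] [NormedSpace ℝ F] (s : Finset κ)
    (c : κ → ℝ) (X : κ → F) :
    ‖∑ i ∈ s, c i • X i‖ ^ 2 ≤ (∑ i ∈ s, c i ^ 2) * ∑ i ∈ s, ‖X i‖ ^ 2 := by
  calc ‖∑ i ∈ s, c i • X i‖ ^ 2 ≤ (∑ i ∈ s, |c i| * ‖X i‖) ^ 2 := by
        gcongr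
        refine (norm_sum_le _ _).trans (Finset.sum_le_sum fun i _ => ?_)
        rw [norm_smul, Real.norm_eq_abs]
    _ ≤ (∑ i ∈ s, |c i| ^ 2) * ∑ i ∈ s, ‖X i‖ ^ 2 := Finset.sum_mul_sq_le_sq_mul_sq _ _ _
    _ = _ := by simp only [sq_abs]

theorem CoarseMesh.sum_sum_layer_comm (T : CoarseMesh Ω ι J H ρ ν) (g : ι → ι → ℝ) :
    ∑ i, ∑ k ∈ T.layerFinset i 1, g i k = ∑ k, ∑ i ∈ T.layerFinset k 1, g i k :=
  Finset.sum_comm' fun i k => by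
    simp only [Finset.mem_univ, true_and, and_true, mem_layerFinset]
    exact T.mem_layer_one_comm

/-- The enlargements `K_m^+` overlap at most `((m + 1) / ρ)^d` times. -/
theorem CoarseMesh.sum_sum_layer_le (T : CoarseMesh Ω ι J H ρ ν) (hρ : 0 < ρ) (hH : 0 < H) (m : ℕ)
    {g : ι → ℝ} (hg : ∀ k, 0 ≤ g k) :
    ∑ i, ∑ k ∈ T.layerFinset i m, g k ≤ ((m + 1) / ρ) ^ d * ∑ k, g k := by
  classical
  rw [Finset.sum_comm' (t' := Finset.univ)
    (s' := fun k => Finset.univ.filter fun i => k ∈ T.layerFinset i m) (by simp), Finset.mul_sum]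
  refine Finset.sum_le_sum fun k _ => ?_
  rw [Finset.sum_const, nsmul_eq_mul]
  exact mul_le_mul_of_nonneg_right (T.card_filter_mem_layer_le hρ hH k m) (hg k)

namespace IsGluing

variable {Cχ : ℝ} {χ : ι → E d → ℝ} (hχ : IsGluing T Cχ χ)
include hχ

theorem le_one (i : ι) {x : E d} (hx : x ∈ Ω) : χ i x ≤ 1 := by
  rw [← hχ.sum_eq x hx]
  exact Finset.single_le_sum (f := fun i => χ i x) (fun i _ => hχ.nonneg i x hx)
    (Finset.mem_univ i)

theorem abs_le_one (i : ι) {x : E d} (hx : x ∈ Ω) : |χ i x| ≤ 1 := by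
  rw [abs_of_nonneg (hχ.nonneg i x hx)]; exact hχ.le_one i hx

theorem eq_zero_of_mem_cell {i k : ι} (hk : k ∉ T.layer i 1) {x : E d} (hx : x ∈ T.cell k) :
    χ i x = 0 := by
  refine hχ.support i x (T.cell_subset k hx) fun h => ?_
  obtain ⟨l, hl, hxl⟩ := Set.mem_iUnion₂.1 h
  exact hk (T.eq_of_mem_cell_of_mem_closure hx hxl ▸ hl)

theorem gradient_eq_zero_of_mem_cell {i k : ι} (hk : k ∉ T.layer i 1) {x : E d}
    (hx : x ∈ T.cell k) : gradient (χ i) x = 0 :=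
  gradient_eq_zero_of_eqOn_const (T.isOpen_cell k) (fun _ hy => hχ.eq_zero_of_mem_cell hk hy) hx

theorem norm_gradient_sq_le (i : ι) : ∀ᵐ x ∂volume.restrict Ω,
    ‖gradient (χ i) x‖ ^ 2 ≤ Cχ * ∑ j, ‖gradient (T.hat j) x‖ ^ 2 := by
  filter_upwards [hχ.grad_le] with x hx
  exact (Finset.single_le_sum (f := fun i => ‖gradient (χ i) x‖ ^ 2) (fun i _ => sq_nonneg _)
    (Finset.mem_univ i)).trans hx

theorem sum_gradient_eq_zero (hΩ : IsOpen Ω) :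
    ∀ᵐ x ∂volume.restrict Ω, ∑ i, gradient (χ i) x = 0 := by
  have hd : ∀ᵐ x ∂volume.restrict Ω, ∀ i, DifferentiableAt ℝ (χ i) x := by
    refine ae_all_iff.2 fun i => ?_
    obtain ⟨L, hL⟩ := hχ.lipschitz i
    exact ae_differentiableAt_of_lipschitzOn hΩ hL
  filter_upwards [hd, ae_restrict_mem hΩ.measurableSet] with x hx hxΩ
  rw [← gradient_sum _ fun i _ => hx i]
  exact gradient_eq_zero_of_eqOn_const hΩ hχ.sum_eq hxΩ

theorem sum_layer_eq_one {k : ι} {x : E d} (hx : x ∈ T.cell k) :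
    ∑ i ∈ T.layerFinset k 1, χ i x = 1 := by
  rw [← hχ.sum_eq x (T.cell_subset k hx)]
  refine Finset.sum_subset (Finset.subset_univ _) fun i _ hi =>
    hχ.eq_zero_of_mem_cell (k := k) ?_ hx
  rwa [T.mem_layerFinset, T.mem_layer_one_comm] at hi

theorem sum_layer_gradient_eq_zero (hΩ : IsOpen Ω) (k : ι) :
    ∀ᵐ x ∂volume.restrict (T.cell k), ∑ i ∈ T.layerFinset k 1, gradient (χ i) x = 0 := by
  filter_upwards [ae_restrict_of_ae_restrict_of_subset (T.cell_subset k)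
    (hχ.sum_gradient_eq_zero hΩ), ae_restrict_mem (T.measurableSet_cell k)] with x hx hxk
  rw [← hx]
  refine Finset.sum_subset (Finset.subset_univ _) fun i _ hi =>
    hχ.gradient_eq_zero_of_mem_cell (k := k) ?_ hxk
  rwa [T.mem_layerFinset, T.mem_layer_one_comm] at hi

theorem sum_sq_le_one {x : E d} (hx : x ∈ Ω) (s : Finset ι) : ∑ i ∈ s, χ i x ^ 2 ≤ 1 := by
  rw [← hχ.sum_eq x hx]
  calc ∑ i ∈ s, χ i x ^ 2 ≤ ∑ i ∈ s, χ i x := Finset.sum_le_sum fun i _ => by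
        nlinarith [hχ.nonneg i x hx, hχ.le_one i hx]
    _ ≤ _ := Finset.sum_le_univ_sum_of_nonneg fun i => hχ.nonneg i x hx

/-- Multiplication by a gluing function maps `H¹₀(Ω)` to `H¹₀(K_M^+)`. -/
theorem exists_mul (hΩ : IsOpen Ω) (hρ : 0 < ρ) (hH : 0 < H)
    (hw : ∀ᵐ x ∂volume.restrict Ω, 0 < T.weight A x) {M : ℕ} (hM : 1 ≤ M) (i : ι) {v : E d → ℝ}
    {D : E d → E d} (h : IsH10 Ω v D) : ∃ z : H10 (T.region i M),
      (∀ x ∈ Ω, z.val x = χ i x * v x) ∧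
      ∀ x ∈ T.region i M, z.grad x = χ i x • D x + v x • gradient (χ i) x := by
  obtain ⟨L, hL⟩ := hχ.lipschitz i
  have hrsub := T.region_subset i M
  exact IsH10.exists_mul_lipschitz hΩ (T.isOpen_region hΩ i M)
    ((T.compl_nonempty hΩ hw).mono (Set.compl_subset_compl.2 hrsub)) hrsub h hL (hχ.nonneg i)
    (fun x hx => hχ.le_one i hx) fun x hx hxr =>
      T.eq_zero_of_notMem_region hΩ hL.continuousOn (fun k hk y hy =>
        hχ.eq_zero_of_mem_cell (fun hk1 => hk (T.layer_mono hρ hH i hM hk1)) hy) hx hxr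

/-- The glued function `∑_K χ_K F_K` belongs to `H¹₀(Ω)`. -/
theorem exists_sum_mul (hΩ : IsOpen Ω) (hw : ∀ᵐ x ∂volume.restrict Ω, 0 < T.weight A x) {M : ℕ}
    (F : (i : ι) → H10 (T.region i M)) : ∃ z : H10 Ω,
      (∀ x ∈ Ω, z.val x = ∑ i, χ i x * (F i).val x) ∧
      ∀ x ∈ Ω, z.grad x = ∑ i, (χ i x • (F i).grad x + (F i).val x • gradient (χ i) x) := by
  have h : ∀ i, ∃ z : H10 Ω, (∀ x ∈ Ω, z.val x = χ i x * (F i).val x) ∧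
      ∀ x ∈ Ω, z.grad x = χ i x • (F i).grad x + (F i).val x • gradient (χ i) x := by
    intro i
    obtain ⟨L, hL⟩ := hχ.lipschitz i
    exact IsH10.exists_mul_lipschitz hΩ hΩ (T.compl_nonempty hΩ hw) subset_rfl
      ((F i).isH10.mono (T.region_subset i M)) hL (hχ.nonneg i)
      (fun x hx => hχ.le_one i hx) fun x hx hxr => absurd hx hxr
  choose z hz1 hz2 using h
  obtain ⟨y, hy1, hy2⟩ := IsH10.sum Finset.univ fun i _ => (z i).isH10
  refine ⟨y, fun x hx => ?_, fun x hx => ?_⟩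
  · rw [hy1]; exact Finset.sum_congr rfl fun i _ => hz1 i x hx
  · rw [hy2]; exact Finset.sum_congr rfl fun i _ => hz2 i x hx

end IsGluing

/-- The total discrepancy between the local solutions of neighbouring cells, in the energy norm
of the cells. -/
def jumpSq {M : ℕ} (A : Flux Ω C₁ C₂) (F : (i : ι) → H10 (T.region i M)) : ℝ :=
  ∑ k, ∑ i ∈ T.layerFinset k 1, aNorm A (T.cell k) (fun x => (F k).grad x - (F i).grad x) ^ 2

theorem jumpSq_nonneg {M : ℕ} (A : Flux Ω C₁ C₂) (F : (i : ι) → H10 (T.region i M)) :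
    0 ≤ jumpSq A F :=
  Finset.sum_nonneg fun _ _ => Finset.sum_nonneg fun _ _ => sq_nonneg _

section Solution

variable {M : ℕ} {f U : E d → ℝ} {F₁ : (i : ι) → H10 (T.region i M)} {F₂ : ι → E d → ℝ}
  {χ : ι → E d → ℝ} {Cχ Cas : ℝ}

/-- The discrepancy of the local solutions decays exponentially in the number of layers. -/
theorem jumpSq_le (hN : IsNLMCSolution A B M f U F₁ F₂) (hΩ : IsOpen Ω) (hρ : 0 < ρ) (hH : 0 < H)
    (hw : ∀ᵐ x ∂volume.restrict Ω, 0 < T.weight A x)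
    (hP : CoarseApproximation A B Cas) (hI : InfSup A B Cas) (hC₁ : 0 ≤ C₁) (hC₂ : 0 < C₂)
    (hCas : 0 ≤ Cas) (hM : 1 ≤ M) {q : ℝ} (hq : 0 ≤ q)
    (hqC : C₁ * (√ν * Cas * H + Cas ^ 2 * H)
      ≤ q * (C₂ + C₁ * (√ν * Cas * H + Cas ^ 2 * H))) :
    jumpSq A F₁ ≤ q ^ (M - 1) * (4 * ((1 + 1) / ρ) ^ d * ((Cas * (C₁ / C₂)) ^ 2
      * (((M + 1) / ρ) ^ d * sNorm (T.weight A) Ω U ^ 2))) := by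
  have hU := hN.mem_aux
  set e : ι → ℝ := fun i => ∑ k ∈ T.layerFinset i M, aNorm A (T.cell k) (F₁ i).grad ^ 2 with he
  have he0 : ∀ i, 0 ≤ e i := fun i => Finset.sum_nonneg fun _ _ => sq_nonneg _
  have hnbr : ∀ {g : ι → ℝ}, (∀ k, 0 ≤ g k) →
      ∑ k, ∑ i ∈ T.layerFinset k 1, g i ≤ ((1 + 1) / ρ) ^ d * ∑ k, g k := fun hg => by
    simpa using T.sum_sum_layer_le hρ hH 1 hg
  have h1 : jumpSq A F₁ ≤ ∑ k, ∑ i ∈ T.layerFinset k 1, q ^ (M - 1) * (2 * e k + 2 * e i) :=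
    Finset.sum_le_sum fun k _ => Finset.sum_le_sum fun i hi =>
      (hN.downscaling k).aNorm_sub_sq_le_pow (hN.downscaling i) hΩ hρ hH hw hU hP hI hC₁ hC₂ hCas
        hM (T.mem_layerFinset.1 hi) hq hqC
  have h2 : ∑ k, ∑ i ∈ T.layerFinset k 1, q ^ (M - 1) * (2 * e k + 2 * e i)
      = q ^ (M - 1) * (2 * ∑ k, ∑ i ∈ T.layerFinset k 1, e i
        + 2 * ∑ k, ∑ i ∈ T.layerFinset k 1, e i) := by
    have : ∑ k, ∑ i ∈ T.layerFinset k 1, e k = ∑ k, ∑ i ∈ T.layerFinset k 1, e i :=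
      T.sum_sum_layer_comm fun i _ => e i
    simp only [← Finset.mul_sum, Finset.sum_add_distrib]
    rw [← this]
  have h3 : ∑ i, e i ≤ (Cas * (C₁ / C₂)) ^ 2
      * (((M + 1) / ρ) ^ d * sNorm (T.weight A) Ω U ^ 2) := by
    rw [sNorm_sq_eq_sum_cell hΩ hw (B.memLp_of_mem_aux hΩ hU)]
    refine le_trans (Finset.sum_le_sum fun i _ =>
      (hN.downscaling i).sum_aNorm_sq_le hΩ hw hU hI hC₁ hC₂ hCas) ?_
    rw [← Finset.mul_sum]
    exact mul_le_mul_of_nonneg_left (T.sum_sum_layer_le hρ hH M fun _ => sq_nonneg _)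
      (sq_nonneg _)
  have h4 := (hnbr he0).trans (mul_le_mul_of_nonneg_left h3 (by positivity))
  refine h1.trans (h2.trans_le ?_)
  gcongr
  linarith

variable (hN : IsNLMCSolution A B M f U F₁ F₂) (hχ : IsGluing T Cχ χ) (hΩ : IsOpen Ω)
  (hρ : 0 < ρ) (hH : 0 < H) (hw : ∀ᵐ x ∂volume.restrict Ω, 0 < T.weight A x)
  (hP : CoarseApproximation A B Cas) (hM : 1 ≤ M)
include hN hΩ hρ hH hw hP hM

omit hw in
theorem sNorm_val_sub_sq_le {k i : ι} (hi : i ∈ T.layerFinset k 1) :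
    sNorm (T.weight A) (T.cell k) (fun x => (F₁ k).val x - (F₁ i).val x) ^ 2
      ≤ (Cas * H) ^ 2 * aNorm A (T.cell k) (fun x => (F₁ k).grad x - (F₁ i).grad x) ^ 2 := by
  have hk := T.self_mem_layer hρ hH k M
  have hk' : k ∈ T.layer i M := T.layer_mono hρ hH i hM
    (T.mem_layer_one_comm.1 (T.mem_layerFinset.1 hi))
  rw [← mul_pow]
  exact pow_le_pow_left₀ (sNorm_nonneg _ _ _)
    ((hN.downscaling k).sNorm_sub_le (hN.downscaling i) hΩ hN.mem_aux hk hk' hP) 2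

include hχ

/-- On each cell, the glued function is close to the local solution in the energy norm. -/
theorem aNorm_glued_sub_sq_le (hCχ : 0 ≤ Cχ) {z : H10 Ω}
    (hz : ∀ x ∈ Ω, z.grad x = ∑ i, (χ i x • (F₁ i).grad x + (F₁ i).val x • gradient (χ i) x))
    (k : ι) : aNorm A (T.cell k) (fun x => z.grad x - (F₁ k).grad x) ^ 2
      ≤ (2 + 2 * Cχ * (Cas * H) ^ 2) * ∑ i ∈ T.layerFinset k 1,
        aNorm A (T.cell k) (fun x => (F₁ k).grad x - (F₁ i).grad x) ^ 2 := by
  have hkt := memLp_weight hΩ T A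
  have hkt0 := weight_nonneg hw
  have hb := bar_nonneg_of_weight_pos hw
  have hsub := T.cell_subset k
  have hDm : ∀ i, MemLp (fun x => (F₁ k).grad x - (F₁ i).grad x) 2 (volume.restrict Ω) := fun i =>
    ((F₁ k).memLp_grad_restrict Ω).sub ((F₁ i).memLp_grad_restrict Ω)
  have hvm : ∀ i, MemLp (fun x => (F₁ k).val x - (F₁ i).val x) 2 (volume.restrict Ω) := fun i =>
    ((F₁ k).memLp_val_restrict Ω).sub ((F₁ i).memLp_val_restrict Ω)
  have i1 := fun i => (integrableOn_bar_mul_sq A (hDm i)).mono_set hsub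
  have i2 := fun i => (integrableOn_sForm hkt (hvm i) (hvm i)).mono_set hsub
  have i3 : ∀ i, IntegrableOn (fun x => 2 * (A.bar x * ‖(F₁ k).grad x - (F₁ i).grad x‖ ^ 2)
      + 2 * Cχ * (T.weight A x * ((F₁ k).val x - (F₁ i).val x)
        * ((F₁ k).val x - (F₁ i).val x))) (T.cell k) := fun i =>
    ((i1 i).const_mul 2).add ((i2 i).const_mul (2 * Cχ))
  set N := T.layerFinset k 1
  have hint : ∫ x in T.cell k, ∑ i ∈ N, (2 * (A.bar x * ‖(F₁ k).grad x - (F₁ i).grad x‖ ^ 2)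
      + 2 * Cχ * (T.weight A x * ((F₁ k).val x - (F₁ i).val x) * ((F₁ k).val x - (F₁ i).val x)))
      = ∑ i ∈ N, (2 * aNorm A (T.cell k) (fun x => (F₁ k).grad x - (F₁ i).grad x) ^ 2
        + 2 * Cχ * sNorm (T.weight A) (T.cell k)
          (fun x => (F₁ k).val x - (F₁ i).val x) ^ 2) := by
    rw [integral_finsetSum _ fun i _ => i3 i]
    refine Finset.sum_congr rfl fun i _ => ?_
    refine (integral_add ((i1 i).const_mul 2) ((i2 i).const_mul (2 * Cχ))).trans ?_
    rw [integral_const_mul, integral_const_mul, aNorm_sq A hb hsub, sNorm_sq hkt0 hsub]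
    rfl
  refine (aNorm_sq_le_of_ae A hb hsub ((z.memLp_grad_restrict Ω).sub
    ((F₁ k).memLp_grad_restrict Ω)) (integrable_finsetSum _ fun i _ => i3 i) ?_).trans
    (hint.trans_le ?_)
  · filter_upwards [ae_restrict_of_ae_restrict_of_subset hsub hb,
      ae_restrict_of_ae_restrict_of_subset hsub hχ.grad_le, hχ.sum_layer_gradient_eq_zero hΩ k,
      ae_restrict_mem (T.measurableSet_cell k)] with x hbx hg hg0 hxk
    have hxΩ := hsub hxk
    have e1 : z.grad x = ∑ i ∈ N, (χ i x • (F₁ i).grad x + (F₁ i).val x • gradient (χ i) x) := by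
      rw [hz x hxΩ]
      refine (Finset.sum_subset (Finset.subset_univ _) fun i _ hi => ?_).symm
      have hi' : k ∉ T.layer i 1 := by rwa [T.mem_layerFinset, T.mem_layer_one_comm] at hi
      rw [hχ.eq_zero_of_mem_cell hi' hxk, hχ.gradient_eq_zero_of_mem_cell hi' hxk, zero_smul,
        smul_zero, add_zero]
    have e2 : (F₁ k).grad x = ∑ i ∈ N, (χ i x • (F₁ k).grad x
        + (F₁ k).val x • gradient (χ i) x) := by
      rw [Finset.sum_add_distrib, ← Finset.sum_smul, ← Finset.smul_sum, hg0,
        hχ.sum_layer_eq_one hxk, one_smul, smul_zero, add_zero]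
    -- as `∑ χ_i = 1` and `∑ ∇χ_i = 0`, only differences of local solutions remain
    have e3 : z.grad x - (F₁ k).grad x = -(∑ i ∈ N, χ i x • ((F₁ k).grad x - (F₁ i).grad x)
        + ∑ i ∈ N, ((F₁ k).val x - (F₁ i).val x) • gradient (χ i) x) := by
      rw [e1]
      nth_rewrite 1 [e2]
      rw [← Finset.sum_sub_distrib, ← Finset.sum_add_distrib, ← Finset.sum_neg_distrib]
      refine Finset.sum_congr rfl fun i _ => ?_
      module
    have e4 : ‖∑ i ∈ N, χ i x • ((F₁ k).grad x - (F₁ i).grad x)‖ ^ 2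
        ≤ ∑ i ∈ N, ‖(F₁ k).grad x - (F₁ i).grad x‖ ^ 2 :=
      (norm_sum_smul_sq_le _ _ _).trans (mul_le_of_le_one_left
        (Finset.sum_nonneg fun _ _ => sq_nonneg _) (hχ.sum_sq_le_one hxΩ N))
    set Sx := ∑ j, ‖gradient (T.hat j) x‖ ^ 2 with hSx
    set Y := ∑ i ∈ N, ((F₁ k).val x - (F₁ i).val x) ^ 2 with hY
    have hY0 : 0 ≤ Y := Finset.sum_nonneg fun _ _ => sq_nonneg _
    have e5 : ‖∑ i ∈ N, ((F₁ k).val x - (F₁ i).val x) • gradient (χ i) x‖ ^ 2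
        ≤ Y * (Cχ * Sx) := by
      refine (norm_sum_smul_sq_le _ _ _).trans (mul_le_mul_of_nonneg_left ?_ hY0)
      exact (Finset.sum_le_sum_of_subset_of_nonneg (Finset.subset_univ _)
        fun _ _ _ => sq_nonneg _).trans hg
    have e6 : ‖z.grad x - (F₁ k).grad x‖ ^ 2
        ≤ 2 * ∑ i ∈ N, ‖(F₁ k).grad x - (F₁ i).grad x‖ ^ 2 + 2 * (Y * (Cχ * Sx)) := by
      rw [e3, norm_neg]
      set a := ∑ i ∈ N, χ i x • ((F₁ k).grad x - (F₁ i).grad x)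
      set b := ∑ i ∈ N, ((F₁ k).val x - (F₁ i).val x) • gradient (χ i) x
      have := norm_add_le a b
      nlinarith [norm_nonneg (a + b), sq_nonneg (‖a‖ - ‖b‖)]
    refine (mul_le_mul_of_nonneg_left e6 hbx).trans_eq ?_
    rw [Finset.sum_add_distrib, ← Finset.mul_sum, ← Finset.mul_sum, ← Finset.mul_sum]
    have e7 : ∑ i ∈ N, T.weight A x * ((F₁ k).val x - (F₁ i).val x)
        * ((F₁ k).val x - (F₁ i).val x) = A.bar x * Sx * Y := by
      rw [hY, Finset.mul_sum]
      refine Finset.sum_congr rfl fun i _ => ?_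
      rw [mul_assoc, ← sq]; rfl
    rw [e7]; ring
  · rw [Finset.mul_sum]
    refine Finset.sum_le_sum fun i hi => ?_
    have := mul_le_mul_of_nonneg_left (sNorm_val_sub_sq_le hN hΩ hρ hH hP hM hi)
      (by positivity : 0 ≤ 2 * Cχ)
    linarith

/-- On each cell, the glued function is close to the local solution in the `s`-norm. -/
theorem sNorm_glued_sub_sq_le {z : H10 Ω}
    (hz : ∀ x ∈ Ω, z.val x = ∑ i, χ i x * (F₁ i).val x) (k : ι) :
    sNorm (T.weight A) (T.cell k) (fun x => z.val x - (F₁ k).val x) ^ 2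
      ≤ (Cas * H) ^ 2 * ∑ i ∈ T.layerFinset k 1,
        aNorm A (T.cell k) (fun x => (F₁ k).grad x - (F₁ i).grad x) ^ 2 := by
  have hkt := memLp_weight hΩ T A
  have hkt0 := weight_nonneg hw
  have hsub := T.cell_subset k
  have hvm : ∀ i, MemLp (fun x => (F₁ k).val x - (F₁ i).val x) 2 (volume.restrict Ω) := fun i =>
    ((F₁ k).memLp_val_restrict Ω).sub ((F₁ i).memLp_val_restrict Ω)
  have hzm : MemLp (fun x => z.val x - (F₁ k).val x) 2 (volume.restrict Ω) :=
    (z.memLp_val_restrict Ω).sub ((F₁ k).memLp_val_restrict Ω)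
  have i2 := fun i => (integrableOn_sForm hkt (hvm i) (hvm i)).mono_set hsub
  set N := T.layerFinset k 1
  have h1 : sNorm (T.weight A) (T.cell k) (fun x => z.val x - (F₁ k).val x) ^ 2
      ≤ ∑ i ∈ N, sNorm (T.weight A) (T.cell k) (fun x => (F₁ k).val x - (F₁ i).val x) ^ 2 := by
    simp only [sNorm_sq hkt0 hsub]
    unfold sForm
    rw [← integral_finsetSum _ fun i _ => i2 i]
    refine integral_mono_ae ((integrableOn_sForm hkt hzm hzm).mono_set hsub)
      (integrable_finsetSum _ fun i _ => i2 i) ?_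
    filter_upwards [ae_restrict_of_ae_restrict_of_subset hsub hkt0,
      ae_restrict_mem (T.measurableSet_cell k)] with x hx hxk
    have hxΩ := hsub hxk
    have e1 : z.val x - (F₁ k).val x = -∑ i ∈ N, χ i x * ((F₁ k).val x - (F₁ i).val x) := by
      have e2 : z.val x = ∑ i ∈ N, χ i x * (F₁ i).val x := by
        rw [hz x hxΩ]
        refine (Finset.sum_subset (Finset.subset_univ _) fun i _ hi => ?_).symm
        have hi' : k ∉ T.layer i 1 := by rwa [T.mem_layerFinset, T.mem_layer_one_comm] at hi
        rw [hχ.eq_zero_of_mem_cell hi' hxk, zero_mul]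
      simp only [mul_sub]
      rw [Finset.sum_sub_distrib, ← Finset.sum_mul, hχ.sum_layer_eq_one hxk, e2]
      ring
    have e3 : (z.val x - (F₁ k).val x) ^ 2 ≤ ∑ i ∈ N, ((F₁ k).val x - (F₁ i).val x) ^ 2 := by
      rw [e1, neg_sq]
      exact (Finset.sum_mul_sq_le_sq_mul_sq _ _ _).trans (mul_le_of_le_one_left
        (Finset.sum_nonneg fun _ _ => sq_nonneg _) (hχ.sum_sq_le_one hxΩ N))
    calc T.weight A x * (z.val x - (F₁ k).val x) * (z.val x - (F₁ k).val x)
        = T.weight A x * (z.val x - (F₁ k).val x) ^ 2 := by ring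
      _ ≤ T.weight A x * ∑ i ∈ N, ((F₁ k).val x - (F₁ i).val x) ^ 2 :=
        mul_le_mul_of_nonneg_left e3 hx
      _ = _ := by
        rw [Finset.mul_sum]
        exact Finset.sum_congr rfl fun i _ => by ring
  refine h1.trans ?_
  rw [Finset.mul_sum]
  exact Finset.sum_le_sum fun i hi => sNorm_val_sub_sq_le hN hΩ hρ hH hP hM hi

end Solution

end

/-! ### Consistency of the local equations -/

section

variable {d : ℕ}

variable {Ω : Set (E d)} {ι J : Type} [Fintype ι] [Fintype J] {H ρ : ℝ} {ν : ℕ}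
  {C₁ C₂ : ℝ}
variable {T : CoarseMesh Ω ι J H ρ ν} {A : Flux Ω C₁ C₂} {B : Continua T}

theorem energyForm_sum_right {κ : Type*} (s : Finset κ) (A : Flux Ω C₁ C₂) {ω : Set (E d)}
    (hω : ω ⊆ Ω) {D : E d → E d} (hD : MemLp D 2 (volume.restrict Ω)) {Ψ : κ → E d → E d}
    (hΨ : ∀ i, MemLp (Ψ i) 2 (volume.restrict Ω)) :
    energyForm A ω D (fun x => ∑ i ∈ s, Ψ i x) = ∑ i ∈ s, energyForm A ω D (Ψ i) := by
  unfold energyForm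
  rw [← integral_finsetSum _ fun i _ => (A.integrableOn_inner hD (hΨ i)).mono_set hω]
  simp only [inner_sum]

theorem sForm_sum_right {κ : Type*} (s : Finset κ) {kt : E d → ℝ} {ω : Set (E d)}
    (hkt : MemLp kt ⊤ (volume.restrict Ω)) (hω : ω ⊆ Ω) {v : E d → ℝ}
    (hv : MemLp v 2 (volume.restrict Ω)) {y : κ → E d → ℝ}
    (hy : ∀ i, MemLp (y i) 2 (volume.restrict Ω)) :
    sForm kt ω v (fun x => ∑ i ∈ s, y i x) = ∑ i ∈ s, sForm kt ω v (y i) := by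
  unfold sForm
  rw [← integral_finsetSum _ fun i _ => (integrableOn_sForm hkt hv (hy i)).mono_set hω]
  simp only [Finset.mul_sum]

theorem energyForm_congr_ae (A : Flux Ω C₁ C₂) {ω : Set (E d)} {D D₁ D₂ : E d → E d}
    (h : ∀ᵐ x ∂volume.restrict ω, D₁ x = D₂ x) : energyForm A ω D D₁ = energyForm A ω D D₂ :=
  integral_congr_ae <| by filter_upwards [h] with x hx; rw [hx]

section Solution

variable {M : ℕ} {f U : E d → ℝ} {F₁ : (i : ι) → H10 (T.region i M)} {F₂ : ι → E d → ℝ}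
  {χ : ι → E d → ℝ} {Cχ Cas : ℝ}
variable (hN : IsNLMCSolution A B M f U F₁ F₂) (hχ : IsGluing T Cχ χ) (hΩ : IsOpen Ω)
  (hρ : 0 < ρ) (hH : 0 < H) (hw : ∀ᵐ x ∂volume.restrict Ω, 0 < T.weight A x)
  (hM : 1 ≤ M)
include hN hχ hΩ hρ hH hw hM

/-- The local equation in `K_M^+`, tested with the localization `χ_K v` of a function on `Ω`. -/
theorem sum_layer_one_eq_zero (i : ι) {v : E d → ℝ} {D : E d → E d} (h : IsH10 Ω v D) :
    ∑ k ∈ T.layerFinset i 1,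
      (energyForm A (T.cell k) (F₁ i).grad (fun x => χ i x • D x + v x • gradient (χ i) x)
        - sForm (T.weight A) (T.cell k) (F₂ i) (fun x => χ i x * v x)) = 0 := by
  obtain ⟨z, hz1, hz2⟩ := hχ.exists_mul hΩ hρ hH hw hM i h
  have h1 := sub_eq_zero.1 ((hN.downscaling i).equation z)
  rw [energyForm_region_eq_sum_cell hΩ T _ _ ((F₁ i).memLp_grad_restrict Ω)
    (z.memLp_grad_restrict Ω), sForm_region_eq_sum_cell hΩ _ _
    (B.memLp_of_mem_aux hΩ (hN.downscaling i).mem_aux) (z.memLp_val_restrict Ω)] at h1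
  have h2 : ∑ k ∈ T.layerFinset i M,
      (energyForm A (T.cell k) (F₁ i).grad (fun x => χ i x • D x + v x • gradient (χ i) x)
        - sForm (T.weight A) (T.cell k) (F₂ i) (fun x => χ i x * v x)) = 0 := by
    rw [Finset.sum_sub_distrib, sub_eq_zero]
    refine Eq.trans (Finset.sum_congr rfl fun k hk => ?_)
      (h1.trans (Finset.sum_congr rfl fun k hk => ?_))
    · have hk' := T.cell_subset_region (T.mem_layerFinset.1 hk)
      exact (energyForm_congr A (T.measurableSet_cell k) fun x hx => hz2 x (hk' hx)).symm
    · exact sForm_congr (T.measurableSet_cell k) (fun _ _ => rfl)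
        fun x hx => hz1 x (T.cell_subset k hx)
  rw [← h2]
  refine Finset.sum_subset (fun k hk => ?_) fun k _ hk => ?_
  · exact T.mem_layerFinset.2 (T.layer_mono hρ hH i hM (T.mem_layerFinset.1 hk))
  · rw [T.mem_layerFinset] at hk
    have hm := T.measurableSet_cell k
    have e1 : energyForm A (T.cell k) (F₁ i).grad
        (fun x => χ i x • D x + v x • gradient (χ i) x) = 0 := by
      rw [energyForm_congr (D₂ := fun _ => 0) A hm fun x hx => by
        rw [hχ.eq_zero_of_mem_cell hk hx, hχ.gradient_eq_zero_of_mem_cell hk hx, zero_smul,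
          smul_zero, add_zero]]
      simp [energyForm]
    have e2 : sForm (T.weight A) (T.cell k) (F₂ i) (fun x => χ i x * v x) = 0 := by
      rw [sForm_congr (v' := fun _ => 0) hm (fun _ _ => rfl) fun x hx => by
        rw [hχ.eq_zero_of_mem_cell hk hx, zero_mul]]
      simp [sForm]
    rw [e1, e2, sub_zero]

/-- The consistency error: the local fluxes and multipliers, each restricted to its own cell,
satisfy the global equation up to the discrepancy of neighbouring local solutions. -/
theorem sq_sum_energyForm_sub_le (hI : InfSup A B Cas) (hC₁ : 0 ≤ C₁) (hCas : 0 ≤ Cas)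
    (hCχ : 0 ≤ Cχ) {v : E d → ℝ} {D : E d → E d} (h : IsH10 Ω v D) :
    (∑ k, (energyForm A (T.cell k) (F₁ k).grad D
        - sForm (T.weight A) (T.cell k) (F₂ k) v)) ^ 2
      ≤ C₁ ^ 2 * jumpSq A F₁ * (((1 + 1) / ρ) ^ d
        * (4 * aNorm A Ω D ^ 2 + (4 * Cχ + 2 * Cas ^ 2) * sNorm (T.weight A) Ω v ^ 2)) := by
  have hkt := memLp_weight hΩ T A
  have hkt0 := weight_nonneg hw
  have hb := bar_nonneg_of_weight_pos hw
  have hvm : MemLp v 2 (volume.restrict Ω) := h.memLp_val.restrict _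
  have hDm : MemLp D 2 (volume.restrict Ω) := h.memLp_grad.restrict _
  have hG := fun i => (F₁ i).memLp_grad_restrict Ω
  have hF₂ := fun i => B.memLp_of_mem_aux hΩ (hN.downscaling i).mem_aux
  set Ψ : ι → E d → E d := fun i x => χ i x • D x + v x • gradient (χ i) x with hΨdef
  set y : ι → E d → ℝ := fun i x => χ i x * v x with hydef
  have hΨ1 : ∀ i, MemLp (fun x => χ i x • D x) 2 (volume.restrict Ω) := fun i => by
    obtain ⟨L, hL⟩ := hχ.lipschitz i
    exact memLp_lipschitz_smul hΩ hL (fun x hx => hχ.abs_le_one i hx) hDm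
  have hΨ2 : ∀ i, MemLp (fun x => v x • gradient (χ i) x) 2 (volume.restrict Ω) := fun i => by
    obtain ⟨L, hL⟩ := hχ.lipschitz i
    exact memLp_smul_gradient hΩ hL hvm
  have hΨm : ∀ i, MemLp (Ψ i) 2 (volume.restrict Ω) := fun i => (hΨ1 i).add (hΨ2 i)
  have hym : ∀ i, MemLp (y i) 2 (volume.restrict Ω) := fun i => by
    obtain ⟨L, hL⟩ := hχ.lipschitz i
    exact memLp_lipschitz_mul hΩ hL (fun x hx => hχ.abs_le_one i hx) hvm
  set a : ι → ι → ℝ := fun k i => aNorm A (T.cell k) fun x => (F₁ k).grad x - (F₁ i).grad x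
  have ha0 : ∀ k i, 0 ≤ a k i := fun k i => aNorm_nonneg _ _ _
  set t : ι → ℝ := fun k => √(2 * aNorm A (T.cell k) D ^ 2
    + 2 * (Cχ * sNorm (T.weight A) (T.cell k) v ^ 2)) + Cas * sNorm (T.weight A) (T.cell k) v
  have ht : ∀ k, t k ^ 2 ≤ 4 * aNorm A (T.cell k) D ^ 2
      + (4 * Cχ + 2 * Cas ^ 2) * sNorm (T.weight A) (T.cell k) v ^ 2 := by
    intro k
    have hr := Real.sq_sqrt (show 0 ≤ 2 * aNorm A (T.cell k) D ^ 2
      + 2 * (Cχ * sNorm (T.weight A) (T.cell k) v ^ 2) by positivity)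
    simp only [t]
    set r := √(2 * aNorm A (T.cell k) D ^ 2 + 2 * (Cχ * sNorm (T.weight A) (T.cell k) v ^ 2))
    nlinarith [sq_nonneg (r - Cas * sNorm (T.weight A) (T.cell k) v)]
  -- the localizations `χ_i v` and their gradients add up to `v` and `D`
  have hΨsum : ∀ k, ∀ᵐ x ∂volume.restrict (T.cell k), D x = ∑ i ∈ T.layerFinset k 1, Ψ i x := by
    intro k
    filter_upwards [hχ.sum_layer_gradient_eq_zero hΩ k, ae_restrict_mem (T.measurableSet_cell k)]
      with x hx hxk
    rw [Finset.sum_add_distrib, ← Finset.sum_smul, ← Finset.smul_sum, hx,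
      hχ.sum_layer_eq_one hxk, one_smul, smul_zero, add_zero]
  have hysum : ∀ k, ∀ x ∈ T.cell k, v x = ∑ i ∈ T.layerFinset k 1, y i x := by
    intro k x hxk
    rw [← Finset.sum_mul, hχ.sum_layer_eq_one hxk, one_mul]
  -- The localized equations sum to zero; subtracting them leaves differences of local solutions.
  have hzero : ∑ k, ∑ i ∈ T.layerFinset k 1, (energyForm A (T.cell k) (F₁ i).grad (Ψ i)
      - sForm (T.weight A) (T.cell k) (F₂ i) (y i)) = 0 := by
    rw [← T.sum_sum_layer_comm fun i k => energyForm A (T.cell k) (F₁ i).grad (Ψ i)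
      - sForm (T.weight A) (T.cell k) (F₂ i) (y i)]
    exact Finset.sum_eq_zero fun i _ => sum_layer_one_eq_zero hN hχ hΩ hρ hH hw hM i h
  have hsum : ∑ k, (energyForm A (T.cell k) (F₁ k).grad D
      - sForm (T.weight A) (T.cell k) (F₂ k) v)
      = ∑ k, ∑ i ∈ T.layerFinset k 1, ((energyForm A (T.cell k) (F₁ k).grad (Ψ i)
        - energyForm A (T.cell k) (F₁ i).grad (Ψ i))
        - sForm (T.weight A) (T.cell k) (fun x => F₂ k x - F₂ i x) (y i)) := by
    rw [← sub_zero (∑ k, (energyForm A (T.cell k) (F₁ k).grad D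
      - sForm (T.weight A) (T.cell k) (F₂ k) v)), ← hzero, ← Finset.sum_sub_distrib]
    refine Finset.sum_congr rfl fun k _ => ?_
    have hsub := T.cell_subset k
    rw [energyForm_congr_ae A (hΨsum k), energyForm_sum_right _ A hsub (hG k) hΨm,
      sForm_congr (T.measurableSet_cell k) (fun _ _ => rfl) (hysum k),
      sForm_sum_right _ hkt hsub (hF₂ k) hym, ← Finset.sum_sub_distrib, ← Finset.sum_sub_distrib]
    refine Finset.sum_congr rfl fun i _ => ?_
    rw [sForm_sub_left hkt hsub (hF₂ k) (hF₂ i) (hym i)]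
    ring
  have hterm : ∀ k, ∀ i ∈ T.layerFinset k 1, |(energyForm A (T.cell k) (F₁ k).grad (Ψ i)
        - energyForm A (T.cell k) (F₁ i).grad (Ψ i))
        - sForm (T.weight A) (T.cell k) (fun x => F₂ k x - F₂ i x) (y i)|
      ≤ C₁ * (a k i * t k) := by
    intro k i hi
    have hsub := T.cell_subset k
    have hm := T.measurableSet_cell k
    have hk := T.self_mem_layer hρ hH k M
    have hk' : k ∈ T.layer i M := T.layer_mono hρ hH i hM
      (T.mem_layer_one_comm.1 (T.mem_layerFinset.1 hi))
    have e1 := abs_energyForm_sub_le A hb hsub hC₁ (hG k) (hG i) (hΨm i)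
    have e2 : aNorm A (T.cell k) (Ψ i) ≤ √(2 * aNorm A (T.cell k) D ^ 2
        + 2 * (Cχ * sNorm (T.weight A) (T.cell k) v ^ 2)) := by
      refine Real.le_sqrt_of_sq_le ((aNorm_add_sq_le A hb hsub (hΨ1 i) (hΨ2 i)).trans ?_)
      obtain ⟨L, hL⟩ := hχ.lipschitz i
      have e3 := aNorm_smul_sq_le A hb hsub hDm (fun x hx => hχ.abs_le_one i (hsub hx)) hm (hΨ1 i)
      have e4 := aNorm_smul_gradient_sq_le hΩ hw hsub hL (hχ.norm_gradient_sq_le i) hvm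
      linarith
    have e5 := abs_sForm_le hkt hkt0 hsub ((hF₂ k).sub (hF₂ i)) (hym i)
    have e6 : sNorm (T.weight A) (T.cell k) (fun x => F₂ k x - F₂ i x) ≤ C₁ * Cas * a k i :=
      (hN.downscaling k).sNorm_multiplier_sub_le (hN.downscaling i) hΩ hk hk' hw hI hC₁ hCas
    have e7 : sNorm (T.weight A) (T.cell k) (y i) ≤ sNorm (T.weight A) (T.cell k) v :=
      (abs_le_of_sq_le_sq' (sNorm_mul_sq_le hkt hkt0 hsub hm
        (fun x hx => hχ.abs_le_one i (hsub hx)) hvm (hym i)) (sNorm_nonneg _ _ _)).2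
    have e8 := mul_le_mul e6 e7 (sNorm_nonneg _ _ _) (mul_nonneg (mul_nonneg hC₁ hCas) (ha0 k i))
    have e9 := mul_le_mul_of_nonneg_left e2 (mul_nonneg hC₁ (ha0 k i))
    have e10 := abs_sub (energyForm A (T.cell k) (F₁ k).grad (Ψ i)
        - energyForm A (T.cell k) (F₁ i).grad (Ψ i))
        (sForm (T.weight A) (T.cell k) (fun x => F₂ k x - F₂ i x) (y i))
    have e5' : |sForm (T.weight A) (T.cell k) (fun x => F₂ k x - F₂ i x) (y i)|
      ≤ C₁ * Cas * a k i * sNorm (T.weight A) (T.cell k) v := e5.trans e8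
    simp only [t]
    linarith
  have habs : |∑ k, (energyForm A (T.cell k) (F₁ k).grad D
      - sForm (T.weight A) (T.cell k) (F₂ k) v)|
      ≤ C₁ * ∑ k, ∑ i ∈ T.layerFinset k 1, a k i * t k := by
    rw [hsum]
    simp only [Finset.mul_sum]
    exact (Finset.abs_sum_le_sum_abs _ _).trans (Finset.sum_le_sum fun k _ =>
      (Finset.abs_sum_le_sum_abs _ _).trans (Finset.sum_le_sum fun i hi => hterm k i hi))
  have hcs : (∑ k, ∑ i ∈ T.layerFinset k 1, a k i * t k) ^ 2
      ≤ jumpSq A F₁ * ∑ k, ∑ i ∈ T.layerFinset k 1, t k ^ 2 := by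
    rw [jumpSq, Finset.sum_sigma', Finset.sum_sigma', Finset.sum_sigma']
    exact Finset.sum_mul_sq_le_sq_mul_sq _ _ _
  have hcount : ∑ k, ∑ i ∈ T.layerFinset k 1, t k ^ 2 ≤ ((1 + 1) / ρ) ^ d
      * (4 * aNorm A Ω D ^ 2 + (4 * Cχ + 2 * Cas ^ 2) * sNorm (T.weight A) Ω v ^ 2) := by
    have e1 : ∑ k, ∑ i ∈ T.layerFinset k 1, t k ^ 2 = ∑ k, ∑ i ∈ T.layerFinset k 1, t i ^ 2 :=
      T.sum_sum_layer_comm fun k _ => t k ^ 2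
    rw [e1]
    have e2 := T.sum_sum_layer_le hρ hH 1 (g := fun k => t k ^ 2) fun k => sq_nonneg _
    rw [Nat.cast_one] at e2
    refine e2.trans (mul_le_mul_of_nonneg_left ?_ (by positivity))
    rw [aNorm_sq_eq_sum_cell hΩ hw hDm, sNorm_sq_eq_sum_cell hΩ hw hvm, Finset.mul_sum,
      Finset.mul_sum, ← Finset.sum_add_distrib]
    exact Finset.sum_le_sum fun k _ => ht k
  calc (∑ k, (energyForm A (T.cell k) (F₁ k).grad D
        - sForm (T.weight A) (T.cell k) (F₂ k) v)) ^ 2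
      ≤ (C₁ * ∑ k, ∑ i ∈ T.layerFinset k 1, a k i * t k) ^ 2 := by
        rw [← sq_abs]; gcongr
    _ = C₁ ^ 2 * (∑ k, ∑ i ∈ T.layerFinset k 1, a k i * t k) ^ 2 := mul_pow _ _ _
    _ ≤ C₁ ^ 2 * (jumpSq A F₁ * ∑ k, ∑ i ∈ T.layerFinset k 1, t k ^ 2) := by gcongr
    _ ≤ C₁ ^ 2 * (jumpSq A F₁ * (((1 + 1) / ρ) ^ d
      * (4 * aNorm A Ω D ^ 2 + (4 * Cχ + 2 * Cas ^ 2) * sNorm (T.weight A) Ω v ^ 2))) := by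
        have := jumpSq_nonneg A F₁
        gcongr
    _ = _ := by ring

end Solution

end

/-! ### The error of the glued solution -/

section

variable {d : ℕ}

variable {Ω : Set (E d)} {ι J : Type} [Fintype ι] [Fintype J] {H ρ : ℝ} {ν : ℕ}
  {C₁ C₂ : ℝ}
variable {T : CoarseMesh Ω ι J H ρ ν} {A : Flux Ω C₁ C₂} {B : Continua T}

theorem Continua.exists_isProj_cell (B : Continua T) (A : Flux Ω C₁ C₂) (hΩ : IsOpen Ω)
    (hw : ∀ᵐ x ∂volume.restrict Ω, 0 < T.weight A x) (k : ι) {v : E d → ℝ}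
    (hv : MemLp v 2 (volume.restrict Ω)) :
    ∃ p, IsProj (T.weight A) (T.cell k) (B.aux {k}) v p := by
  have hmono := Measure.restrict_mono_set (volume : Measure (E d)) (T.cell_subset k)
  have : FiniteDimensional ℝ (B.aux {k}) :=
    FiniteDimensional.span_of_finite ℝ (B.finite_generators {k})
  exact exists_isProj ((memLp_weight hΩ T A).mono_measure hmono)
    (ae_restrict_of_ae_restrict_of_subset (T.cell_subset k) (weight_nonneg hw)) _
    (fun q hq => (B.memLp_of_mem_aux hΩ hq).mono_measure hmono) (hv.mono_measure hmono)

/-- The Cauchy-Schwarz inequality for the residual `f - κ̃ p`, where `f / κ̃` is only known to have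
finite `s`-norm. -/
theorem integral_mul_sub_sForm_le {kt f p w : E d → ℝ} (hkt : MemLp kt ⊤ (volume.restrict Ω))
    (hkt0 : ∀ᵐ x ∂volume.restrict Ω, 0 < kt x) (hf : AEStronglyMeasurable f (volume.restrict Ω))
    (hfi : IntegrableOn (fun x => kt x * (f x / kt x) ^ 2) Ω)
    (hp : MemLp p 2 (volume.restrict Ω)) (hw : MemLp w 2 (volume.restrict Ω)) :
    (∫ x in Ω, f x * w x) - sForm kt Ω p w
      ≤ sNorm kt Ω (fun x => f x / kt x - p x) * sNorm kt Ω w := by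
  have hkt1 : ∀ᵐ x ∂volume.restrict Ω, 0 ≤ kt x := hkt0.mono fun _ h => h.le
  have hφ : MemLp (fun x => √(kt x) * (f x / kt x)) 2 (volume.restrict Ω) := by
    have hm : AEStronglyMeasurable (fun x => √(kt x) * (f x / kt x)) (volume.restrict Ω) :=
      (Real.continuous_sqrt.comp_aestronglyMeasurable hkt.1).mul
        (hf.aemeasurable.div hkt.1.aemeasurable).aestronglyMeasurable
    refine (memLp_two_iff_integrable_sq hm).2 (hfi.congr ?_)
    filter_upwards [hkt1] with x hx
    rw [mul_pow, Real.sq_sqrt hx]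
  have hp' := memLp_sqrt_mul hkt hkt1 hp
  have hw' := memLp_sqrt_mul hkt hkt1 hw
  have h1 : (∫ x in Ω, f x * w x) - sForm kt Ω p w
      = ∫ x in Ω, 1 * (√(kt x) * (f x / kt x) - √(kt x) * p x) * (√(kt x) * w x) := by
    have e1 : ∫ x in Ω, f x * w x
        = ∫ x in Ω, (√(kt x) * (f x / kt x)) * (√(kt x) * w x) := by
      refine integral_congr_ae ?_
      filter_upwards [hkt0] with x hx
      calc f x * w x = kt x * (f x / kt x) * w x := by rw [mul_div_cancel₀ _ hx.ne']
        _ = (√(kt x) * √(kt x)) * (f x / kt x) * w x := by rw [Real.mul_self_sqrt hx.le]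
        _ = _ := by ring
    have e2 : sForm kt Ω p w = ∫ x in Ω, (√(kt x) * p x) * (√(kt x) * w x) := by
      refine integral_congr_ae ?_
      filter_upwards [hkt0] with x hx
      calc kt x * p x * w x = (√(kt x) * √(kt x)) * p x * w x := by
            rw [Real.mul_self_sqrt hx.le]
        _ = _ := by ring
    rw [e1, e2]
    refine (integral_sub (hφ.integrable_mul hw') (hp'.integrable_mul hw')).symm.trans ?_
    congr 1; ext x; simp only [Pi.mul_apply]; ring
  have hcs := abs_integral_mul_mul_le (memLp_top_const (1 : ℝ)) (Eventually.of_forall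
    fun _ => zero_le_one) (hφ.sub hp') hw'
  rw [h1]
  refine (le_abs_self _).trans (hcs.trans_eq ?_)
  unfold sNorm sForm
  congr 2
  · refine integral_congr_ae ?_
    filter_upwards [hkt1] with x hx
    calc 1 * (√(kt x) * (f x / kt x) - √(kt x) * p x) * (√(kt x) * (f x / kt x) - √(kt x) * p x)
        = (√(kt x) * √(kt x)) * (f x / kt x - p x) * (f x / kt x - p x) := by ring
      _ = _ := by rw [Real.mul_self_sqrt hx]
  · refine integral_congr_ae ?_
    filter_upwards [hkt1] with x hx
    calc 1 * (√(kt x) * w x) * (√(kt x) * w x) = (√(kt x) * √(kt x)) * w x * w x := by ring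
      _ = _ := by rw [Real.mul_self_sqrt hx]

section Solution

variable {M : ℕ} {f U p : E d → ℝ} {F₁ : (i : ι) → H10 (T.region i M)} {F₂ : ι → E d → ℝ}
  {χ : ι → E d → ℝ} {Cχ Cas Ck : ℝ}
variable (hN : IsNLMCSolution A B M f U F₁ F₂) (hχ : IsGluing T Cχ χ) (hΩ : IsOpen Ω)
  (hρ : 0 < ρ) (hH : 0 < H) (hw : ∀ᵐ x ∂volume.restrict Ω, 0 < T.weight A x)
  (hP : CoarseApproximation A B Cas) (hM : 1 ≤ M)
  (hf : AEStronglyMeasurable f (volume.restrict Ω))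
  (hfi : IntegrableOn (fun x => T.weight A x * (f x / T.weight A x) ^ 2) Ω)
  (hp : p ∈ B.aux Set.univ)

include hN hΩ hH hw hP hf hfi hp in
/-- The coarse-scale error: by the coarse system, the multipliers act on the projection of a test
function as the source does, so only the part of the source outside `V_aux`, tested with the
unresolved part of the test function, is left. -/
theorem sum_sForm_sub_integral_le (hCas : 0 ≤ Cas) {v : E d → ℝ} {D : E d → E d}
    (h : IsH10 Ω v D) :
    (∑ k, sForm (T.weight A) (T.cell k) (F₂ k) v) - ∫ x in Ω, f x * v x
      ≤ sNorm (T.weight A) Ω (fun x => f x / T.weight A x - p x)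
        * (Cas * H * aNorm A Ω D) := by
  have hkt := memLp_weight hΩ T A
  have hkt0 := weight_nonneg hw
  have hvm : MemLp v 2 (volume.restrict Ω) := h.memLp_val.restrict _
  have hDm : MemLp D 2 (volume.restrict Ω) := h.memLp_grad.restrict _
  have hpm := B.memLp_of_mem_aux hΩ hp
  choose π hπ1 hπ2 using fun k => B.exists_isProj_cell A hΩ hw k hvm
  have hPmem : (fun x => ∑ k, π k x) ∈ B.aux Set.univ := by
    have : (fun x => ∑ k, π k x) = ∑ k, π k := by ext x; simp
    rw [this]
    exact Submodule.sum_mem _ fun k _ => B.aux_mono (Set.subset_univ _) (hπ1 k)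
  set P : E d → ℝ := fun x => ∑ k, π k x
  have hPm := B.memLp_of_mem_aux hΩ hPmem
  have hPcell : ∀ k, ∀ x ∈ T.cell k, P x = π k x := fun k x hx =>
    Finset.sum_eq_single k (fun l _ hl => B.eq_zero_of_mem_aux_singleton hl.symm (hπ1 l) hx)
      fun hk => absurd (Finset.mem_univ k) hk
  have hπm := fun k => B.memLp_of_mem_aux hΩ (hπ1 k)
  have hproj : ∀ k, ∀ g ∈ B.aux Set.univ,
      sForm (T.weight A) (T.cell k) g P = sForm (T.weight A) (T.cell k) g v := by
    intro k g hg
    obtain ⟨g', hg', hcell⟩ := B.exists_mem_aux_singleton hg k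
    have hm := T.measurableSet_cell k
    rw [sForm_congr hm hcell (hPcell k), sForm_comm, hπ2 k g' hg', sForm_comm,
      sForm_congr hm (fun x hx => (hcell x hx).symm) (fun _ _ => rfl)]
  have h1 : ∑ k, sForm (T.weight A) (T.cell k) (F₂ k) v = ∫ x in Ω, f x * P x := by
    rw [← hN.coarse P hPmem]
    exact Finset.sum_congr rfl fun k _ => (hproj k _
      (B.aux_mono (Set.subset_univ _) (hN.downscaling k).mem_aux)).symm
  have h2 : sForm (T.weight A) Ω p (fun x => P x - v x) = 0 := by
    rw [sForm_sub_right hkt subset_rfl hPm hvm hpm, sForm_eq_sum_cell hΩ hpm hPm,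
      sForm_eq_sum_cell hΩ hpm hvm, ← Finset.sum_sub_distrib]
    exact Finset.sum_eq_zero fun k _ => by rw [hproj k p hp, sub_self]
  -- `f v = √κ̃ (f / κ̃) · √κ̃ v` is integrable for `v ∈ L²`, although `f` need not be in `L²`.
  have hfint : ∀ {q : E d → ℝ}, MemLp q 2 (volume.restrict Ω) →
      IntegrableOn (fun x => f x * q x) Ω := by
    intro q hq
    have hφ : MemLp (fun x => √(T.weight A x) * (f x / T.weight A x)) 2 (volume.restrict Ω) := by
      have hm : AEStronglyMeasurable (fun x => √(T.weight A x) * (f x / T.weight A x))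
          (volume.restrict Ω) :=
        (Real.continuous_sqrt.comp_aestronglyMeasurable hkt.1).mul
          (hf.aemeasurable.div hkt.1.aemeasurable).aestronglyMeasurable
      refine (memLp_two_iff_integrable_sq hm).2 (hfi.congr ?_)
      filter_upwards [hkt0] with x hx
      rw [mul_pow, Real.sq_sqrt hx]
    refine (hφ.integrable_mul (memLp_sqrt_mul hkt hkt0 hq)).congr ?_
    filter_upwards [hw] with x hx
    calc √(T.weight A x) * (f x / T.weight A x) * (√(T.weight A x) * q x)
        = (√(T.weight A x) * √(T.weight A x)) * (f x / T.weight A x) * q x := by ring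
      _ = f x * q x := by rw [Real.mul_self_sqrt hx.le, mul_div_cancel₀ _ hx.ne']
  have h3 : (∑ k, sForm (T.weight A) (T.cell k) (F₂ k) v) - ∫ x in Ω, f x * v x
      = (∫ x in Ω, f x * (P x - v x)) - sForm (T.weight A) Ω p fun x => P x - v x := by
    rw [h1, h2, sub_zero, ← integral_sub (hfint hPm) (hfint hvm)]
    simp only [mul_sub]
  rw [h3]
  refine (integral_mul_sub_sForm_le hkt hw hf hfi hpm (hPm.sub hvm)).trans
    (mul_le_mul_of_nonneg_left ?_ (sNorm_nonneg _ _ _))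
  have hPv : MemLp (fun x => P x - v x) 2 (volume.restrict Ω) := hPm.sub hvm
  refine (abs_le_of_sq_le_sq' ?_ (mul_nonneg (mul_nonneg hCas hH.le) (aNorm_nonneg _ _ _))).2
  rw [mul_pow, aNorm_sq_eq_sum_cell hΩ hw hDm, Finset.mul_sum,
    sNorm_sq_eq_sum_cell (T := T) hΩ hw (u := P - v) hPv]
  refine Finset.sum_le_sum fun k _ => ?_
  rw [← mul_pow]
  refine pow_le_pow_left₀ (sNorm_nonneg _ _ _) ?_ 2
  obtain ⟨z, rfl, rfl⟩ := h
  refine le_of_eq_of_le ?_ (hP k z (π k) ⟨hπ1 k, hπ2 k⟩)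
  have e : ∀ x, (P - z.val) x = -(z.val x - P x) := fun x => by simp
  rw [sNorm_congr (u' := fun x => -(z.val x - π k x)) (T.measurableSet_cell k) fun x hx => by
    rw [e, hPcell k x hx]]
  simp only [sNorm, sForm, mul_neg, neg_mul, neg_neg]

include hN hχ hΩ hρ hH hw hP hM hf hfi hp in
/-- The error of the glued solution in terms of the discrepancy of the local solutions and of the
coarse-scale error. -/
theorem mul_aNorm_error_le (hI : InfSup A B Cas) (hK : WeightedPoincare T A Ck) (hC₁ : 0 ≤ C₁)
    (hCas : 0 ≤ Cas) (hCχ : 0 ≤ Cχ) {u z : H10 Ω} (hu : IsWeakSolution A f u)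
    (hz : ∀ x ∈ Ω, z.grad x = ∑ i, (χ i x • (F₁ i).grad x + (F₁ i).val x • gradient (χ i) x)) :
    C₂ * aNorm A Ω (fun x => z.grad x - u.grad x)
      ≤ C₁ * √(jumpSq A F₁) * (√(2 + 2 * Cχ * (Cas * H) ^ 2)
          + √(((1 + 1) / ρ) ^ d * (4 + (4 * Cχ + 2 * Cas ^ 2) * Ck ^ 2)))
        + Cas * H * sNorm (T.weight A) Ω (fun x => f x / T.weight A x - p x) := by
  have hb := bar_nonneg_of_weight_pos hw
  have hzm := z.memLp_grad_restrict Ω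
  have hum := u.memLp_grad_restrict Ω
  have hG := fun i => (F₁ i).memLp_grad_restrict Ω
  have hJ := jumpSq_nonneg A F₁
  obtain ⟨e, he1, he2⟩ := z.isH10.sub u.isH10
  have heD := e.memLp_grad_restrict Ω
  have hmon := mul_aNorm_sq_le_energyForm_sub A hb subset_rfl hzm hum
  rw [← he2] at hmon ⊢
  rw [hu e] at hmon
  set s := aNorm A Ω e.grad with hs
  have hs0 : 0 ≤ s := aNorm_nonneg _ _ _
  set R := sNorm (T.weight A) Ω (fun x => f x / T.weight A x - p x)
  set K₁ := 2 + 2 * Cχ * (Cas * H) ^ 2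
  set K₂ := ((1 + 1) / ρ) ^ d * (4 + (4 * Cχ + 2 * Cas ^ 2) * Ck ^ 2) with hK₂
  have hK₁0 : 0 ≤ K₁ := by positivity
  -- replacing the flux of the glued solution by the local ones
  have h1 : ∑ k, (energyForm A (T.cell k) z.grad e.grad
      - energyForm A (T.cell k) (F₁ k).grad e.grad) ≤ C₁ * (√K₁ * √(jumpSq A F₁)) * s := by
    have e1 : ∑ k, (energyForm A (T.cell k) z.grad e.grad
        - energyForm A (T.cell k) (F₁ k).grad e.grad)
        ≤ C₁ * ∑ k, aNorm A (T.cell k) (fun x => z.grad x - (F₁ k).grad x)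
          * aNorm A (T.cell k) e.grad := by
      rw [Finset.mul_sum]
      refine Finset.sum_le_sum fun k _ => (le_abs_self _).trans ?_
      rw [← mul_assoc]
      exact abs_energyForm_sub_le A hb (T.cell_subset k) hC₁ hzm (hG k) heD
    have e2 : (∑ k, aNorm A (T.cell k) (fun x => z.grad x - (F₁ k).grad x)
        * aNorm A (T.cell k) e.grad) ^ 2 ≤ (K₁ * jumpSq A F₁) * s ^ 2 := by
      refine (Finset.sum_mul_sq_le_sq_mul_sq _ _ _).trans ?_
      rw [hs, aNorm_sq_eq_sum_cell hΩ hw heD]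
      refine mul_le_mul_of_nonneg_right ?_ (Finset.sum_nonneg fun _ _ => sq_nonneg _)
      rw [jumpSq, Finset.mul_sum]
      exact Finset.sum_le_sum fun k _ => aNorm_glued_sub_sq_le hN hχ hΩ hρ hH hw hP hM hCχ hz k
    have e3 : ∑ k, aNorm A (T.cell k) (fun x => z.grad x - (F₁ k).grad x)
        * aNorm A (T.cell k) e.grad ≤ √K₁ * √(jumpSq A F₁) * s := by
      refine (abs_le_of_sq_le_sq' (e2.trans_eq ?_) (by positivity)).2
      rw [mul_pow, mul_pow, Real.sq_sqrt hK₁0, Real.sq_sqrt hJ]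
    calc _ ≤ _ := e1
      _ ≤ C₁ * (√K₁ * √(jumpSq A F₁) * s) := by gcongr
      _ = _ := by ring
  -- the consistency error
  have h2 : ∑ k, (energyForm A (T.cell k) (F₁ k).grad e.grad
      - sForm (T.weight A) (T.cell k) (F₂ k) e.val) ≤ C₁ * (√K₂ * √(jumpSq A F₁)) * s := by
    refine (abs_le_of_sq_le_sq' ?_ (by positivity)).2
    refine (sq_sum_energyForm_sub_le hN hχ hΩ hρ hH hw hM hI hC₁ hCas hCχ e.isH10).trans ?_
    rw [mul_pow, mul_pow, mul_pow, Real.sq_sqrt (by positivity), Real.sq_sqrt hJ]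
    have e1 : sNorm (T.weight A) Ω e.val ^ 2 ≤ Ck ^ 2 * s ^ 2 := by
      rw [← mul_pow]
      exact pow_le_pow_left₀ (sNorm_nonneg _ _ _) (hK e) 2
    have e2 : ((1 + 1) / ρ) ^ d * (4 * s ^ 2
        + (4 * Cχ + 2 * Cas ^ 2) * sNorm (T.weight A) Ω e.val ^ 2) ≤ K₂ * s ^ 2 := by
      rw [hK₂, mul_assoc]
      gcongr
      have := mul_le_mul_of_nonneg_left e1 (by positivity : 0 ≤ 4 * Cχ + 2 * Cas ^ 2)
      linarith
    calc _ ≤ C₁ ^ 2 * jumpSq A F₁ * (K₂ * s ^ 2) := by gcongr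
      _ = _ := by ring
  have h3 := sum_sForm_sub_integral_le hN hΩ hH hw hP hf hfi hp hCas e.isH10
  have h4 : energyForm A Ω z.grad e.grad - ∫ x in Ω, f x * e.val x
      = ∑ k, (energyForm A (T.cell k) z.grad e.grad
          - energyForm A (T.cell k) (F₁ k).grad e.grad)
        + ∑ k, (energyForm A (T.cell k) (F₁ k).grad e.grad
          - sForm (T.weight A) (T.cell k) (F₂ k) e.val)
        + ((∑ k, sForm (T.weight A) (T.cell k) (F₂ k) e.val) - ∫ x in Ω, f x * e.val x) := by
    rw [energyForm_eq_sum_cell hΩ T hzm heD, Finset.sum_sub_distrib, Finset.sum_sub_distrib]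
    ring
  rw [h4] at hmon
  have h5 : (C₂ * s) * s ≤ (C₁ * √(jumpSq A F₁) * (√K₁ + √K₂) + Cas * H * R) * s := by
    calc (C₂ * s) * s = C₂ * s ^ 2 := by ring
      _ ≤ _ := hmon
      _ ≤ C₁ * (√K₁ * √(jumpSq A F₁)) * s + C₁ * (√K₂ * √(jumpSq A F₁)) * s
          + R * (Cas * H * s) := add_le_add (add_le_add h1 h2) h3
      _ = _ := by ring
  rcases hs0.eq_or_lt with h0 | h0
  · rw [← h0, mul_zero]
    have : 0 ≤ R := sNorm_nonneg _ _ _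
    positivity
  · exact le_of_mul_le_mul_right h5 h0

end Solution

end

/-! ### Bounds on the data of the problem -/

section

variable {d : ℕ}

variable {Ω : Set (E d)} {ι J : Type} [Fintype ι] [Fintype J] {H ρ : ℝ} {ν : ℕ}
  {C₁ C₂ : ℝ}
variable {T : CoarseMesh Ω ι J H ρ ν} {A : Flux Ω C₁ C₂} {B : Continua T}

/-- On a domain of positive measure the monotonicity constant is at most the Lipschitz constant; the
positive weight excludes `d = 0`. -/
theorem Flux.monotonicity_le_lipschitz (A : Flux Ω C₁ C₂)
    (hw : ∀ᵐ x ∂volume.restrict Ω, 0 < T.weight A x) (h0 : volume.restrict Ω ≠ 0) : C₂ ≤ C₁ := by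
  have : (ae (volume.restrict Ω)).NeBot := ae_neBot.2 h0
  obtain ⟨x, hx, hl, hm, hb⟩ :=
    (hw.and (A.lipschitz.and (A.monotone.and (bar_nonneg_of_weight_pos hw)))).exists
  have hb' : 0 < A.bar x := by
    refine hb.lt_of_ne fun h => ?_
    rw [CoarseMesh.weight, ← h, zero_mul] at hx
    exact lt_irrefl _ hx
  obtain ⟨j, hj⟩ : ∃ j, gradient (T.hat j) x ≠ 0 := by
    by_contra! h
    simp [CoarseMesh.weight, h] at hx
  set v := gradient (T.hat j) x
  have hv : 0 < ‖v - 0‖ := by rw [sub_zero]; exact norm_pos_iff.2 hj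
  have h1 := (hm v 0).trans ((real_inner_le_norm _ _).trans
    (mul_le_mul_of_nonneg_right (hl v 0) (norm_nonneg _)))
  have h2 : C₂ * (A.bar x * ‖v - 0‖ ^ 2) ≤ C₁ * (A.bar x * ‖v - 0‖ ^ 2) := by
    calc _ = C₂ * A.bar x * ‖v - 0‖ ^ 2 := by ring
      _ ≤ _ := h1
      _ = _ := by ring
  exact le_of_mul_le_mul_right h2 (by positivity)

/-- Testing the Poincaré inequality with the inf-sup function of a nonzero `U ∈ V_aux` shows that
its constant cannot be small. -/
theorem one_le_mul_poincare (hΩ : IsOpen Ω) (hw : ∀ᵐ x ∂volume.restrict Ω, 0 < T.weight A x)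
    {Cas Ck : ℝ} (hCk : 0 ≤ Ck) (hI : InfSup A B Cas) (hK : WeightedPoincare T A Ck)
    {U : E d → ℝ} (hU : U ∈ B.aux Set.univ) (hS : 0 < sNorm (T.weight A) Ω U) :
    1 ≤ Cas * Ck := by
  have hkt := memLp_weight hΩ T A
  have hkt0 := weight_nonneg hw
  have hUm := B.memLp_of_mem_aux hΩ hU
  obtain ⟨k, hk⟩ : ∃ k, sNorm (T.weight A) (T.cell k) U ≠ 0 := by
    by_contra! h
    have h1 := sNorm_sq_eq_sum_cell (T := T) hΩ hw hUm
    simp [h] at h1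
    exact hS.ne' h1
  obtain ⟨U', hU', hcell⟩ := B.exists_mem_aux_singleton hU k
  have hm := T.measurableSet_cell k
  obtain ⟨w, hw1, hw2⟩ := hI k U' hU'
  set s := sNorm (T.weight A) (T.cell k) U'
  have hs : 0 < s := by
    refine (sNorm_nonneg _ _ _).lt_of_ne fun h => hk ?_
    rw [sNorm_congr hm hcell]
    exact h.symm
  have hcs := (le_abs_self _).trans (abs_sForm_le hkt hkt0 (T.cell_subset k)
    (B.memLp_of_mem_aux hΩ hU') (w.memLp_val_restrict Ω))
  have hKw := hK (w.ofSubset (T.cell_subset k))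
  have e1 : sNorm (T.weight A) Ω w.val = sNorm (T.weight A) (T.cell k) w.val :=
    sNorm_eq_of_subset w hm hΩ.measurableSet (T.cell_subset k) _
  have e2 : aNorm A Ω w.grad = aNorm A (T.cell k) w.grad :=
    aNorm_eq_of_subset w hm hΩ.measurableSet (T.cell_subset k) _
  have e3 : sNorm (T.weight A) (T.cell k) w.val ≤ Ck * aNorm A (T.cell k) w.grad := by
    rw [← e1, ← e2]; exact hKw
  have h1 : 1 * s ^ 2 ≤ Cas * Ck * s ^ 2 := by
    calc 1 * s ^ 2 = s ^ 2 := one_mul _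
      _ ≤ s * sNorm (T.weight A) (T.cell k) w.val := hw1.trans hcs
      _ ≤ s * (Ck * (Cas * s)) := by gcongr; exact e3.trans (by gcongr)
      _ = _ := by ring
  exact le_of_mul_le_mul_right h1 (by positivity)

section Solution

variable {M : ℕ} {f U p : E d → ℝ} {F₁ : (i : ι) → H10 (T.region i M)} {F₂ : ι → E d → ℝ}
  {χ : ι → E d → ℝ} {Cχ Cas Ck : ℝ}
variable (hN : IsNLMCSolution A B M f U F₁ F₂) (hχ : IsGluing T Cχ χ) (hΩ : IsOpen Ω)
  (hρ : 0 < ρ) (hH : 0 < H) (hw : ∀ᵐ x ∂volume.restrict Ω, 0 < T.weight A x)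
  (hP : CoarseApproximation A B Cas) (hM : 1 ≤ M)

include hN hχ hΩ hρ hH hw hP hM in
/-- The coarse solution is controlled by the glued one, since the local solutions reproduce its
continua. -/
theorem sNorm_coarse_sq_le {z : H10 Ω} (hz : ∀ x ∈ Ω, z.val x = ∑ i, χ i x * (F₁ i).val x) :
    sNorm (T.weight A) Ω U ^ 2
      ≤ 2 * sNorm (T.weight A) Ω z.val ^ 2 + 2 * ((Cas * H) ^ 2 * jumpSq A F₁) := by
  have hkt := memLp_weight hΩ T A
  have hkt0 := weight_nonneg hw
  have hUm := B.memLp_of_mem_aux hΩ hN.mem_aux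
  have hzm := z.memLp_val_restrict Ω
  have hcell : ∀ k, sNorm (T.weight A) (T.cell k) U ^ 2
      ≤ 2 * sNorm (T.weight A) (T.cell k) z.val ^ 2
        + 2 * ((Cas * H) ^ 2 * ∑ i ∈ T.layerFinset k 1,
            aNorm A (T.cell k) (fun x => (F₁ k).grad x - (F₁ i).grad x) ^ 2) := by
    intro k
    have hFm := (F₁ k).memLp_val_restrict Ω
    have hm := T.measurableSet_cell k
    obtain ⟨U', hU', hc⟩ := B.exists_mem_aux_singleton hN.mem_aux k
    have h1 := (hN.downscaling k).constraint_cell hΩ hN.mem_aux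
      (T.self_mem_layer hρ hH k M) hU'
    have h2 : sNorm (T.weight A) (T.cell k) U ^ 2
        ≤ sNorm (T.weight A) (T.cell k) (F₁ k).val * sNorm (T.weight A) (T.cell k) U := by
      rw [sNorm_sq hkt0 (T.cell_subset k),
        sForm_congr hm (fun _ _ => rfl) hc, ← h1, sNorm_congr hm hc]
      exact (le_abs_self _).trans (abs_sForm_le hkt hkt0 (T.cell_subset k) hFm
        (B.memLp_of_mem_aux hΩ hU'))
    have h3 : sNorm (T.weight A) (T.cell k) U ≤ sNorm (T.weight A) (T.cell k) (F₁ k).val := by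
      rcases (sNorm_nonneg (T.weight A) (T.cell k) U).eq_or_lt with h | h
      · rw [← h]; exact sNorm_nonneg _ _ _
      · rw [sq] at h2; exact le_of_mul_le_mul_right h2 h
    have h4 : sNorm (T.weight A) (T.cell k) (F₁ k).val ^ 2
        ≤ 2 * sNorm (T.weight A) (T.cell k) z.val ^ 2
          + 2 * sNorm (T.weight A) (T.cell k) (fun x => (F₁ k).val x - z.val x) ^ 2 := by
      have := sNorm_add_sq_le hkt hkt0 (T.cell_subset k) hzm
        (v := fun x => (F₁ k).val x - z.val x) (hFm.sub hzm)
      simp only [add_sub_cancel] at this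
      exact this
    have h5 : sNorm (T.weight A) (T.cell k) (fun x => (F₁ k).val x - z.val x)
        = sNorm (T.weight A) (T.cell k) (fun x => z.val x - (F₁ k).val x) := by
      unfold sNorm sForm
      congr 2; ext x; ring
    have h6 := sNorm_glued_sub_sq_le hN hχ hΩ hρ hH hw hP hM hz k
    have h7 := pow_le_pow_left₀ (sNorm_nonneg _ _ _) h3 2
    rw [h5] at h4
    linarith
  rw [sNorm_sq_eq_sum_cell (T := T) hΩ hw hUm, sNorm_sq_eq_sum_cell (T := T) hΩ hw hzm, jumpSq,
    Finset.mul_sum, Finset.mul_sum, Finset.mul_sum, ← Finset.sum_add_distrib]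
  exact Finset.sum_le_sum fun k _ => hcell k

end Solution

end

/-! ### Constants and absorption -/

section

/-- The square of the localization factor drops below any fixed multiple of `H² / X⁴` once `M` is at
least a multiple of `log H⁻¹ + log X`. The bound `H ≤ 1 / 2` lets the logarithm absorb the
constants. -/
theorem exists_forall_mul_pow_le (d : ℕ) {q G : ℝ} (hq0 : 0 < q) (hq1 : q < 1) (hG : 0 < G) :
    ∃ c : ℝ, 0 < c ∧ ∀ (M : ℕ) (H X : ℝ), 0 < H → H ≤ 1 / 2 → 1 ≤ X →
      c * (Real.log H⁻¹ + Real.log X) ≤ M → G * (q ^ M * (M : ℝ) ^ d) * X ^ 4 ≤ H ^ 2 := by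
  set r := √q with hr
  have hr0 : 0 < r := Real.sqrt_pos.2 hq0
  have hr1 : r < 1 := (Real.sqrt_lt' one_pos).2 (by simpa using hq1)
  have hrr : r * r = q := Real.mul_self_sqrt hq0.le
  obtain ⟨b, hb⟩ := (tendsto_pow_const_mul_const_pow_of_abs_lt_one d
    (show |r| < 1 by rwa [abs_of_pos hr0])).bddAbove_range
  have hb' : ∀ M : ℕ, (M : ℝ) ^ d * r ^ M ≤ max b 1 := fun M =>
    (hb ⟨M, rfl⟩).trans (le_max_left _ _)
  set K := max (G * max b 1) 1 with hK
  have hK1 : 1 ≤ K := le_max_right _ _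
  have ha : 0 < -Real.log r := neg_pos.2 (Real.log_neg hr0 hr1)
  have hl2 : 0 < Real.log 2 := Real.log_pos one_lt_two
  have hlK : 0 ≤ Real.log K := Real.log_nonneg hK1
  refine ⟨(4 + Real.log K / Real.log 2) / (-Real.log r), by positivity, ?_⟩
  intro M H X hH hH2 hX hM
  have hX0 : 0 < X := one_pos.trans_le hX
  have hlX : 0 ≤ Real.log X := Real.log_nonneg hX
  have hlH : Real.log 2 ≤ Real.log H⁻¹ := by
    refine Real.log_le_log two_pos ?_
    rw [le_inv_comm₀ two_pos hH]
    simpa using hH2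
  set L := Real.log H⁻¹ + Real.log X
  have h1 : (4 + Real.log K / Real.log 2) * L ≤ -Real.log r * M := by
    rw [div_mul_eq_mul_div, div_le_iff₀ ha] at hM
    linarith
  have h2 : Real.log K ≤ Real.log K / Real.log 2 * L := by
    have : Real.log K / Real.log 2 * Real.log 2 ≤ Real.log K / Real.log 2 * L :=
      mul_le_mul_of_nonneg_left (by linarith) (by positivity)
    rwa [div_mul_cancel₀ _ hl2.ne'] at this
  have h3 : K * r ^ M * X ^ 4 ≤ H ^ 2 := by
    rw [← Real.log_le_log_iff (by positivity) (by positivity), Real.log_mul (by positivity)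
      (by positivity), Real.log_mul (by positivity) (by positivity), Real.log_pow, Real.log_pow,
      Real.log_pow]
    have : Real.log H = -Real.log H⁻¹ := by rw [Real.log_inv, neg_neg]
    rw [this]
    push_cast
    linarith
  calc G * (q ^ M * (M : ℝ) ^ d) * X ^ 4
      = G * ((M : ℝ) ^ d * r ^ M) * r ^ M * X ^ 4 := by rw [← hrr, mul_pow]; ring
    _ ≤ G * max b 1 * r ^ M * X ^ 4 := by gcongr; exact hb' M
    _ ≤ K * r ^ M * X ^ 4 := by gcongr; exact le_max_left _ _
    _ ≤ H ^ 2 := h3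

theorem sq_rpow_half {a : ℝ} (ha : 0 ≤ a) (n : ℕ) : (a ^ ((n : ℝ) / 2)) ^ 2 = a ^ n := by
  rw [← Real.rpow_natCast (a ^ ((n : ℝ) / 2)) 2, ← Real.rpow_mul ha]
  norm_num

/-- The constant of the bound on the discrepancy of the local solutions. -/
def jumpConst (d : ℕ) (ρ Cas : ℝ) : ℝ := √(8 * (2 / ρ) ^ d * Cas ^ 2 * (2 / ρ) ^ d)

/-- The constant of the gluing and consistency errors. -/
def glueConst (d : ℕ) (ρ Cas Cχ Hmax : ℝ) : ℝ :=
  √(2 * Cas ^ 2 + 2 * Cχ * Cas ^ 4 * Hmax ^ 2)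
    + √((2 / ρ) ^ d * (4 * Cas ^ 2 + (4 * Cχ + 2 * Cas ^ 2)))

/-- The constant of the error estimate. The second summand makes the cutoff argument work with the
rate `1 - C⁻¹ C₁⁻¹ C₂`. -/
def errConst (d ν : ℕ) (ρ Cas Cχ Hmax : ℝ) : ℝ :=
  2 + (√ν * Cas * Hmax + Cas ^ 2 * Hmax) + 2 * Cas
    + glueConst d ρ Cas Cχ Hmax * jumpConst d ρ Cas

section Constants

variable {d ν : ℕ} {ρ Cas Cχ Hmax : ℝ}

theorem jumpConst_nonneg : 0 ≤ jumpConst d ρ Cas := Real.sqrt_nonneg _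

theorem glueConst_nonneg : 0 ≤ glueConst d ρ Cas Cχ Hmax :=
  add_nonneg (Real.sqrt_nonneg _) (Real.sqrt_nonneg _)

variable (hCas : 0 < Cas) (hHmax : 0 < Hmax)

include hCas hHmax in
theorem two_le_errConst : 2 ≤ errConst d ν ρ Cas Cχ Hmax := by
  have := mul_nonneg (glueConst_nonneg (d := d) (ρ := ρ) (Cas := Cas) (Cχ := Cχ) (Hmax := Hmax))
    (jumpConst_nonneg (d := d) (ρ := ρ) (Cas := Cas))
  have h1 : 0 ≤ √(ν : ℝ) * Cas * Hmax + Cas ^ 2 * Hmax := by positivity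
  unfold errConst
  linarith

variable {C₁ C₂ C q H Ck S jump : ℝ} {M : ℕ}

/-- The rate `q = 1 - C⁻¹ C₁⁻¹ C₂` is at least the one that the cutoff argument provides. -/
theorem rate_condition (hCas : 0 ≤ Cas) (hC₁ : 0 < C₁) (hC₂ : 0 < C₂) (h21 : C₂ ≤ C₁)
    (hHH : H ≤ Hmax) (hC : 1 + (√(ν : ℝ) * Cas * Hmax + Cas ^ 2 * Hmax) ≤ C) (hC0 : 0 < C)
    (hq : q = 1 - C⁻¹ * C₁⁻¹ * C₂) :
    C₁ * (√(ν : ℝ) * Cas * H + Cas ^ 2 * H)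
      ≤ q * (C₂ + C₁ * (√(ν : ℝ) * Cas * H + Cas ^ 2 * H)) := by
  set L := √(ν : ℝ) * Cas * H + Cas ^ 2 * H
  have hL : L ≤ √(ν : ℝ) * Cas * Hmax + Cas ^ 2 * Hmax := by
    simp only [L]; gcongr
  have h1 : C₂ + C₁ * L ≤ C * C₁ := by
    have := mul_le_mul_of_nonneg_left (hL.trans (le_sub_iff_add_le'.2 hC)) hC₁.le
    linarith
  have h2 : C⁻¹ * C₁⁻¹ * C₂ * (C₂ + C₁ * L) ≤ C₂ := by
    calc C⁻¹ * C₁⁻¹ * C₂ * (C₂ + C₁ * L) ≤ C⁻¹ * C₁⁻¹ * C₂ * (C * C₁) := by gcongr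
      _ = C₂ := by field_simp
  rw [hq, sub_mul, one_mul]
  linarith

/-- The bound on the discrepancy in terms of the localization factor `q^(M/2) M^(d/2)`; passing from
`q^(M-1)` to `q^M` costs a factor `2`. -/
theorem sqrt_jump_le (hρ : 0 < ρ) (hCas : 0 < Cas) (hC₁ : 0 < C₁) (hC₂ : 0 < C₂) (hS : 0 ≤ S)
    (hq : 1 / 2 ≤ q) (hM : 1 ≤ M)
    (hj : jump ≤ q ^ (M - 1) * (4 * ((1 + 1) / ρ) ^ d
      * ((Cas * (C₁ / C₂)) ^ 2 * (((M + 1) / ρ) ^ d * S ^ 2)))) :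
    √jump ≤ jumpConst d ρ Cas * (C₁ / C₂) * (q ^ ((M : ℝ) / 2) * (M : ℝ) ^ ((d : ℝ) / 2)) * S := by
  have hq0 : 0 < q := by linarith
  have hM' : (1 : ℝ) ≤ M := by exact_mod_cast hM
  have hj0 := jumpConst_nonneg (d := d) (ρ := ρ) (Cas := Cas)
  refine Real.sqrt_le_iff.2 ⟨by positivity, hj.trans ?_⟩
  have h1 : q ^ (M - 1) ≤ 2 * q ^ M := by
    obtain ⟨n, rfl⟩ := Nat.exists_eq_add_of_le' hM
    rw [Nat.add_sub_cancel, pow_succ]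
    have := mul_le_mul_of_nonneg_left hq (pow_nonneg hq0.le n)
    linarith
  have h2 : ((M + 1 : ℝ) / ρ) ^ d ≤ (2 / ρ) ^ d * (M : ℝ) ^ d := by
    rw [← mul_pow]
    refine pow_le_pow_left₀ (by positivity) ?_ d
    rw [div_mul_eq_mul_div]
    gcongr
    linarith
  have h3 : (jumpConst d ρ Cas * (C₁ / C₂) * (q ^ ((M : ℝ) / 2) * (M : ℝ) ^ ((d : ℝ) / 2)) * S) ^ 2
      = jumpConst d ρ Cas ^ 2 * (C₁ / C₂) ^ 2 * (q ^ M * (M : ℝ) ^ d) * S ^ 2 := by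
    rw [mul_pow, mul_pow, mul_pow, mul_pow (q ^ ((M : ℝ) / 2)), sq_rpow_half hq0.le]
    have : ((M : ℝ) ^ ((d : ℝ) / 2)) ^ 2 = (M : ℝ) ^ d := sq_rpow_half (by positivity) d
    rw [this]
  rw [h3, jumpConst, Real.sq_sqrt (by positivity)]
  calc q ^ (M - 1) * (4 * ((1 + 1) / ρ) ^ d * ((Cas * (C₁ / C₂)) ^ 2 * (((M + 1) / ρ) ^ d * S ^ 2)))
      ≤ (2 * q ^ M) * (4 * ((1 + 1) / ρ) ^ d
        * ((Cas * (C₁ / C₂)) ^ 2 * (((2 / ρ) ^ d * (M : ℝ) ^ d) * S ^ 2))) := by gcongr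
    _ = _ := by rw [one_add_one_eq_two]; ring

/-- As `Cas * Ck` is at least `1`, the terms without a factor `Ck` may be given one. -/
theorem glue_factor_le (hρ : 0 < ρ) (hCas : 0 < Cas) (hCχ : 0 < Cχ) (hH : 0 < H) (hHH : H ≤ Hmax)
    (hCk : 0 < Ck) (h1 : 1 ≤ Cas * Ck) :
    √(2 + 2 * Cχ * (Cas * H) ^ 2) + √(((1 + 1) / ρ) ^ d * (4 + (4 * Cχ + 2 * Cas ^ 2) * Ck ^ 2))
      ≤ glueConst d ρ Cas Cχ Hmax * Ck := by
  have h2 : 1 ≤ Cas ^ 2 * Ck ^ 2 := by rw [← mul_pow]; exact one_le_pow₀ h1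
  have h3 : H ^ 2 ≤ Hmax ^ 2 := pow_le_pow_left₀ hH.le hHH 2
  have key : ∀ {a b : ℝ}, a ≤ b * Ck ^ 2 → √a ≤ √b * Ck := by
    intro a b hab
    calc √a ≤ √(b * Ck ^ 2) := Real.sqrt_le_sqrt hab
      _ = √b * Ck := by rw [Real.sqrt_mul' _ (sq_nonneg _), Real.sqrt_sq hCk.le]
  rw [glueConst, add_mul (√_)]
  refine add_le_add (key ?_) (key ?_)
  · have h4 : 2 * Cχ * (Cas * H) ^ 2 * 1 ≤ 2 * Cχ * (Cas * Hmax) ^ 2 * (Cas ^ 2 * Ck ^ 2) := by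
      gcongr
    calc _ ≤ 2 * (Cas ^ 2 * Ck ^ 2) + 2 * Cχ * (Cas * Hmax) ^ 2 * (Cas ^ 2 * Ck ^ 2) := by linarith
      _ = _ := by ring
  · rw [one_add_one_eq_two, mul_assoc]
    gcongr
    linarith

end Constants

/-- The absorption argument of the second estimate: the norm `S` of the coarse solution is bounded
in terms of `a = ‖u‖_a` and of the error `e` itself, which the small localization factor `t` allows
to move to the left-hand side. -/
theorem error_le_of_small {e a S R H Ck j g κ t Cas C₂ sj : ℝ} (he : 0 ≤ e) (ha : 0 ≤ a)
    (hS : 0 ≤ S) (hR : 0 ≤ R) (hH : 0 < H) (hH2 : H ≤ 1 / 2) (hCk : 0 < Ck) (hCas : 0 < Cas)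
    (hC₂ : 0 < C₂) (hsj : 0 ≤ sj) (hsj' : sj ≤ j * κ * t * S)
    (hcoarse : S ^ 2 ≤ 2 * (Ck ^ 2 * (2 * a ^ 2 + 2 * e ^ 2)) + 2 * ((Cas * H) ^ 2 * sj ^ 2))
    (herr : e ≤ Cas * C₂⁻¹ * H * R + g * j * Ck * κ ^ 2 * t * S)
    (ht1 : 8 * (g * j * κ ^ 2) * t * Ck ^ 2 ≤ H) (ht2 : 4 * Cas * (j * κ * t) ≤ 1)
    (hg : 0 ≤ g * j * κ ^ 2 * t) :
    e ≤ 2 * Cas * (H * (C₂⁻¹ * R)) + H * a := by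
  have h1 : S ≤ 2 * Ck * (a + e) + 2 * (Cas * H) * sj := by
    refine (abs_le_of_sq_le_sq' (hcoarse.trans ?_) (by positivity)).2
    have : 0 ≤ 2 * Ck * (a + e) * (2 * (Cas * H) * sj) := by positivity
    have h3 : 0 ≤ Ck ^ 2 * (a * e) := by positivity
    have h4 : 0 ≤ (Cas * H) ^ 2 * sj ^ 2 := by positivity
    nlinarith
  have h2 : 2 * (Cas * H) * sj ≤ 1 / 2 * S := by
    have e1 : 2 * (Cas * H) * sj ≤ 2 * (Cas * (1 / 2)) * (j * κ * t * S) := by gcongr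
    have e2 := mul_le_mul_of_nonneg_right ht2 hS
    linarith
  have h3 : S ≤ 4 * Ck * (a + e) := by linarith
  have h4 : g * j * Ck * κ ^ 2 * t * S ≤ H / 2 * (a + e) := by
    calc g * j * Ck * κ ^ 2 * t * S = (g * j * κ ^ 2 * t) * Ck * S := by ring
      _ ≤ (g * j * κ ^ 2 * t) * Ck * (4 * Ck * (a + e)) := by gcongr
      _ = (8 * (g * j * κ ^ 2) * t * Ck ^ 2) / 2 * (a + e) := by ring
      _ ≤ H / 2 * (a + e) := by gcongr
  have h5 : H / 2 * e ≤ 1 / 4 * e := mul_le_mul_of_nonneg_right (by linarith) he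
  have h6 : 0 ≤ Cas * C₂⁻¹ * H * R := by positivity
  have h7 : 0 ≤ H * a := by positivity
  have h8 : 2 * Cas * (H * (C₂⁻¹ * R)) = 2 * (Cas * C₂⁻¹ * H * R) := by ring
  rw [h8]
  linarith

end

end NLMC

end

theorem mainTheorem1 (d ν : ℕ) (ρ Cas Cχ Hmax : ℝ) (hρ : 0 < ρ) (hCas : 0 < Cas)
    (hCχ : 0 < Cχ) (hHmax : 0 < Hmax) :
    ∃ C : ℝ, 1 < C ∧ ∀ C₁ C₂ : ℝ, 0 < C₁ → 0 < C₂ → ∃ c : ℝ, 0 < c ∧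
      ∀ (Ω : Set (NLMC.E d)) (_ : IsOpen Ω) (ι J : Type) [Fintype ι] [Fintype J]
        (H : ℝ) (_ : 0 < H) (_ : H ≤ Hmax) (T : NLMC.CoarseMesh Ω ι J H ρ ν)
        (A : NLMC.Flux Ω C₁ C₂) (_ : ∀ᵐ x ∂volume.restrict Ω, 0 < T.weight A x)
        (B : NLMC.Continua T) (Ck : ℝ) (_ : 0 < Ck)
        (_ : NLMC.CoarseApproximation A B Cas) (_ : NLMC.InfSup A B Cas)
        (_ : NLMC.WeightedPoincare T A Ck)
        (f : NLMC.E d → ℝ) (_ : AEStronglyMeasurable f (volume.restrict Ω))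
        (_ : IntegrableOn (fun x => T.weight A x * (f x / T.weight A x) ^ 2) Ω)
        (u : NLMC.H10 Ω) (_ : NLMC.IsWeakSolution A f u)
        (M : ℕ) (_ : 1 ≤ M) (U : NLMC.E d → ℝ)
        (F₁ : (i : ι) → NLMC.H10 (T.region i M)) (F₂ : ι → NLMC.E d → ℝ)
        (_ : NLMC.IsNLMCSolution A B M f U F₁ F₂)
        (χ : ι → NLMC.E d → ℝ) (_ : NLMC.IsGluing T Cχ χ)
        (p : NLMC.E d → ℝ)
        (_ : NLMC.IsProj (T.weight A) Ω (B.aux Set.univ) (fun x => f x / T.weight A x) p),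
        ∃ ums : NLMC.H10 Ω,
          ums.val =ᵐ[volume.restrict Ω] (fun x => ∑ i, χ i x * (F₁ i).val x) ∧
          NLMC.aNorm A Ω (fun x => ums.grad x - u.grad x) ≤
            C * C₂⁻¹ * H * NLMC.sNorm (T.weight A) Ω (fun x => f x / T.weight A x - p x)
            + NLMC.locError₁ C C₁ C₂ d M (NLMC.sNorm (T.weight A) Ω U)
            + NLMC.locError₂ C Ck C₁ C₂ d M (NLMC.sNorm (T.weight A) Ω U) ∧
          (H ≤ 1 / 2 → c * (Real.log H⁻¹ + Real.log (max 1 Ck)) ≤ M →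
            NLMC.aNorm A Ω (fun x => ums.grad x - u.grad x) ≤
              C * H * (C₂⁻¹ * NLMC.sNorm (T.weight A) Ω (fun x => f x / T.weight A x - p x)
                + NLMC.aNorm A Ω u.grad)) := by
  set C := NLMC.errConst d ν ρ Cas Cχ Hmax with hCdef
  set j := NLMC.jumpConst d ρ Cas
  set g := NLMC.glueConst d ρ Cas Cχ Hmax
  have hC2 : 2 ≤ C := NLMC.two_le_errConst hCas hHmax
  have hC0 : 0 < C := by linarith
  have hj0 : 0 ≤ j := NLMC.jumpConst_nonneg
  have hg0 : 0 ≤ g := NLMC.glueConst_nonneg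
  have hgj : 0 ≤ g * j := mul_nonneg hg0 hj0
  have hc0 : 0 ≤ √(ν : ℝ) * Cas * Hmax + Cas ^ 2 * Hmax := by positivity
  have hC : C = 2 + (√(ν : ℝ) * Cas * Hmax + Cas ^ 2 * Hmax) + 2 * Cas + g * j := rfl
  refine ⟨C, by linarith, fun C₁ C₂ hC₁ hC₂ => ?_⟩
  set q := 1 - C⁻¹ * C₁⁻¹ * C₂ with hq
  set κ := C₁ / C₂ with hκ
  have hκ0 : 0 < κ := div_pos hC₁ hC₂
  set G := 8 * (g * j * κ ^ 2) + 4 * Cas * (j * κ) + 1 with hG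
  have hG0 : 0 < G := by positivity
  have hq1 : q < 1 := by
    have : 0 < C⁻¹ * C₁⁻¹ * C₂ := by positivity
    linarith
  -- for `C₁ < C₂` the domain is a null set, and `c` does not matter
  obtain ⟨c, hc, hcM⟩ : ∃ c : ℝ, 0 < c ∧ (0 < q → ∀ (M : ℕ) (H X : ℝ), 0 < H → H ≤ 1 / 2 → 1 ≤ X →
      c * (Real.log H⁻¹ + Real.log X) ≤ M → G ^ 2 * (q ^ M * (M : ℝ) ^ d) * X ^ 4 ≤ H ^ 2) := by
    by_cases hq0 : 0 < q
    · obtain ⟨c, hc, h⟩ := NLMC.exists_forall_mul_pow_le d hq0 hq1 (pow_pos hG0 2)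
      exact ⟨c, hc, fun _ => h⟩
    · exact ⟨1, one_pos, fun h => absurd h hq0⟩
  refine ⟨c, hc, ?_⟩
  intro Ω hΩ ι J _ _ H hH hHH T A hw B Ck hCk hP hI hK f hf hfi u hu M hM U F₁ F₂ hN χ hχ p hp
  obtain ⟨z, hz1, hz2⟩ := hχ.exists_sum_mul hΩ hw F₁
  refine ⟨z, (ae_restrict_mem hΩ.measurableSet).mono hz1, ?_⟩
  have herr := NLMC.mul_aNorm_error_le hN hχ hΩ hρ hH hw hP hM hf hfi hp.1 hI hK hC₁.le hCas.le
    hCχ.le hu hz2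
  have hjump := NLMC.jumpSq_nonneg A F₁
  obtain ⟨e, he⟩ : ∃ e, e = NLMC.aNorm A Ω (fun x => z.grad x - u.grad x) := ⟨_, rfl⟩
  obtain ⟨R, hR⟩ : ∃ R, R = NLMC.sNorm (T.weight A) Ω (fun x => f x / T.weight A x - p x) :=
    ⟨_, rfl⟩
  obtain ⟨S, hS⟩ : ∃ S, S = NLMC.sNorm (T.weight A) Ω U := ⟨_, rfl⟩
  obtain ⟨a, ha⟩ : ∃ a, a = NLMC.aNorm A Ω u.grad := ⟨_, rfl⟩
  have he0 : 0 ≤ e := he ▸ NLMC.aNorm_nonneg _ _ _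
  have ha0 : 0 ≤ a := ha ▸ NLMC.aNorm_nonneg _ _ _
  have hR0 : 0 ≤ R := hR ▸ NLMC.sNorm_nonneg _ _ _
  have hS0 : 0 ≤ S := hS ▸ NLMC.sNorm_nonneg _ _ _
  rw [← he, ← hR] at herr
  rw [← he, ← hR, ← hS, ← ha]
  have hsrc : Cas * C₂⁻¹ * H * R ≤ C * C₂⁻¹ * H * R := by gcongr; linarith
  rcases hS0.eq_or_lt with h0 | h0
  · -- if `U = 0`, then all the local solutions vanish
    have hJ0 : NLMC.jumpSq A F₁ = 0 := by
      refine le_antisymm ((NLMC.jumpSq_le hN hΩ hρ hH hw hP hI hC₁.le hC₂ hCas.le hM zero_le_one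
        (by linarith)).trans_eq ?_) hjump
      rw [← hS, ← h0]; simp
    rw [hJ0, Real.sqrt_zero, mul_zero, zero_mul, zero_add] at herr
    have h1 : e ≤ Cas * C₂⁻¹ * H * R := by
      refine le_of_mul_le_mul_left (herr.trans_eq ?_) hC₂
      field_simp
    refine ⟨?_, fun _ _ => ?_⟩
    · rw [← h0]
      simp only [NLMC.locError₁, NLMC.locError₂, mul_zero, add_zero]
      exact h1.trans hsrc
    · have : 0 ≤ C * H * a := by positivity
      linarith
  -- for `U ≠ 0`, the domain is not a null set, which orders `C₁` and `C₂` and bounds `Ck` below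
  have hvol : volume.restrict Ω ≠ 0 := fun h => by
    rw [hS, NLMC.sNorm, NLMC.sForm, h] at h0
    simp at h0
  have h21 : C₂ ≤ C₁ := A.monotonicity_le_lipschitz hw hvol
  have hCk1 : 1 ≤ Cas * Ck := NLMC.one_le_mul_poincare hΩ hw hCk.le hI hK hN.mem_aux (hS ▸ h0)
  -- the factor `2` in `C` keeps the rate away from zero
  have hq2 : 1 / 2 ≤ q := by
    have : C⁻¹ * C₁⁻¹ * C₂ ≤ 2⁻¹ * C₁⁻¹ * C₁ := by gcongr
    rw [mul_assoc (2⁻¹ : ℝ), inv_mul_cancel₀ hC₁.ne'] at this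
    linarith
  have hq0 : 0 < q := by linarith
  have hrate := NLMC.rate_condition (ν := ν) hCas.le hC₁ hC₂ h21 hHH (by linarith) hC0 hq
  set t := q ^ ((M : ℝ) / 2) * (M : ℝ) ^ ((d : ℝ) / 2) with ht
  have ht0 : 0 ≤ t := by positivity
  have hJ : √(NLMC.jumpSq A F₁) ≤ j * κ * t * S :=
    NLMC.sqrt_jump_le hρ hCas hC₁ hC₂ hS0 hq2 hM (hS ▸
      NLMC.jumpSq_le hN hΩ hρ hH hw hP hI hC₁.le hC₂ hCas.le hM hq0.le hrate)
  have herr' : e ≤ Cas * C₂⁻¹ * H * R + g * j * Ck * κ ^ 2 * t * S := by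
    refine le_of_mul_le_mul_left (herr.trans ?_) hC₂
    calc _ ≤ C₁ * (j * κ * t * S) * (g * Ck) + Cas * H * R := by
          gcongr
          exact NLMC.glue_factor_le hρ hCas hCχ hH hHH hCk hCk1
      _ = _ := by rw [hκ]; field_simp; ring
  refine ⟨herr'.trans ?_, fun hH2 hMc => ?_⟩
  · have h1 : 0 ≤ NLMC.locError₁ C C₁ C₂ d M S := by unfold NLMC.locError₁; positivity
    have h2 : g * j * Ck * κ ^ 2 * t * S ≤ NLMC.locError₂ C Ck C₁ C₂ d M S := by
      calc g * j * Ck * κ ^ 2 * t * S ≤ C * Ck * κ ^ 2 * t * S := by gcongr; linarith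
        _ = _ := by rw [NLMC.locError₂, ← hq, ht, hκ]; ring
    linarith
  · set X := max 1 Ck with hX
    have hX1 : 1 ≤ X := le_max_left _ _
    have hGt : G * t * X ^ 2 ≤ H := by
      refine (abs_le_of_sq_le_sq' (le_of_eq_of_le ?_ (hcM hq0 M H X hH hH2 hX1 hMc)) hH.le).2
      have e1 : t ^ 2 = q ^ M * (M : ℝ) ^ d := by
        rw [ht, mul_pow, NLMC.sq_rpow_half hq0.le, NLMC.sq_rpow_half M.cast_nonneg]
      rw [← e1]; ring
    have ht1 : 8 * (g * j * κ ^ 2) * t * Ck ^ 2 ≤ H := by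
      refine le_trans ?_ hGt
      have : 0 ≤ 4 * Cas * (j * κ) := by positivity
      gcongr
      · linarith
      · exact le_max_right _ _
    have ht2 : 4 * Cas * (j * κ * t) ≤ 1 := by
      calc 4 * Cas * (j * κ * t) = 4 * Cas * (j * κ) * t * 1 ^ 2 := by ring
        _ ≤ G * t * X ^ 2 := by
          have : 0 ≤ 8 * (g * j * κ ^ 2) := by positivity
          gcongr
          linarith
        _ ≤ 1 := by linarith
    have hcoarse : S ^ 2 ≤ 2 * (Ck ^ 2 * (2 * a ^ 2 + 2 * e ^ 2))
        + 2 * ((Cas * H) ^ 2 * √(NLMC.jumpSq A F₁) ^ 2) := by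
      rw [Real.sq_sqrt hjump, hS]
      refine (NLMC.sNorm_coarse_sq_le hN hχ hΩ hρ hH hw hP hM hz1).trans ?_
      have hb := NLMC.bar_nonneg_of_weight_pos hw
      have e1 : NLMC.aNorm A Ω z.grad ^ 2 ≤ 2 * a ^ 2 + 2 * e ^ 2 := by
        have := NLMC.aNorm_add_sq_le A hb subset_rfl (u.memLp_grad_restrict Ω)
          (D₂ := fun x => z.grad x - u.grad x)
          ((z.memLp_grad_restrict Ω).sub (u.memLp_grad_restrict Ω))
        simp only [add_sub_cancel] at this
        rw [ha, he]
        exact this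
      have e2 : NLMC.sNorm (T.weight A) Ω z.val ^ 2 ≤ Ck ^ 2 * (2 * a ^ 2 + 2 * e ^ 2) := by
        calc _ ≤ (Ck * NLMC.aNorm A Ω z.grad) ^ 2 :=
              pow_le_pow_left₀ (NLMC.sNorm_nonneg _ _ _) (hK z) 2
          _ ≤ _ := by rw [mul_pow]; gcongr
      linarith
    refine (NLMC.error_le_of_small he0 ha0 hS0 hR0 hH hH2 hCk hCas hC₂ (Real.sqrt_nonneg _) hJ
      hcoarse herr' ht1 ht2 (by positivity)).trans ?_
    have e1 : 2 * Cas * (H * (C₂⁻¹ * R)) ≤ C * (H * (C₂⁻¹ * R)) := by gcongr; linarith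
    have e2 : 1 * (H * a) ≤ C * (H * a) := by gcongr; linarith
    linarith
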